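/- Let $p\ge 1$ be an integer and let $L$ be a positively oriented simple closed contour in $\mathbb C$ with a regular parametrization $\gamma:\mathbb R\to\mathbb C$ of period $1$ and class $C^p$. Let $D^+$ be the inner domain of $L$, let $G\supset \overline{D^+}$ be open, let $a,b,f$ be analytic in $G$ with $a\ne 0$ in $D^+$, and let $0<\alpha\le 1$. For $t\in L$ the integral $\int_L \frac{x(\tau)\,d\tau}{(\tau-t)^p}$ is the Cauchy–Hadamard finite part, that is $$\lim_{v\to 0+}\left[\int_{L,\ |\tau-t|\ge v}\frac{x(\tau)\,d\tau}{(\tau-t)^p}+\frac{\xi(v)}{v^{p-1}}\right],$$ where $\xi$ is a polynomial of degree less than $p-1$ ($\xi=0$ if $p=1$) for which the limit exists; the value does not depend on $\xi$. Derivatives $x^{(k)}$ on $L$ are taken along $L$ with respect to the complex variable. Let $X$ be the class of functions $x$ that are continuous on $\overline{D^+}$, analytic in $D^+$, and of class $W^{p-1}H_\alpha$ on $L$ (that is, $x,x',\dots,x^{(p-1)}$ exist and are continuous on $L$, and $x^{(p-1)}$ is Hölder continuous on $L$ with exponent $\alpha$). Consider the equation $$a(t)x(t)+\frac{b(t)}{\pi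 i}\int_L\frac{x(\tau)\,d\tau}{(\tau-t)^p}=f(t),\qquad t\in L. \tag{1}$$ (i) For every $x\in X$ and $t\in L$ the finite part exists and $\displaystyle\frac1{\pi i}\int_L\frac{x(\tau)\,d\tau}{(\tau-t)^p}=\frac{x^{(p-1)}(t)}{(p-1)!}.$ (ii) Every solution $x\in X$ of (1) satisfies, on $L$ and in $D^+$, the equation $\frac{b}{(p-1)!}x^{(p-1)}+ax=f$, hence, at every point where $b\ne 0$, the ordinary differential equation $$x^{(p-1)}+(p-1)!\,\frac{a}{b}\,x=\frac{(p-1)!\,f}{b}.$$ (iii) If $b\ne 0$ on $\overline{D^+}$, then (1) has at least $p-1$ solutions in $X$ whose restrictions to $L$ are linearly independent over $\mathbb C$. (iv) If $p=1$ and $a+b\ne 0$ on $\overline{D^+}$, then $x=f/(a+b)$ belongs to $X$, solves (1), and is on $\overline{D^+}$ the only solution of (1) in $X$. (v) Let $p=2$. If $b\neq 0$ on $L$, then every solution $x\in X$ of (1) satisfies, for all $t_0,t\in L$, $$x(t)=e^{-\int_{t_0}^t\frac{a}{b}d\tau}\left[x(t_0)+\int_{t_0}^t\frac{f(\tau)}{b(\tau)}\,e^{\int_{t_0}^\tau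 \frac{a}{b}d\sigma}\,d\tau\right],$$ where the integrals are taken along $L$ (along $\gamma$ between any parameter values of $t_0$ and $t$). If $b\ne 0$ on $\overline{D^+}$, then for every $t_0\in L$ and every $c\in\mathbb C$ equation (1) has a solution $x\in X$ with $x(t_0)=c$, and it is given on $L$ by this formula with $x(t_0)=c$. -/

import Mathlib

open scoped NNReal Topology

noncomputable section

namespace Hypersingular

/-- The trace `L` of a closed curve `γ` of period `1`. -/
def trace (γ : ℝ → ℂ) : Set ℂ := Set.range γ

/-- The inner domain `D⁺` of a closed curve: the union of the bounded connected components of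
the complement of its trace. -/
def inside (γ : ℝ → ℂ) : Set ℂ :=
  {z | z ∉ trace γ ∧ Bornology.IsBounded (connectedComponentIn (trace γ)ᶜ z)}

/-- `γ` is a regular, `1`-periodic parametrization, of class `C^p`, of a simple closed contour
which is traversed in the positive direction (winding number one about the inner points). -/
structure IsSmoothContour (p : ℕ) (γ : ℝ → ℂ) : Prop where
  contDiff : ContDiff ℝ p γ
  periodic : Function.Periodic γ 1
  injOn : Set.InjOn γ (Set.Ico 0 1)
  deriv_ne_zero : ∀ s, deriv γ s ≠ 0
  positive : ∀ z ∈ inside γ,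
    ∫ s in (0 : ℝ)..1, deriv γ s / (γ s - z) = 2 * Real.pi * Complex.I

/-- The derivative of order `k` along the contour, with respect to the complex variable:
`φ'(t) = lim (φ(τ) - φ(t)) / (τ - t)` as `τ → t`, `τ ∈ L`, and so on. -/
def contourDeriv (γ : ℝ → ℂ) (k : ℕ) (x : ℂ → ℂ) (t : ℂ) : ℂ :=
  iteratedDerivWithin k x (trace γ) t

/-- The class `W^r H_α` on the contour: continuous derivatives along the contour up to order
`r`, the one of order `r` being Hölder continuous with exponent `α`. -/
def WHolder (γ : ℝ → ℂ) (r : ℕ) (α : ℝ≥0) (x : ℂ → ℂ) : Prop :=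
  ContDiffOn ℂ r x (trace γ) ∧ ∃ M : ℝ≥0, HolderOnWith M α (contourDeriv γ r x) (trace γ)

/-- The class in which solutions are sought: continuous on the closed inner domain, analytic in
the inner domain, and of class `W^{p-1} H_α` on the contour. -/
structure IsAdmissible (γ : ℝ → ℂ) (p : ℕ) (α : ℝ≥0) (x : ℂ → ℂ) : Prop where
  continuousOn : ContinuousOn x (closure (inside γ))
  analytic : AnalyticOnNhd ℂ x (inside γ)
  wHolder : WHolder γ (p - 1) α x

/-- The integral of `x(τ) / (τ - t)^p` over the part of the contour outside the disc of radius
`v` about `t`. -/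
def truncatedIntegral (γ : ℝ → ℂ) (p : ℕ) (x : ℂ → ℂ) (t : ℂ) (v : ℝ) : ℂ :=
  ∫ s in {s : ℝ | s ∈ Set.Ioc 0 1 ∧ v ≤ ‖γ s - t‖}, x (γ s) / (γ s - t) ^ p * deriv γ s

/-- The integral `∫_L x(τ) dτ / (τ - t)^p` exists in the sense of Cauchy and Hadamard (finite
part) and has the value `I`: the truncated integrals tend to `I` after addition of a term
`ξ(v) / v^(p-1)`. Here `ξ` is a polynomial of degree less than `p - 1`, so that the added term
consists of negative powers of `v` only, which makes `I` unique. For `p = 1` one has `ξ = 0`,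
and `I` is the Cauchy principal value. -/
def HasFinitePart (γ : ℝ → ℂ) (p : ℕ) (x : ℂ → ℂ) (t I : ℂ) : Prop :=
  ∃ ξ : Polynomial ℂ, ξ.degree < ((p - 1 : ℕ) : WithBot ℕ) ∧
    Filter.Tendsto
      (fun v : ℝ => truncatedIntegral γ p x t v + ξ.eval (v : ℂ) / (v : ℂ) ^ (p - 1))
      (𝓝[>] 0) (𝓝 I)

/-- `x` solves `a(t) x(t) + (b(t) / (π i)) ∫_L x(τ) dτ / (τ - t)^p = f(t)` on the contour. -/
def SolvesEquation (γ : ℝ → ℂ) (p : ℕ) (a b f x : ℂ → ℂ) : Prop :=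
  ∀ t ∈ trace γ, ∃ I : ℂ, HasFinitePart γ p x t I ∧
    a t * x t + b t / (Real.pi * Complex.I) * I = f t

/-- The integral of `g(τ) dτ` along the contour from `γ s₀` to `γ s`. -/
def arcIntegral (γ : ℝ → ℂ) (g : ℂ → ℂ) (s₀ s : ℝ) : ℂ :=
  ∫ u in s₀..s, g (γ u) * deriv γ u

/-- The value at the point `γ s` of the solution of `x' + P x = Q` which has the value `c` at
`γ s₀`, by variation of constants along the contour. -/
def firstOrderSolution (γ : ℝ → ℂ) (P Q : ℂ → ℂ) (s₀ : ℝ) (c : ℂ) (s : ℝ) : ℂ :=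
  Complex.exp (-arcIntegral γ P s₀ s) *
    (c + ∫ u in s₀..s, Q (γ u) * Complex.exp (arcIntegral γ P s₀ u) * deriv γ u)

end Hypersingular

end

noncomputable section

namespace Hypersingular

open Filter Set MeasureTheory Interval

/-! ### Chord estimates for a C¹ contour, and the Cauchy transform off it. -/

section

/-! The singular equation is a differential equation in disguise. Put r = p - 1 and subtract from x
its Taylor polynomial of degree r along the contour at t. The remainder is O(|τ - t|^(r+α)) on L, so
its integral against (τ - t)^(-r-1) converges absolutely; it is the limit of integrals whose pole
lies in the exterior, and those vanish by Cauchy's theorem (`tendsto_truncatedIntegral_zero`). What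
is left are the kernels (τ - t)^(-m-1) with 0 ≤ m ≤ r. For m = 0 the principal value is πi
(`tendsto_truncatedIntegral_one`). For m ≥ 1 an explicit primitive reduces the truncated integral to
the two ends of the removed arc, and a parity cancellation between the ends kills the constant term,
so the finite part is zero (`exists_tendsto_truncatedIntegral`). Only πi x^(r)(t)/r! survives, which
gives `hasFinitePart` and `solvesEquation_iff`.

This needs Cauchy theory up to a C¹ boundary for an inner domain defined through bounded components.
The Jordan curve theorem is not invoked: the winding integral jumps by 2πi across L, and since it is
2πi inside and 0 outside, the jump decides which side of each normal is inner (`exists_tube`).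
Cauchy's theorem for curves inside the domain is proved by Dixon's argument, and extended to
functions continuous on the closure by pushing L inwards.

The converse tool is `exists_diffContOnCl`: a continuous density whose Cauchy integral vanishes in
the exterior is the boundary value of a function analytic inside. Integration by parts shows that
this criterion passes to derivatives along L, so x^(r) on L is the boundary value of the r-th
derivative inside, and the equation extends from L to the inner domain. The criterion also survives
products, primitives along L and uniform limits. Picard iteration on L itself, in the complete space
of boundary values, therefore solves the linear equation with arbitrary initial data
(`exists_linear_system`), and the solutions are automatically single-valued. Unit initial vectors
give p - 1 independent solutions; for p = 2 an integrating factor gives the explicit formula. -/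

theorem IsSmoothContour.toOne {p : ℕ} {γ : ℝ → ℂ} (hγ : IsSmoothContour p γ) (hp : 1 ≤ p) :
    IsSmoothContour 1 γ where
  contDiff := hγ.contDiff.of_le (by exact_mod_cast hp)
  periodic := hγ.periodic
  injOn := hγ.injOn
  deriv_ne_zero := hγ.deriv_ne_zero
  positive := hγ.positive

theorem uniformContinuous_of_continuous_of_periodic {f : ℝ → ℂ} (hf : Continuous f)
    (hp : Function.Periodic f 1) : UniformContinuous f := by
  rw [Metric.uniformContinuous_iff]
  intro ε hε
  have h := isCompact_Icc (a := (-1 : ℝ)) (b := 2) |>.uniformContinuousOn_of_continuous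
    hf.continuousOn
  rw [Metric.uniformContinuousOn_iff] at h
  obtain ⟨δ, hδ, h⟩ := h ε hε
  refine ⟨min δ 1, by positivity, fun {s t} hst => ?_⟩
  have h1 : ∀ x : ℝ, f (x - ⌊s⌋) = f x := fun x => by
    simpa using hp.sub_int_mul_eq (x := x) ⌊s⌋
  rw [← h1 s, ← h1 t]
  have h2 := Int.floor_le s
  have h3 := Int.lt_floor_add_one s
  have h4 : dist s t < 1 := hst.trans_le (min_le_right _ _)
  rw [Real.dist_eq, abs_lt] at h4
  refine h _ ⟨by linarith, by linarith⟩ _ ⟨by linarith, by linarith⟩ ?_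
  simpa using hst.trans_le (min_le_left _ _)

theorem exists_bound_of_periodic {f : ℝ → ℂ} (hf : Continuous f) (hp : Function.Periodic f 1) :
    ∃ M : ℝ, 0 < M ∧ ∀ s, ‖f s‖ ≤ M := by
  obtain ⟨M, hM, h⟩ := (hp.isBounded_of_continuous one_ne_zero hf).exists_pos_norm_le
  exact ⟨M, hM, fun s => h _ ⟨s, rfl⟩⟩

section contour

variable {γ : ℝ → ℂ} (hγ : IsSmoothContour 1 γ)
include hγ

theorem IsSmoothContour.continuous : Continuous γ := hγ.contDiff.continuous

theorem IsSmoothContour.continuous_deriv : Continuous (deriv γ) :=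
  hγ.contDiff.continuous_deriv le_rfl

theorem IsSmoothContour.hasDerivAt (s : ℝ) : HasDerivAt γ (deriv γ s) s :=
  (hγ.contDiff.differentiable one_ne_zero s).hasDerivAt

theorem IsSmoothContour.periodic_deriv : Function.Periodic (deriv γ) 1 := by
  intro s
  rw [← deriv_comp_add_const]
  congr 1
  ext x
  exact hγ.periodic x

theorem IsSmoothContour.map_add_int (s : ℝ) (n : ℤ) : γ (s + n) = γ s := by
  simpa using hγ.periodic.int_mul n s

theorem IsSmoothContour.eq_iff {s s' : ℝ} : γ s = γ s' ↔ ∃ n : ℤ, s' = s + n := by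
  constructor
  · intro h
    have h1 : ∀ x : ℝ, γ (Int.fract x) = γ x := fun x => by
      have := hγ.map_add_int (Int.fract x) ⌊x⌋
      rw [Int.fract_add_floor] at this
      exact this.symm
    have h2 := hγ.injOn ⟨Int.fract_nonneg s, Int.fract_lt_one s⟩
      ⟨Int.fract_nonneg s', Int.fract_lt_one s'⟩ (by rw [h1, h1, h])
    refine ⟨⌊s'⌋ - ⌊s⌋, ?_⟩
    have h3 := Int.fract_add_floor s
    have h4 := Int.fract_add_floor s'
    push_cast
    linarith
  · rintro ⟨n, rfl⟩
    rw [hγ.map_add_int]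

theorem IsSmoothContour.exists_le_norm_deriv : ∃ m : ℝ, 0 < m ∧ ∀ s, m ≤ ‖deriv γ s‖ := by
  have hc : Continuous fun s => (deriv γ s)⁻¹ := hγ.continuous_deriv.inv₀ hγ.deriv_ne_zero
  obtain ⟨M, hM, h⟩ := exists_bound_of_periodic hc (fun s => by simp [hγ.periodic_deriv s])
  refine ⟨M⁻¹, by positivity, fun s => ?_⟩
  rw [← inv_inv (deriv γ s), norm_inv]
  exact inv_anti₀ (by simp [hγ.deriv_ne_zero]) (h s)

theorem IsSmoothContour.exists_norm_deriv_le : ∃ M : ℝ, 0 < M ∧ ∀ s, ‖deriv γ s‖ ≤ M :=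
  exists_bound_of_periodic hγ.continuous_deriv hγ.periodic_deriv

/-- This is the mean value inequality for x ↦ γ x - x γ'(s). One δ serves all s because γ' is
periodic, hence uniformly continuous. -/
theorem IsSmoothContour.linear_approx {η : ℝ} (hη : 0 < η) : ∃ δ : ℝ, 0 < δ ∧ ∀ s s' : ℝ,
    |s' - s| ≤ δ → ‖γ s' - γ s - (s' - s : ℝ) * deriv γ s‖ ≤ η * |s' - s| := by
  have hu := uniformContinuous_of_continuous_of_periodic hγ.continuous_deriv hγ.periodic_deriv
  rw [Metric.uniformContinuous_iff] at hu
  obtain ⟨δ, hδ, h⟩ := hu η hη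
  refine ⟨δ / 2, by positivity, fun s s' hs => ?_⟩
  have hd : ∀ x ∈ uIcc s s', HasDerivWithinAt (fun x : ℝ => γ x - x * deriv γ s)
      (deriv γ x - deriv γ s) (uIcc s s') x := fun x _ => by
    have := (hγ.hasDerivAt x).sub ((Complex.ofRealCLM.hasDerivAt (x := x)).mul_const (deriv γ s))
    have := this.hasDerivWithinAt (s := uIcc s s')
    rw [Complex.ofRealCLM_apply, Complex.ofReal_one, one_mul] at this
    exact this
  have hb : ∀ x ∈ uIcc s s', ‖deriv γ x - deriv γ s‖ ≤ η := fun x hx => by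
    rw [← dist_eq_norm]
    refine (h ?_).le
    rw [Real.dist_eq]
    have : |x - s| ≤ |s' - s| := abs_sub_left_of_mem_uIcc hx
    linarith
  have := (convex_uIcc s s').norm_image_sub_le_of_norm_hasDerivWithin_le hd hb
    left_mem_uIcc right_mem_uIcc
  rw [Real.norm_eq_abs] at this
  have he : γ s' - γ s - (s' - s : ℝ) * deriv γ s =
      γ s' - s' * deriv γ s - (γ s - s * deriv γ s) := by
    push_cast
    ring
  rwa [he]

/-- A uniform lower bound for the distance of the points of the normal at `γ s` to the contour. -/
theorem IsSmoothContour.exists_normal_bound : ∃ c lam : ℝ, 0 < c ∧ 0 < lam ∧ ∀ s s' l : ℝ,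
    |s' - s| ≤ 1 / 2 → |l| ≤ lam →
      c * (|s' - s| + |l|) ≤ ‖γ s' - (γ s + l * (Complex.I * deriv γ s))‖ := by
  obtain ⟨m, hm, hm'⟩ := hγ.exists_le_norm_deriv
  obtain ⟨M, hM, hM'⟩ := hγ.exists_norm_deriv_le
  obtain ⟨δ, hδ, hδ'⟩ := hγ.linear_approx (η := m / 4) (by positivity)
  -- Away from the diagonal compactness bounds the chord from below. Shifting both parameters by ⌊s⌋
  -- lands in `K`, and a vanishing chord would make the parameter difference an integer n with δ ≤
  -- |n| ≤ 1/2.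
  have hfar : ∃ e : ℝ, 0 < e ∧ ∀ s s' : ℝ, δ ≤ |s' - s| → |s' - s| ≤ 1 / 2 →
      e ≤ ‖γ s' - γ s‖ := by
    let K : Set (ℝ × ℝ) := (Icc 0 1 ×ˢ Icc (-1) 2) ∩ {q | δ ≤ |q.2 - q.1| ∧ |q.2 - q.1| ≤ 1 / 2}
    have hK : IsCompact K := by
      refine (isCompact_Icc.prod isCompact_Icc).inter_right ?_
      have hc : Continuous fun q : ℝ × ℝ => |q.2 - q.1| := by fun_prop
      exact (isClosed_le continuous_const hc).inter (isClosed_le hc continuous_const)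
    have hcont : ContinuousOn (fun q : ℝ × ℝ => ‖γ q.2 - γ q.1‖) K := by
      have := hγ.continuous
      fun_prop
    have hred : ∀ s s' : ℝ, |s' - s| ≤ 1 / 2 → δ ≤ |s' - s| →
        (s - ⌊s⌋, s' - ⌊s⌋) ∈ K := fun s s' h1 h2 => by
      have h3 := Int.floor_le s
      have h4 := Int.lt_floor_add_one s
      have h5 := abs_le.1 h1
      refine ⟨⟨⟨sub_nonneg.2 h3, by linarith⟩, ⟨by linarith, by linarith⟩⟩, ?_⟩
      have h6 : s' - ⌊s⌋ - (s - ⌊s⌋) = s' - s := by ring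
      simp only [mem_ofPred_eq, h6]
      exact ⟨h2, h1⟩
    rcases K.eq_empty_or_nonempty with hKe | hKn
    · refine ⟨1, one_pos, fun s s' h2 h1 => ?_⟩
      have := hred s s' h1 h2
      rw [hKe] at this
      exact this.elim
    · obtain ⟨q, hq, hmin⟩ := hK.exists_isMinOn hKn hcont
      refine ⟨‖γ q.2 - γ q.1‖, ?_, fun s s' h2 h1 => ?_⟩
      · rw [norm_pos_iff, sub_ne_zero]
        intro he
        obtain ⟨n, hn⟩ := hγ.eq_iff.1 he.symm
        have h6 : q.2 - q.1 = n := by linarith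
        obtain ⟨-, h7, h8⟩ := hq
        rw [h6] at h7 h8
        have h9 : |(n : ℝ)| < 1 := by linarith
        have h10 : |n| < 1 := by exact_mod_cast h9
        rw [Int.abs_lt_one_iff] at h10
        simp [h10] at h7
        linarith
      · have := hmin (hred s s' h1 h2)
        simp only [mem_ofPred_eq] at this
        have h3 : ∀ x : ℝ, γ (x - ⌊s⌋) = γ x := fun x => by
          have := hγ.map_add_int (x - ⌊s⌋) ⌊s⌋
          simpa using this.symm
        rwa [h3, h3] at this
  obtain ⟨e, he, hfar⟩ := hfar
  have hlam : 0 < min 1 (e / (2 * M)) := by positivity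
  refine ⟨min (m / 4) (e / 4), min 1 (e / (2 * M)), by positivity, hlam,
    fun s s' l hs hl => ?_⟩
  have hl1 := hl.trans (min_le_left _ _)
  have hl2 := hl.trans (min_le_right _ _)
  rcases le_total |s' - s| δ with h | h
  · have h1 := hδ' s s' h
    -- Tangential and normal displacements are the real and imaginary parts of one factor, whose
    -- modulus is at least the mean of their absolute values. The linearization error m/4 · |s' - s|
    -- then leaves m/4 of this.
    have h2 : (|s' - s| + |l|) / 2 * m ≤ ‖((s' - s : ℝ) - l * Complex.I) * deriv γ s‖ := by
      rw [norm_mul]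
      refine mul_le_mul ?_ (hm' s) hm.le (norm_nonneg _)
      have h3 := Complex.abs_re_le_norm (((s' - s : ℝ) : ℂ) - l * Complex.I)
      have h4 := Complex.abs_im_le_norm (((s' - s : ℝ) : ℂ) - l * Complex.I)
      simp at h3 h4
      simp
      linarith
    have h5 : γ s' - (γ s + l * (Complex.I * deriv γ s)) =
      (γ s' - γ s - (s' - s : ℝ) * deriv γ s) + ((s' - s : ℝ) - l * Complex.I) * deriv γ s := by
      ring
    have h6 : min (m / 4) (e / 4) * (|s' - s| + |l|) ≤ m / 4 * (|s' - s| + |l|) := by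
      gcongr
      exact min_le_left _ _
    have h7 := norm_sub_le_norm_add (((s' - s : ℝ) - l * Complex.I) * deriv γ s)
      (γ s' - γ s - (s' - s : ℝ) * deriv γ s)
    rw [h5, add_comm (γ s' - γ s - _)]
    nlinarith [abs_nonneg l]
  · have h1 := hfar s s' h hs
    have h2 : ‖(l : ℂ) * (Complex.I * deriv γ s)‖ ≤ e / 2 := by
      simp only [norm_mul, Complex.norm_real, Complex.norm_I, one_mul, Real.norm_eq_abs]
      calc |l| * ‖deriv γ s‖ ≤ e / (2 * M) * M := by gcongr; exact hM' s
        _ = e / 2 := by field_simp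
    have h3 : min (m / 4) (e / 4) * (|s' - s| + |l|) ≤ e / 4 * (1 / 2 + 1) := by
      gcongr
      exact min_le_right _ _
    have h4 := norm_sub_norm_le (γ s' - γ s) ((l : ℂ) * (Complex.I * deriv γ s))
    rw [← sub_sub]
    linarith

theorem IsSmoothContour.exists_mem_trace {t : ℂ} (ht : t ∈ trace γ) (s : ℝ) :
    ∃ s', |s' - s| ≤ 1 / 2 ∧ γ s' = t := by
  obtain ⟨r, rfl⟩ := ht
  refine ⟨r + ((-round (r - s) : ℤ) : ℝ), ?_, hγ.map_add_int _ _⟩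
  have h := abs_sub_round (r - s)
  have he : r + ((-round (r - s) : ℤ) : ℝ) - s = r - s - round (r - s) := by
    push_cast
    ring
  rwa [he]

theorem IsSmoothContour.isCompact_trace : IsCompact (trace γ) :=
  hγ.periodic.compact_of_continuous one_ne_zero hγ.continuous

end contour

/-- The Cauchy transform of order `k` of the density `u` along the curve `η`. -/
def cauchyTransform (η u : ℝ → ℂ) (k : ℕ) (z : ℂ) : ℂ :=
  ∫ s in (0 : ℝ)..1, u s / (η s - z) ^ k

theorem hasDerivAt_cauchyTransform {η u : ℝ → ℂ} (hη : Continuous η) (hu : Continuous u) {z : ℂ}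
    (hz : ∀ s ∈ Icc (0 : ℝ) 1, η s ≠ z) (k : ℕ) :
    HasDerivAt (cauchyTransform η u k) (k * cauchyTransform η u (k + 1) z) z := by
  have hK : IsCompact (η '' Icc 0 1) := isCompact_Icc.image hη
  have hzK : z ∈ (η '' Icc 0 1)ᶜ := by
    rintro ⟨s, hs, rfl⟩
    exact hz s hs rfl
  obtain ⟨r, hr, hball⟩ := Metric.isOpen_iff.1 hK.isClosed.isOpen_compl z hzK
  have hdist : ∀ s ∈ Icc (0 : ℝ) 1, ∀ w ∈ Metric.ball z (r / 2), r / 2 ≤ ‖η s - w‖ := by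
    intro s hs w hw
    by_contra! hlt
    refine hball (?_ : η s ∈ _) ⟨s, hs, rfl⟩
    rw [Metric.mem_ball] at hw ⊢
    rw [← dist_eq_norm] at hlt
    linarith [dist_triangle (η s) w z]
  obtain ⟨B, hB⟩ := isCompact_Icc.exists_bound_of_continuousOn (s := Icc (0 : ℝ) 1)
    hu.continuousOn
  have hsub : Ι (0 : ℝ) 1 ⊆ Icc 0 1 := by
    rw [uIoc_of_le zero_le_one]; exact Ioc_subset_Icc_self
  have hcont : ∀ w ∈ Metric.ball z (r / 2), ∀ j : ℕ,
      ContinuousOn (fun s => u s / (η s - w) ^ j) (uIcc 0 1) := by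
    intro w hw j
    rw [uIcc_of_le zero_le_one]
    refine hu.continuousOn.div (by fun_prop) fun s hs => pow_ne_zero _ ?_
    intro h0
    have := hdist s hs w hw
    rw [h0, norm_zero] at this
    linarith
  have hmeas : ∀ w ∈ Metric.ball z (r / 2), ∀ j : ℕ, AEStronglyMeasurable
      (fun s => u s / (η s - w) ^ j) (volume.restrict (Ι 0 1)) := fun w hw j =>
    (intervalIntegrable_iff.1 (hcont w hw j).intervalIntegrable).aestronglyMeasurable
  have hz0 : z ∈ Metric.ball z (r / 2) := Metric.mem_ball_self (by positivity)
  have hd := intervalIntegral.hasDerivAt_integral_of_dominated_loc_of_deriv_le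
    (μ := volume) (a := 0) (b := 1) (F := fun w s => u s / (η s - w) ^ k)
    (F' := fun w s => k * (u s / (η s - w) ^ (k + 1))) (x₀ := z)
    (s := Metric.ball z (r / 2)) (bound := fun _ => k * (B / (r / 2) ^ (k + 1)))
    (Metric.ball_mem_nhds _ (by positivity))
    (eventually_of_mem (Metric.ball_mem_nhds _ (by positivity)) fun w hw => hmeas w hw k)
    (hcont z hz0 k).intervalIntegrable ((hmeas z hz0 (k + 1)).const_mul _) ?_
    intervalIntegrable_const ?_
  · have h2 := hd.2
    rw [intervalIntegral.integral_const_mul] at h2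
    exact h2
  · refine Eventually.of_forall fun s hs w hw => ?_
    rw [norm_mul, norm_div, norm_pow, Complex.norm_natCast]
    gcongr
    · exact (norm_nonneg _).trans (hB s (hsub hs))
    · exact hB s (hsub hs)
    · exact hdist s (hsub hs) w hw
  · refine Eventually.of_forall fun s hs w hw => ?_
    have hne : η s - w ≠ 0 := by
      intro h0
      have := hdist s (hsub hs) w hw
      rw [h0, norm_zero] at this
      linarith
    have h1 : HasDerivAt (fun w => (η s - w) ^ k) (k * (η s - w) ^ (k - 1) * -1) w := by
      exact ((hasDerivAt_id w).const_sub (η s)).fun_pow k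
    convert! (h1.fun_inv (pow_ne_zero _ hne)).const_mul (u s) using 1
    rcases k with _ | k
    · simp
    · simp only [Nat.add_sub_cancel]
      field_simp
      ring

end

/-! ### Winding integrals and the topology of the inner domain. -/

section

section closedCurve

variable {η η' : ℝ → ℂ}

theorem exists_norm_le_Icc {u : ℝ → ℂ} (hu : Continuous u) :
    ∃ B : ℝ, 0 < B ∧ ∀ s ∈ Icc (0 : ℝ) 1, ‖u s‖ ≤ B := by
  obtain ⟨B, hB⟩ := isCompact_Icc.exists_bound_of_continuousOn (s := Icc (0 : ℝ) 1) hu.continuousOn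
  exact ⟨max B 1, by positivity, fun s hs => (hB s hs).trans (le_max_left _ _)⟩

theorem norm_cauchyTransform_le {u : ℝ → ℂ} {M B : ℝ} (hu : ∀ s ∈ Icc (0 : ℝ) 1, ‖u s‖ ≤ M)
    (hη : ∀ s ∈ Icc (0 : ℝ) 1, ‖η s‖ ≤ B) {z : ℂ} (hz : B < ‖z‖) :
    ‖cauchyTransform η u 1 z‖ ≤ M / (‖z‖ - B) := by
  have := intervalIntegral.norm_integral_le_of_norm_le_const (a := 0) (b := 1)
    (f := fun s => u s / (η s - z) ^ 1) (C := M / (‖z‖ - B)) fun s hs => by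
      rw [uIoc_of_le zero_le_one] at hs
      have hs' := Ioc_subset_Icc_self hs
      rw [pow_one, norm_div]
      have h1 := norm_sub_norm_le z (η s)
      rw [norm_sub_rev] at h1
      have h2 := hη s hs'
      have h3 := (norm_nonneg _).trans (hu s hs')
      exact div_le_div₀ h3 (hu s hs') (by linarith) (by linarith)
  simpa [cauchyTransform] using this

theorem tendsto_cauchyTransform_cocompact {u : ℝ → ℂ} (hu : Continuous u) (hη : Continuous η) :
    Tendsto (cauchyTransform η u 1) (cocompact ℂ) (𝓝 0) := by
  obtain ⟨M, hM, hM'⟩ := exists_norm_le_Icc hu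
  obtain ⟨B, hB, hB'⟩ := exists_norm_le_Icc hη
  have h1 : Tendsto (fun z : ℂ => ‖z‖ - B) (cocompact ℂ) atTop :=
    tendsto_atTop_add_const_right _ _ tendsto_norm_cocompact_atTop
  refine squeeze_zero_norm' ?_ (h1.const_div_atTop M)
  filter_upwards [h1.eventually_gt_atTop 0] with z hz
  exact norm_cauchyTransform_le hM' hB' (by linarith)

theorem isOpen_compl_image (hη : Continuous η) : IsOpen (η '' Icc 0 1)ᶜ :=
  (isCompact_Icc.image hη).isClosed.isOpen_compl

variable (hη : ∀ s, HasDerivAt η (η' s) s) (hη' : Continuous η') (hcl : η 1 = η 0)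
include hη hη' hcl

/-- The integrand is the derivative of -(η - z)⁻¹, which takes the same value at both ends of a
closed curve. -/
theorem cauchyTransform_two_eq_zero {z : ℂ} (hz : z ∉ η '' Icc 0 1) :
    cauchyTransform η η' 2 z = 0 := by
  have hc : Continuous η := continuous_iff_continuousAt.2 fun s => (hη s).continuousAt
  have hne : ∀ s ∈ uIcc (0 : ℝ) 1, η s - z ≠ 0 := fun s hs h => by
    rw [uIcc_of_le zero_le_one] at hs
    exact hz ⟨s, hs, sub_eq_zero.1 h⟩
  have h1 : ∀ s ∈ uIcc (0 : ℝ) 1,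
      HasDerivAt (fun s => -(η s - z)⁻¹) (η' s / (η s - z) ^ 2) s := fun s hs => by
    convert! (((hη s).sub_const z).fun_inv (hne s hs)).fun_neg using 1
    ring
  have h2 : ContinuousOn (fun s => η' s / (η s - z) ^ 2) (uIcc 0 1) :=
    hη'.continuousOn.div (by fun_prop) fun s hs => pow_ne_zero _ (hne s hs)
  rw [cauchyTransform, intervalIntegral.integral_eq_sub_of_hasDerivAt h1 h2.intervalIntegrable,
    hcl, sub_self]

/-- The derivative of the winding integral is the transform of order two, which vanishes. Constancy
on components thus needs no integrality of winding numbers. -/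
theorem winding_eq_of_isPreconnected {S : Set ℂ} (hS : IsPreconnected S)
    (hST : S ⊆ (η '' Icc 0 1)ᶜ) {z w : ℂ} (hz : z ∈ S) (hw : w ∈ S) :
    cauchyTransform η η' 1 z = cauchyTransform η η' 1 w := by
  have hc : Continuous η := continuous_iff_continuousAt.2 fun s => (hη s).continuousAt
  have hd : ∀ w ∈ (η '' Icc 0 1)ᶜ, HasDerivAt (cauchyTransform η η' 1) 0 w := fun w hw => by
    have := hasDerivAt_cauchyTransform hc hη' (z := w) (fun s hs h => hw ⟨s, hs, h⟩) 1
    rwa [cauchyTransform_two_eq_zero hη hη' hcl hw, mul_zero] at this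
  have hsub := connectedComponentIn_subset (η '' Icc 0 1)ᶜ z
  exact ((isOpen_compl_image hc).connectedComponentIn (x := z)).is_const_of_deriv_eq_zero
    isPreconnected_connectedComponentIn
    (fun w hw => (hd w (hsub hw)).differentiableAt.differentiableWithinAt)
    (fun w hw => (hd w (hsub hw)).deriv) (mem_connectedComponentIn (hST hz))
    (hS.subset_connectedComponentIn hz hST hw)

/-- The winding integral is constant on S and tends to 0 at infinity, where an unbounded S has
points. -/
theorem winding_eq_zero_of_not_isBounded {S : Set ℂ} (hS : IsPreconnected S)
    (hST : S ⊆ (η '' Icc 0 1)ᶜ) (hub : ¬ Bornology.IsBounded S) {z : ℂ} (hz : z ∈ S) :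
    cauchyTransform η η' 1 z = 0 := by
  have hc : Continuous η := continuous_iff_continuousAt.2 fun s => (hη s).continuousAt
  by_contra hne
  have h1 := (tendsto_cauchyTransform_cocompact hη' hc).eventually_ne (Ne.symm hne)
  rw [Filter.Eventually, Metric.mem_cocompact_iff_closedBall_compl_subset 0] at h1
  obtain ⟨r, hr⟩ := h1
  refine hub ((Metric.isBounded_closedBall (x := (0 : ℂ)) (r := r)).subset fun w hw => ?_)
  by_contra hwr
  exact hr hwr (winding_eq_of_isPreconnected hη hη' hcl hS hST hw hz)

end closedCurve

section inside

variable {γ : ℝ → ℂ}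

theorem subset_inside_of_isPreconnected {S : Set ℂ} (hS : IsPreconnected S)
    (hST : S ⊆ (trace γ)ᶜ) {z : ℂ} (hzS : z ∈ S) (hz : z ∈ inside γ) : S ⊆ inside γ := by
  intro w hw
  have h := hS.subset_connectedComponentIn hzS hST hw
  refine ⟨hST hw, ?_⟩
  rw [← connectedComponentIn_eq h]
  exact hz.2

theorem disjoint_inside_of_isPreconnected {S : Set ℂ} (hS : IsPreconnected S)
    (hST : S ⊆ (trace γ)ᶜ) {z : ℂ} (hzS : z ∈ S) (hz : z ∉ inside γ) {w : ℂ} (hw : w ∈ S) :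
    w ∉ inside γ := fun hw' => hz (subset_inside_of_isPreconnected hS hST hw hw' hzS)

variable (hγ : IsSmoothContour 1 γ)
include hγ

theorem IsSmoothContour.isOpen_compl_trace : IsOpen (trace γ)ᶜ :=
  hγ.isCompact_trace.isClosed.isOpen_compl

theorem IsSmoothContour.exists_ball_subset_compl {z : ℂ} (hz : z ∉ trace γ) :
    ∃ r > 0, Metric.ball z r ⊆ (trace γ)ᶜ :=
  Metric.isOpen_iff.1 hγ.isOpen_compl_trace z hz

theorem IsSmoothContour.isOpen_inside : IsOpen (inside γ) := by
  rw [Metric.isOpen_iff]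
  intro z hz
  obtain ⟨r, hr, h⟩ := hγ.exists_ball_subset_compl hz.1
  exact ⟨r, hr, subset_inside_of_isPreconnected (convex_ball z r).isPreconnected h
    (Metric.mem_ball_self hr) hz⟩

theorem IsSmoothContour.closure_inside_subset : closure (inside γ) ⊆ inside γ ∪ trace γ := by
  intro z hz
  by_contra! hcon
  rw [mem_union, not_or] at hcon
  obtain ⟨r, hr, h⟩ := hγ.exists_ball_subset_compl hcon.2
  obtain ⟨w, hw, hwz⟩ := Metric.mem_closure_iff.1 hz r hr
  exact disjoint_inside_of_isPreconnected (convex_ball z r).isPreconnected h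
    (Metric.mem_ball_self hr) hcon.1 (by rwa [Metric.mem_ball, dist_comm]) hw

omit hγ in
theorem IsSmoothContour.closed {p : ℕ} (hγ : IsSmoothContour p γ) : γ 1 = γ 0 := by
  simpa using hγ.periodic 0

theorem IsSmoothContour.winding_inside {z : ℂ} (hz : z ∈ inside γ) :
    cauchyTransform γ (deriv γ) 1 z = 2 * Real.pi * Complex.I := by
  simpa [cauchyTransform] using hγ.positive z hz

theorem IsSmoothContour.winding_outside {z : ℂ} (hz : z ∉ trace γ) (hz' : z ∉ inside γ) :
    cauchyTransform γ (deriv γ) 1 z = 0 :=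
  winding_eq_zero_of_not_isBounded hγ.hasDerivAt hγ.continuous_deriv hγ.closed
    isPreconnected_connectedComponentIn ((connectedComponentIn_subset _ z).trans
      (compl_subset_compl.2 (image_subset_range _ _)))
    (fun h => hz' ⟨hz, h⟩) (mem_connectedComponentIn hz)

end inside

/-- By periodicity any window of length one will do; later a = s₀ - 1/2 centres it at the singular
point. -/
theorem truncatedIntegral_eq {γ : ℝ → ℂ} (hγ : IsSmoothContour 1 γ) (p : ℕ) (x : ℂ → ℂ) (t : ℂ)
    (v a : ℝ) : truncatedIntegral γ p x t v = ∫ s in a..a + 1,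
      {s : ℝ | v ≤ ‖γ s - t‖}.indicator (fun s => x (γ s) / (γ s - t) ^ p * deriv γ s) s := by
  have hmeas : MeasurableSet {s : ℝ | v ≤ ‖γ s - t‖} :=
    (isClosed_le continuous_const (by have := hγ.continuous; fun_prop)).measurableSet
  have hper : Function.Periodic ({s : ℝ | v ≤ ‖γ s - t‖}.indicator
      (fun s => x (γ s) / (γ s - t) ^ p * deriv γ s)) 1 := fun s => by
    simp only [indicator, mem_ofPred_eq, hγ.periodic s, hγ.periodic_deriv s]
  rw [hper.intervalIntegral_add_eq a 0, zero_add, intervalIntegral.integral_of_le zero_le_one,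
    setIntegral_indicator hmeas]
  rfl

end

/-! ### The jump of the Cauchy kernel, by rescaling at a point of the contour. -/

section

/-- The difference of the Cauchy kernels at `σ i` and at the origin, the latter truncated. -/
def jumpKernel (σ u : ℝ) : ℂ := 1 / (u - σ * Complex.I) - if 1 < |u| then 1 / (u : ℂ) else 0

/-- Symmetrizing u ↦ -u removes the truncated term, which is odd, and leaves 2σi/(1 + u²), whose
integral is 2σπi. -/
theorem integral_jumpKernel {σ : ℝ} (hσ : σ ^ 2 = 1) (hint : Integrable (jumpKernel σ)) :
    ∫ u, jumpKernel σ u = σ * Real.pi * Complex.I := by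
  have h1 : ∀ u : ℝ, jumpKernel σ u + jumpKernel σ (-u) =
      2 * σ * Complex.I * ((1 + u ^ 2)⁻¹ : ℝ) := by
    intro u
    have hσ' : (σ : ℂ) ^ 2 = 1 := by exact_mod_cast hσ
    have hne : (1 : ℂ) + u ^ 2 ≠ 0 := by
      have : (1 : ℝ) + u ^ 2 ≠ 0 := by positivity
      exact_mod_cast this
    have hprod : ((u : ℂ) - σ * Complex.I) * (u + σ * Complex.I) = 1 + u ^ 2 := by
      linear_combination (-σ ^ 2 : ℂ) * Complex.I_sq + hσ'
    have hne1 : (u : ℂ) - σ * Complex.I ≠ 0 := left_ne_zero_of_mul (hprod ▸ hne)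
    have hne2 : (u : ℂ) + σ * Complex.I ≠ 0 := right_ne_zero_of_mul (hprod ▸ hne)
    have h2 : (1 : ℂ) / (u - σ * Complex.I) + 1 / (-u - σ * Complex.I) =
        2 * σ * Complex.I * (1 + u ^ 2 : ℂ)⁻¹ := by
      rw [← hprod]
      have h3 : -(u : ℂ) - σ * Complex.I = -(u + σ * Complex.I) := by ring
      rw [h3]
      field_simp
      ring
    simp only [jumpKernel, abs_neg, Complex.ofReal_neg]
    push_cast
    rw [← h2]
    split_ifs <;> ring
  have h2 : ∫ u, (jumpKernel σ u + jumpKernel σ (-u)) = 2 * ∫ u, jumpKernel σ u := by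
    rw [integral_add hint hint.comp_neg, integral_neg_eq_self (jumpKernel σ), two_mul]
  simp_rw [h1] at h2
  rw [integral_const_mul, integral_complex_ofReal, integral_univ_inv_one_add_sq] at h2
  linear_combination (-1 / 2 : ℂ) * h2

variable {γ : ℝ → ℂ} (hγ : IsSmoothContour 1 γ)
include hγ

/-- The substitution s = s₀ + εu on the period centred at s₀. The truncation radius ε‖γ'(s₀)‖ scales
with the displacement along the normal, so that the integrand has a limit as ε → 0. -/
theorem IsSmoothContour.winding_sub_truncated_eq {σ ε : ℝ} (s₀ : ℝ) (hε : 0 < ε)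
    (hz : ∀ s, γ s ≠ γ s₀ + (σ * ε : ℝ) * (Complex.I * deriv γ s₀)) :
    cauchyTransform γ (deriv γ) 1 (γ s₀ + (σ * ε : ℝ) * (Complex.I * deriv γ s₀))
      - truncatedIntegral γ 1 (fun _ => 1) (γ s₀) (ε * ‖deriv γ s₀‖) =
    ∫ u, (Ioc (-(1 / (2 * ε))) (1 / (2 * ε))).indicator (fun u : ℝ =>
      ε * (deriv γ (s₀ + ε * u) /
          (γ (s₀ + ε * u) - (γ s₀ + (σ * ε : ℝ) * (Complex.I * deriv γ s₀)))
        - {u : ℝ | ε * ‖deriv γ s₀‖ ≤ ‖γ (s₀ + ε * u) - γ s₀‖}.indicator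
          (fun u => deriv γ (s₀ + ε * u) / (γ (s₀ + ε * u) - γ s₀)) u)) u := by
  set z := γ s₀ + (σ * ε : ℝ) * (Complex.I * deriv γ s₀) with hzdef
  have hc := hγ.continuous
  have hc' := hγ.continuous_deriv
  have hne : ∀ s, γ s - z ≠ 0 := fun s => sub_ne_zero.2 (hz s)
  have hcont : Continuous fun s => deriv γ s / (γ s - z) := hc'.div (by fun_prop) hne
  have hper : Function.Periodic (fun s => deriv γ s / (γ s - z)) 1 := fun s => by
    simp only [hγ.periodic s, hγ.periodic_deriv s]
  have h1 : cauchyTransform γ (deriv γ) 1 z =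
      ∫ s in (s₀ - 1 / 2)..(s₀ - 1 / 2) + 1, deriv γ s / (γ s - z) := by
    rw [hper.intervalIntegral_add_eq (s₀ - 1 / 2) 0, zero_add, cauchyTransform]
    simp
  set v := ε * ‖deriv γ s₀‖ with hv
  set T : ℝ → ℂ := {s : ℝ | v ≤ ‖γ s - γ s₀‖}.indicator
    (fun s => deriv γ s / (γ s - γ s₀)) with hT
  have hTint : ∀ a b, IntervalIntegrable T volume a b := by
    intro a b
    have hmeas : MeasurableSet {s : ℝ | v ≤ ‖γ s - γ s₀‖} :=
      (isClosed_le continuous_const (by fun_prop)).measurableSet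
    obtain ⟨M, hM, hM'⟩ := hγ.exists_norm_deriv_le
    have hv0 : 0 < v := by have := hγ.deriv_ne_zero s₀; positivity
    refine (intervalIntegrable_const (c := M / v)).mono_fun
      (((hc'.measurable.div (hc.measurable.sub_const _)).indicator hmeas).aestronglyMeasurable) ?_
    refine Eventually.of_forall fun s => ?_
    rw [hT, Real.norm_of_nonneg (by positivity)]
    beta_reduce
    by_cases hs : s ∈ {s : ℝ | v ≤ ‖γ s - γ s₀‖}
    · rw [indicator_of_mem hs, norm_div]
      have : v ≤ ‖γ s - γ s₀‖ := hs
      gcongr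
      exact hM' s
    · rw [indicator_of_notMem hs, norm_zero]
      positivity
  have h2 : truncatedIntegral γ 1 (fun _ => 1) (γ s₀) v =
      ∫ s in (s₀ - 1 / 2)..(s₀ - 1 / 2) + 1, T s := by
    rw [truncatedIntegral_eq hγ _ _ _ _ (s₀ - 1 / 2)]
    simp only [hT, pow_one, one_div_mul_eq_div]
  rw [h1, h2, ← intervalIntegral.integral_sub (hcont.intervalIntegrable _ _) (hTint _ _),
    integral_indicator measurableSet_Ioc, ← intervalIntegral.integral_of_le
      (by have : 0 < 1 / (2 * ε) := by positivity
          linarith)]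
  have h3 := intervalIntegral.smul_integral_comp_add_mul
    (fun s => deriv γ s / (γ s - z) - T s) (a := -(1 / (2 * ε))) (b := 1 / (2 * ε)) ε s₀
  have h4 : s₀ + ε * -(1 / (2 * ε)) = s₀ - 1 / 2 := by field_simp; ring
  have h5 : s₀ + ε * (1 / (2 * ε)) = s₀ - 1 / 2 + 1 := by field_simp; ring
  rw [h4, h5] at h3
  rw [← h3, ← intervalIntegral.integral_smul]
  refine intervalIntegral.integral_congr fun u _ => ?_
  simp only [hT, Complex.real_smul, indicator, mem_ofPred_eq]

/-- In the rescaled variable the contour becomes its tangent line and the integrand tends to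
`jumpKernel σ`, dominated by a multiple of 1/(1 + u²). Only the difference is treated here: neither
term is yet known to converge. -/
theorem IsSmoothContour.tendsto_winding_sub_truncated {σ : ℝ} (hσ : σ ^ 2 = 1) (s₀ : ℝ) :
    Tendsto (fun ε : ℝ => cauchyTransform γ (deriv γ) 1
        (γ s₀ + (σ * ε : ℝ) * (Complex.I * deriv γ s₀))
      - truncatedIntegral γ 1 (fun _ => 1) (γ s₀) (ε * ‖deriv γ s₀‖)) (𝓝[>] 0)
      (𝓝 (σ * Real.pi * Complex.I)) := by
  obtain ⟨c, lam, hc, hlam, hK⟩ := hγ.exists_normal_bound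
  obtain ⟨M, hM, hM'⟩ := hγ.exists_norm_deriv_le
  have hcγ := hγ.continuous
  have hcγ' := hγ.continuous_deriv
  set d := deriv γ s₀ with hd
  have hd0 : 0 < ‖d‖ := norm_pos_iff.2 (hγ.deriv_ne_zero s₀)
  have hσ1 : |σ| = 1 := by
    rw [← sq_abs] at hσ
    exact (pow_eq_one_iff_of_nonneg (abs_nonneg _) two_ne_zero).1 hσ
  set Ψ : ℝ → ℝ → ℂ := fun ε => (Ioc (-(1 / (2 * ε))) (1 / (2 * ε))).indicator (fun u : ℝ =>
      ε * (deriv γ (s₀ + ε * u) /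
          (γ (s₀ + ε * u) - (γ s₀ + (σ * ε : ℝ) * (Complex.I * d)))
        - {u : ℝ | ε * ‖d‖ ≤ ‖γ (s₀ + ε * u) - γ s₀‖}.indicator
          (fun u => deriv γ (s₀ + ε * u) / (γ (s₀ + ε * u) - γ s₀)) u)) with hΨ
  have hsmall : ∀ᶠ ε : ℝ in 𝓝[>] 0, 0 < ε ∧ ε ≤ lam := by
    filter_upwards [self_mem_nhdsWithin, mem_nhdsWithin_of_mem_nhds (Iic_mem_nhds hlam)]
      with ε h1 h2 using ⟨h1, h2⟩
  have hlow : ∀ ε : ℝ, 0 < ε → ε ≤ lam → ∀ u : ℝ, |u| ≤ 1 / (2 * ε) →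
      c * ε * (1 + |u|) ≤ ‖γ (s₀ + ε * u) - (γ s₀ + (σ * ε : ℝ) * (Complex.I * d))‖ ∧
      c * ε * |u| ≤ ‖γ (s₀ + ε * u) - γ s₀‖ := by
    intro ε hε hεl u hu
    have h1 : |s₀ + ε * u - s₀| = ε * |u| := by rw [add_sub_cancel_left, abs_mul, abs_of_pos hε]
    have h2 : |s₀ + ε * u - s₀| ≤ 1 / 2 := by
      rw [h1]
      calc ε * |u| ≤ ε * (1 / (2 * ε)) := by gcongr
        _ = 1 / 2 := by field_simp
    have h3 : |σ * ε| = ε := by rw [abs_mul, hσ1, one_mul, abs_of_pos hε]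
    have h4 := hK s₀ _ (σ * ε) h2 (by rwa [h3])
    have h5 := hK s₀ _ 0 h2 (by simpa using hlam.le)
    rw [h1, h3] at h4
    rw [h1] at h5
    refine ⟨by convert h4 using 1; ring, ?_⟩
    simp only [abs_zero, add_zero, Complex.ofReal_zero, zero_mul] at h5
    convert h5 using 1
    ring
  have hoff : ∀ ε : ℝ, 0 < ε → ε ≤ lam → ∀ s,
      γ s ≠ γ s₀ + (σ * ε : ℝ) * (Complex.I * d) := by
    intro ε hε hεl s h
    obtain ⟨s', hs', he⟩ := hγ.exists_mem_trace ⟨s, rfl⟩ s₀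
    have h3 : |σ * ε| = ε := by rw [abs_mul, hσ1, one_mul, abs_of_pos hε]
    have h4 := hK s₀ s' (σ * ε) hs' (by rwa [h3])
    rw [h3, he, h, sub_self, norm_zero] at h4
    have : 0 < c * (|s' - s₀| + ε) := by positivity
    linarith
  set e := min ‖d‖ c / 2 with he
  have he0 : 0 < e := by positivity
  set C := max (M * ‖d‖ / (c * e)) (M * ((1 + ‖d‖ / c)) / c) with hC
  have hC0 : 0 < C := by positivity
  have hbound : ∀ᶠ ε : ℝ in 𝓝[>] 0, ∀ᵐ u : ℝ, ‖Ψ ε u‖ ≤ C * (1 + u ^ 2)⁻¹ := by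
    filter_upwards [hsmall] with ε ⟨hε, hεl⟩
    refine Eventually.of_forall fun u => ?_
    simp only [hΨ]
    by_cases hu : u ∈ Ioc (-(1 / (2 * ε))) (1 / (2 * ε))
    swap
    · rw [indicator_of_notMem hu, norm_zero]
      positivity
    rw [indicator_of_mem hu]
    obtain ⟨h1, h2⟩ := hlow ε hε hεl u (abs_le.2 ⟨hu.1.le, hu.2⟩)
    set s := s₀ + ε * u
    have hden : (1 + |u|) ^ 2 ≥ 1 + u ^ 2 := by nlinarith [abs_nonneg u, sq_abs u]
    suffices hsuff : ‖(ε : ℂ) * (deriv γ s / (γ s - (γ s₀ + (σ * ε : ℝ) * (Complex.I * d)))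
        - {u : ℝ | ε * ‖d‖ ≤ ‖γ (s₀ + ε * u) - γ s₀‖}.indicator
          (fun u => deriv γ (s₀ + ε * u) / (γ (s₀ + ε * u) - γ s₀)) u)‖ ≤ C / (1 + |u|) ^ 2 by
      refine hsuff.trans ?_
      rw [← div_eq_mul_inv]
      gcongr
    have hz0 : γ s - (γ s₀ + (σ * ε : ℝ) * (Complex.I * d)) ≠ 0 :=
      sub_ne_zero.2 (hoff ε hε hεl s)
    by_cases hmem : ε * ‖d‖ ≤ ‖γ s - γ s₀‖
    · rw [indicator_of_mem (by exact hmem)]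
      have ht0 : γ s - γ s₀ ≠ 0 := by
        rw [← norm_pos_iff]
        exact lt_of_lt_of_le (by positivity) hmem
      have h3 : (ε : ℂ) * (deriv γ s / (γ s - (γ s₀ + (σ * ε : ℝ) * (Complex.I * d)))
          - deriv γ s / (γ s - γ s₀)) = ε * (deriv γ s * ((σ * ε : ℝ) * (Complex.I * d)) /
            ((γ s - (γ s₀ + (σ * ε : ℝ) * (Complex.I * d))) * (γ s - γ s₀))) := by
        rw [div_sub_div _ _ hz0 ht0]
        congr 2
        ring
      have h4 : e * ε * (1 + |u|) ≤ ‖γ s - γ s₀‖ := by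
        have h5 : e ≤ ‖d‖ / 2 := by rw [he]; gcongr; exact min_le_left _ _
        have h6 : e ≤ c / 2 := by rw [he]; gcongr; exact min_le_right _ _
        have h7 : e * ε ≤ ‖d‖ / 2 * ε := by gcongr
        have h8 : e * (ε * |u|) ≤ c / 2 * (ε * |u|) := by gcongr
        linarith
      change ‖(ε : ℂ) * (deriv γ s / (γ s - (γ s₀ + (σ * ε : ℝ) * (Complex.I * d)))
          - deriv γ s / (γ s - γ s₀))‖ ≤ _
      rw [h3, norm_mul, norm_div, norm_mul, norm_mul, norm_mul, norm_mul, Complex.norm_real,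
        Complex.norm_real, Complex.norm_I, one_mul, Real.norm_eq_abs, Real.norm_eq_abs, abs_mul,
        hσ1, one_mul, abs_of_pos hε]
      calc ε * (‖deriv γ s‖ * (ε * ‖d‖) / (‖γ s - (γ s₀ + (σ * ε : ℝ) * (Complex.I * d))‖ *
            ‖γ s - γ s₀‖)) ≤
          ε * (M * (ε * ‖d‖) / ((c * ε * (1 + |u|)) * (e * ε * (1 + |u|)))) := by
            gcongr
            exact hM' s
        _ = M * ‖d‖ / (c * e) / (1 + |u|) ^ 2 := by field_simp
        _ ≤ C / (1 + |u|) ^ 2 := by gcongr; exact le_max_left _ _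
    · rw [indicator_of_notMem (by exact hmem), sub_zero, norm_mul, norm_div, Complex.norm_real,
        Real.norm_of_nonneg hε.le]
      push Not at hmem
      have h5 : 1 + |u| ≤ 1 + ‖d‖ / c := by
        have : c * ε * |u| < ε * ‖d‖ := h2.trans_lt hmem
        have h6 : c * |u| < ‖d‖ := by
          by_contra! hcon
          nlinarith
        rw [add_le_add_iff_left, le_div_iff₀ hc]
        linarith
      calc ε * (‖deriv γ s‖ / ‖γ s - (γ s₀ + (σ * ε : ℝ) * (Complex.I * d))‖) ≤
          ε * (M / (c * ε * (1 + |u|))) := by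
            gcongr
            exact hM' s
        _ = M * (1 + |u|) / c / (1 + |u|) ^ 2 := by field_simp
        _ ≤ M * (1 + ‖d‖ / c) / c / (1 + |u|) ^ 2 := by gcongr
        _ ≤ C / (1 + |u|) ^ 2 := by gcongr; exact le_max_right _ _
  have hmeas : ∀ᶠ ε : ℝ in 𝓝[>] 0, AEStronglyMeasurable (Ψ ε) volume := by
    refine Eventually.of_forall fun ε => Measurable.aestronglyMeasurable ?_
    have h1 : Measurable fun u : ℝ => γ (s₀ + ε * u) := by
      have : Continuous fun u : ℝ => γ (s₀ + ε * u) := by fun_prop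
      exact this.measurable
    have h2 : Measurable fun u : ℝ => deriv γ (s₀ + ε * u) := by
      have : Continuous fun u : ℝ => deriv γ (s₀ + ε * u) := by fun_prop
      exact this.measurable
    refine Measurable.indicator (Measurable.const_mul (Measurable.sub (h2.div (h1.sub_const _))
      (Measurable.indicator (h2.div (h1.sub_const _)) ?_)) _) measurableSet_Ioc
    exact measurableSet_le measurable_const (h1.sub_const _).norm
  have hlim : ∀ᵐ u : ℝ, Tendsto (fun ε => Ψ ε u) (𝓝[>] 0) (𝓝 (jumpKernel σ u)) := by
    -- At |u| = 1 the limiting chord equals the truncation radius, so that membership in the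
    -- truncated set is undecided.
    have hae : ∀ᵐ u : ℝ, u ≠ 1 ∧ u ≠ -1 := by
      have h1 : ∀ a : ℝ, ∀ᵐ u : ℝ, u ≠ a := fun a => by
        simp [ae_iff]
      filter_upwards [h1 1, h1 (-1)] with u h2 h3 using ⟨h2, h3⟩
    filter_upwards [hae] with u ⟨hu1, hu2⟩
    have habs : |u| ≠ 1 := fun h => by
      rcases (abs_eq zero_le_one).1 h with h | h
      exacts [hu1 h, hu2 h]
    have hDu : HasDerivAt (fun ε : ℝ => γ (s₀ + ε * u)) (u * d) 0 := by
      have h1 : HasDerivAt (fun ε : ℝ => s₀ + ε * u) u 0 := by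
        simpa using ((hasDerivAt_id (0 : ℝ)).mul_const u).const_add s₀
      have h2 : HasDerivAt γ d (s₀ + 0 * u) := by
        rw [zero_mul, add_zero]
        exact hγ.hasDerivAt s₀
      simpa [Function.comp_def] using h2.scomp (0 : ℝ) h1
    have hq : Tendsto (fun ε : ℝ => (γ (s₀ + ε * u) - γ s₀) / ε) (𝓝[>] 0) (𝓝 (u * d)) := by
      have h1 := (hasDerivAt_iff_tendsto_slope.1 hDu).mono_left
        (nhdsWithin_mono (0 : ℝ) (fun x (hx : 0 < x) => hx.ne'))
      refine h1.congr fun ε => ?_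
      simp [slope_def_module, div_eq_inv_mul]
    have hder : Tendsto (fun ε : ℝ => deriv γ (s₀ + ε * u)) (𝓝[>] 0) (𝓝 d) := by
      have : Continuous fun ε : ℝ => deriv γ (s₀ + ε * u) := by fun_prop
      have h1 := this.tendsto 0
      simp only [zero_mul, add_zero] at h1
      exact h1.mono_left nhdsWithin_le_nhds
    have hIoc : ∀ᶠ ε : ℝ in 𝓝[>] 0, u ∈ Ioc (-(1 / (2 * ε))) (1 / (2 * ε)) := by
      have h1 : ∀ᶠ ε : ℝ in 𝓝[>] 0, ε < 1 / (2 * (|u| + 1)) :=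
        mem_nhdsWithin_of_mem_nhds (Iio_mem_nhds (by positivity))
      filter_upwards [h1, self_mem_nhdsWithin] with ε h2 (h3 : 0 < ε)
      have h4 : |u| < 1 / (2 * ε) := by
        rw [lt_div_iff₀ (by positivity)] at h2 ⊢
        nlinarith
      exact ⟨(abs_lt.1 h4).1, (abs_lt.1 h4).2.le⟩
    have hfirst : Tendsto (fun ε : ℝ => (ε : ℂ) * (deriv γ (s₀ + ε * u) /
        (γ (s₀ + ε * u) - (γ s₀ + (σ * ε : ℝ) * (Complex.I * d))))) (𝓝[>] 0)
        (𝓝 (1 / (u - σ * Complex.I))) := by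
      have hne : (u : ℂ) - σ * Complex.I ≠ 0 := by
        intro h
        have := congrArg Complex.im h
        simp at this
        simp [this] at hσ1
      have h1 := hder.div (hq.sub_const (σ * Complex.I * d)) (by
        rw [← sub_mul]
        exact mul_ne_zero hne (norm_pos_iff.1 hd0))
      have h2 : d / (u * d - σ * Complex.I * d) = 1 / (u - σ * Complex.I) := by
        rw [← sub_mul]
        field_simp [norm_pos_iff.1 hd0]
      rw [h2] at h1
      refine h1.congr' ?_
      filter_upwards [self_mem_nhdsWithin] with ε (hε : 0 < ε)
      have hε' : (ε : ℂ) ≠ 0 := by exact_mod_cast hε.ne'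
      have h3 : γ (s₀ + ε * u) - (γ s₀ + (σ * ε : ℝ) * (Complex.I * d)) =
        ε * ((γ (s₀ + ε * u) - γ s₀) / ε - σ * Complex.I * d) := by
        push_cast
        field_simp
        ring
      rw [h3, Pi.div_apply, mul_div_assoc', mul_div_mul_left _ _ hε']
    have hnorm : ∀ ε : ℝ, 0 < ε → (ε * ‖d‖ ≤ ‖γ (s₀ + ε * u) - γ s₀‖ ↔
        ‖d‖ ≤ ‖(γ (s₀ + ε * u) - γ s₀) / ε‖) := fun ε hε => by
      rw [norm_div, Complex.norm_real, Real.norm_of_nonneg hε.le, le_div_iff₀ hε, mul_comm]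
    have hqn := hq.norm
    rw [norm_mul, Complex.norm_real, Real.norm_eq_abs] at hqn
    rcases lt_or_gt_of_ne habs with hlt | hgt
    · have h1 : ∀ᶠ ε : ℝ in 𝓝[>] 0, ‖(γ (s₀ + ε * u) - γ s₀) / ε‖ < ‖d‖ :=
        hqn.eventually_lt_const (by nlinarith)
      rw [jumpKernel, if_neg (not_lt.2 hlt.le), sub_zero]
      refine hfirst.congr' ?_
      filter_upwards [h1, hIoc, self_mem_nhdsWithin] with ε h2 h3 (h4 : 0 < ε)
      simp only [hΨ]
      rw [indicator_of_mem h3, indicator_of_notMem, sub_zero]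
      simp only [mem_ofPred_eq, hnorm ε h4, not_le, h2]
    · have h1 : ∀ᶠ ε : ℝ in 𝓝[>] 0, ‖d‖ < ‖(γ (s₀ + ε * u) - γ s₀) / ε‖ :=
        hqn.eventually_const_lt (by nlinarith)
      rw [jumpKernel, if_pos hgt]
      have hu0 : (u : ℂ) ≠ 0 := by
        rintro h
        have : u = 0 := by exact_mod_cast h
        simp [this] at hgt
        linarith
      have hsecond := hder.div hq (mul_ne_zero hu0 (norm_pos_iff.1 hd0))
      have h2 : d / (u * d) = 1 / u := by field_simp [norm_pos_iff.1 hd0]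
      rw [h2] at hsecond
      refine (hfirst.sub hsecond).congr' ?_
      filter_upwards [h1, hIoc, self_mem_nhdsWithin] with ε h2 h3 (h4 : 0 < ε)
      simp only [hΨ]
      rw [indicator_of_mem h3, indicator_of_mem, mul_sub, Pi.div_apply]
      · congr 1
        rw [div_div_eq_mul_div]
        ring
      · simp only [mem_ofPred_eq, hnorm ε h4, h2.le]
  have hbint : Integrable fun u : ℝ => C * (1 + u ^ 2)⁻¹ := integrable_inv_one_add_sq.const_mul _
  have hint : Integrable (jumpKernel σ) := by
    refine hbint.mono' ?_ ?_
    · refine Measurable.aestronglyMeasurable ?_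
      unfold jumpKernel
      refine Measurable.sub (by fun_prop) (Measurable.ite ?_ (by fun_prop) measurable_const)
      exact measurableSet_lt measurable_const (by fun_prop)
    -- The almost everywhere bounds hold for each ε separately; a sequence keeps the exceptional
    -- sets countable in number.
    · obtain ⟨ε, hε⟩ : ∃ ε : ℕ → ℝ, Tendsto ε atTop (𝓝[>] 0) :=
        exists_seq_tendsto _
      have h1 : ∀ᶠ n in atTop, ∀ᵐ u : ℝ, ‖Ψ (ε n) u‖ ≤ C * (1 + u ^ 2)⁻¹ :=
        hε.eventually hbound
      obtain ⟨N, hN⟩ := eventually_atTop.1 h1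
      have h2 : ∀ᵐ u : ℝ, ∀ n, N ≤ n → ‖Ψ (ε n) u‖ ≤ C * (1 + u ^ 2)⁻¹ := by
        rw [ae_all_iff]
        intro n
        by_cases hn : N ≤ n
        · filter_upwards [hN n hn] with u hu _ using hu
        · exact Eventually.of_forall fun u h => absurd h hn
      filter_upwards [hlim, h2] with u h3 h4
      exact le_of_tendsto (h3.comp hε).norm (eventually_atTop.2 ⟨N, h4⟩)
  have hmain := tendsto_integral_filter_of_dominated_convergence _ hmeas hbound hbint hlim
  rw [integral_jumpKernel hσ hint] at hmain
  refine hmain.congr' ?_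
  filter_upwards [hsmall] with ε ⟨hε, hεl⟩
  rw [hγ.winding_sub_truncated_eq s₀ hε (hoff ε hε hεl)]

end

/-! ### Inner and outer side of the contour; the principal value at a boundary point. -/

section

variable {γ : ℝ → ℂ} (hγ : IsSmoothContour 1 γ)
include hγ

/-- The same truncated integral occurs for σ = 1 and σ = -1 and cancels, leaving πi - (-πi). -/
theorem IsSmoothContour.tendsto_winding_jump (s : ℝ) :
    Tendsto (fun ε : ℝ => cauchyTransform γ (deriv γ) 1 (γ s + ε * (Complex.I * deriv γ s))
      - cauchyTransform γ (deriv γ) 1 (γ s + (-ε : ℝ) * (Complex.I * deriv γ s))) (𝓝[>] 0)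
      (𝓝 (2 * Real.pi * Complex.I)) := by
  have h := (hγ.tendsto_winding_sub_truncated (σ := 1) (by norm_num) s).sub
    (hγ.tendsto_winding_sub_truncated (σ := -1) (by norm_num) s)
  convert h using 2
  · simp
  · push_cast
    ring

/-- Near the contour, the inner normal lies in the inner domain, and the outer normal lies in the
exterior. -/
theorem IsSmoothContour.exists_tube : ∃ c lam : ℝ, 0 < c ∧ 0 < lam ∧
    (∀ s s' l : ℝ, |s' - s| ≤ 1 / 2 → |l| ≤ lam →
      c * (|s' - s| + |l|) ≤ ‖γ s' - (γ s + l * (Complex.I * deriv γ s))‖) ∧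
    (∀ s l : ℝ, 0 < |l| → |l| ≤ lam → γ s + l * (Complex.I * deriv γ s) ∉ trace γ) ∧
    (∀ s l : ℝ, 0 < l → l ≤ lam → γ s + l * (Complex.I * deriv γ s) ∈ inside γ) ∧
    (∀ s l : ℝ, l < 0 → -lam ≤ l → γ s + l * (Complex.I * deriv γ s) ∉ inside γ) := by
  obtain ⟨c, lam, hc, hlam, hK⟩ := hγ.exists_normal_bound
  have hoff : ∀ s l : ℝ, 0 < |l| → |l| ≤ lam →
      γ s + l * (Complex.I * deriv γ s) ∉ trace γ := by
    intro s l hl hl' hmem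
    obtain ⟨s', hs', he⟩ := hγ.exists_mem_trace hmem s
    have h4 := hK s s' l hs' hl'
    rw [he, sub_self, norm_zero] at h4
    have : 0 < c * (|s' - s| + |l|) := by positivity
    linarith
  have hpi : (0 : ℝ) < 2 * Real.pi := by positivity
  -- On each side the winding integral is 0 or 2πi, so the jump is 0 or ±2πi. Of these only 2πi is
  -- at distance less than 2π from the limit. One such l suffices, since each half of the normal is
  -- connected and misses the trace.
  have hnear : ∀ s, ∃ l : ℝ, 0 < l ∧ l ≤ lam ∧ γ s + l * (Complex.I * deriv γ s) ∈ inside γ ∧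
      γ s + (-l : ℝ) * (Complex.I * deriv γ s) ∉ inside γ := by
    intro s
    have h1 := (Metric.tendsto_nhds.1 (hγ.tendsto_winding_jump s)) (2 * Real.pi) hpi
    have h2 : ∀ᶠ l : ℝ in 𝓝[>] 0, l ≤ lam := mem_nhdsWithin_of_mem_nhds (Iic_mem_nhds hlam)
    obtain ⟨l, h3, h4, h5 : 0 < l⟩ := (h1.and (h2.and self_mem_nhdsWithin)).exists
    have ho1 := hoff s l (by positivity) (by rwa [abs_of_pos h5])
    have ho2 := hoff s (-l) (by simpa using h5.ne') (by rwa [abs_neg, abs_of_pos h5])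
    have hn : ‖(2 : ℂ) * Real.pi * Complex.I‖ = 2 * Real.pi := by
      simp [abs_of_pos Real.pi_pos]
    refine ⟨l, h5, h4, ?_, ?_⟩
    · by_contra hcon
      rw [hγ.winding_outside ho1 hcon] at h3
      by_cases hcon' : γ s + (-l : ℝ) * (Complex.I * deriv γ s) ∈ inside γ
      · rw [hγ.winding_inside hcon', dist_eq_norm] at h3
        have : (0 : ℂ) - 2 * Real.pi * Complex.I - 2 * Real.pi * Complex.I =
          -(2 * (2 * Real.pi * Complex.I)) := by ring
        rw [this, norm_neg, norm_mul, hn] at h3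
        norm_num at h3
        linarith
      · rw [hγ.winding_outside ho2 hcon', dist_eq_norm, sub_zero, zero_sub, norm_neg, hn] at h3
        exact lt_irrefl _ h3
    · intro hcon'
      rw [hγ.winding_inside hcon', dist_eq_norm] at h3
      by_cases hcon : γ s + l * (Complex.I * deriv γ s) ∈ inside γ
      · rw [hγ.winding_inside hcon, sub_self, zero_sub, norm_neg, hn] at h3
        exact lt_irrefl _ h3
      · rw [hγ.winding_outside ho1 hcon] at h3
        have : (0 : ℂ) - 2 * Real.pi * Complex.I - 2 * Real.pi * Complex.I =
          -(2 * (2 * Real.pi * Complex.I)) := by ring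
        rw [this, norm_neg, norm_mul, hn] at h3
        norm_num at h3
        linarith
  have hseg : ∀ (s : ℝ) (T : Set ℝ), Convex ℝ T →
      IsPreconnected ((fun l : ℝ => γ s + l * (Complex.I * deriv γ s)) '' T) := fun s T hT =>
    hT.isPreconnected.image _ (by fun_prop)
  refine ⟨c, lam, hc, hlam, hK, hoff, fun s l h0 h1 => ?_, fun s l h0 h1 => ?_⟩
  · obtain ⟨l', h2, h3, h4, -⟩ := hnear s
    refine subset_inside_of_isPreconnected (hseg s _ (convex_Ioc 0 lam)) ?_ ⟨l', ⟨h2, h3⟩, rfl⟩ h4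
      ⟨l, ⟨h0, h1⟩, rfl⟩
    rintro _ ⟨r, hr, rfl⟩
    exact hoff s r (abs_pos.2 hr.1.ne') (by rw [abs_of_pos hr.1]; exact hr.2)
  · obtain ⟨l', h2, h3, -, h4⟩ := hnear s
    refine disjoint_inside_of_isPreconnected (hseg s _ (convex_Ico (-lam) 0)) ?_
      ⟨-l', ⟨by linarith, by linarith⟩, rfl⟩ h4 ⟨l, ⟨h1, h0⟩, rfl⟩
    rintro _ ⟨r, hr, rfl⟩
    exact hoff s r (abs_pos.2 hr.2.ne) (by rw [abs_of_neg hr.2]; linarith [hr.1])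

theorem IsSmoothContour.trace_subset_closure : trace γ ⊆ closure (inside γ) := by
  rintro _ ⟨s, rfl⟩
  obtain ⟨c, lam, hc, hlam, -, -, hin, -⟩ := hγ.exists_tube
  have h1 : Tendsto (fun l : ℝ => γ s + l * (Complex.I * deriv γ s)) (𝓝[>] 0) (𝓝 (γ s)) := by
    have : Continuous fun l : ℝ => γ s + l * (Complex.I * deriv γ s) := by fun_prop
    simpa using (this.tendsto 0).mono_left nhdsWithin_le_nhds
  refine mem_closure_of_tendsto h1 ?_
  filter_upwards [self_mem_nhdsWithin, mem_nhdsWithin_of_mem_nhds (Iic_mem_nhds hlam)]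
    with l h2 h3 using hin s l h2 h3

theorem IsSmoothContour.closure_inside : closure (inside γ) = inside γ ∪ trace γ :=
  hγ.closure_inside_subset.antisymm (union_subset subset_closure hγ.trace_subset_closure)

/-- Far away the integrand of the winding integral has modulus at most 1, which is incompatible with
the value 2πi. -/
theorem IsSmoothContour.isBounded_inside : Bornology.IsBounded (inside γ) := by
  obtain ⟨B, hB, hB'⟩ := exists_bound_of_periodic hγ.continuous hγ.periodic
  obtain ⟨M, hM, hM'⟩ := hγ.exists_norm_deriv_le
  refine isBounded_iff_forall_norm_le.2 ⟨B + M, fun z hz => ?_⟩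
  by_contra! hcon
  have := intervalIntegral.norm_integral_le_of_norm_le_const (a := 0) (b := 1)
    (f := fun s => deriv γ s / (γ s - z) ^ 1) (C := 1) fun s _ => by
      rw [pow_one, norm_div]
      have h1 := norm_sub_norm_le z (γ s)
      rw [norm_sub_rev] at h1
      have h2 := hB' s
      have h3 : M ≤ ‖γ s - z‖ := by linarith
      rw [div_le_one (by linarith)]
      exact (hM' s).trans h3
  have h4 := hγ.winding_inside hz
  rw [cauchyTransform] at h4
  rw [h4] at this
  simp only [norm_mul, Complex.norm_ofNat, Complex.norm_real, Complex.norm_I, mul_one, sub_zero,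
    abs_one, Real.norm_of_nonneg Real.pi_pos.le] at this
  linarith [Real.pi_gt_three]

theorem IsSmoothContour.isCompact_closure : IsCompact (closure (inside γ)) :=
  hγ.isBounded_inside.isCompact_closure

/-- The principal value of the Cauchy kernel at a point of the contour. -/
theorem IsSmoothContour.tendsto_truncatedIntegral_one {t : ℂ} (ht : t ∈ trace γ) :
    Tendsto (truncatedIntegral γ 1 (fun _ => 1) t) (𝓝[>] 0) (𝓝 (Real.pi * Complex.I)) := by
  obtain ⟨s, rfl⟩ := ht
  obtain ⟨c, lam, hc, hlam, -, -, hin, -⟩ := hγ.exists_tube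
  have hd : 0 < ‖deriv γ s‖ := norm_pos_iff.2 (hγ.deriv_ne_zero s)
  have h1 := hγ.tendsto_winding_sub_truncated (σ := 1) (by norm_num) s
  have h2 : Tendsto (fun ε : ℝ => truncatedIntegral γ 1 (fun _ => 1) (γ s) (ε * ‖deriv γ s‖))
      (𝓝[>] 0) (𝓝 (Real.pi * Complex.I)) := by
    -- Along the inner normal the winding integral is exactly 2πi, so the truncated integrals must
    -- tend to 2πi - πi.
    have h3 : Tendsto (fun ε : ℝ => cauchyTransform γ (deriv γ) 1
        (γ s + ((1 : ℝ) * ε : ℝ) * (Complex.I * deriv γ s))) (𝓝[>] 0)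
        (𝓝 (2 * Real.pi * Complex.I)) := by
      refine tendsto_const_nhds.congr' ?_
      filter_upwards [self_mem_nhdsWithin, mem_nhdsWithin_of_mem_nhds (Iic_mem_nhds hlam)]
        with l h2 h3
      rw [one_mul, hγ.winding_inside (hin s l h2 h3)]
    convert h3.sub h1 using 2
    · ring
    · push_cast
      ring
  have h4 : Tendsto (fun v : ℝ => v / ‖deriv γ s‖) (𝓝[>] 0) (𝓝[>] 0) := by
    refine tendsto_nhdsWithin_iff.2 ⟨?_, ?_⟩
    · have : Continuous fun v : ℝ => v / ‖deriv γ s‖ := by fun_prop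
      simpa using (this.tendsto 0).mono_left nhdsWithin_le_nhds
    · filter_upwards [self_mem_nhdsWithin] with v (hv : 0 < v)
      exact div_pos hv hd
  refine (h2.comp h4).congr fun v => ?_
  simp [hd.ne']

end

/-! ### Cauchy's theorem inside an open set, by Dixon's argument. -/

section

theorem dslope_comm_complex (h : ℂ → ℂ) (z w : ℂ) : dslope h z w = dslope h w z := by
  rcases eq_or_ne z w with rfl | hne
  · rfl
  · rw [dslope_of_ne _ hne.symm, dslope_of_ne _ hne, slope_comm]

/-- The divided differences of a holomorphic function are bounded, locally uniformly in one
variable and uniformly on compact sets in the other. -/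
theorem exists_norm_dslope_le {U K : Set ℂ} (hU : IsOpen U) {h : ℂ → ℂ}
    (hh : DifferentiableOn ℂ h U) (hK : IsCompact K) (hKU : K ⊆ U) {z₀ : ℂ} (hz₀ : z₀ ∈ U) :
    ∃ r > 0, Metric.closedBall z₀ (2 * r) ⊆ U ∧ ∃ C : ℝ, ∀ w ∈ K,
      ∀ z ∈ Metric.closedBall z₀ (2 * r), ‖dslope h w z‖ ≤ C := by
  obtain ⟨R, hR, hball⟩ := Metric.isOpen_iff.1 hU z₀ hz₀
  have hcb : Metric.closedBall z₀ (3 * (R / 4)) ⊆ U :=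
    (Metric.closedBall_subset_ball (by linarith)).trans hball
  have hsub : Metric.closedBall z₀ (2 * (R / 4)) ⊆ Metric.closedBall z₀ (3 * (R / 4)) :=
    Metric.closedBall_subset_closedBall (by linarith)
  obtain ⟨C₁, hC₁⟩ := (isCompact_closedBall z₀ (3 * (R / 4))).exists_bound_of_continuousOn
    ((hh.deriv hU).continuousOn.mono hcb)
  obtain ⟨C₂, hC₂⟩ := (isCompact_closedBall z₀ (3 * (R / 4))).exists_bound_of_continuousOn
    (hh.continuousOn.mono hcb)
  obtain ⟨C₃, hC₃⟩ := hK.exists_bound_of_continuousOn (hh.continuousOn.mono hKU)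
  refine ⟨R / 4, by positivity, hsub.trans hcb, max C₁ ((C₂ + C₃) / (R / 4)),
    fun w hw z hz => ?_⟩
  -- Near z₀ the mean value inequality bounds the quotient by the derivative; otherwise |z - w| ≥
  -- R/4 bounds its denominator.
  by_cases hwb : w ∈ Metric.closedBall z₀ (3 * (R / 4))
  · refine le_trans ?_ (le_max_left _ _)
    rcases eq_or_ne z w with rfl | hne
    · rw [dslope_same]
      exact hC₁ _ hwb
    · rw [dslope_of_ne _ hne, slope_def_module, norm_smul, norm_inv, inv_mul_le_iff₀
        (norm_pos_iff.2 (sub_ne_zero.2 hne)), mul_comm]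
      exact (convex_closedBall z₀ _).norm_image_sub_le_of_norm_deriv_le
        (fun x hx => hh.differentiableAt (hU.mem_nhds (hcb hx))) hC₁ hwb (hsub hz)
  · refine le_trans ?_ (le_max_right _ _)
    have hd : R / 4 ≤ ‖z - w‖ := by
      rw [Metric.mem_closedBall, not_le] at hwb
      rw [Metric.mem_closedBall] at hz
      rw [← dist_eq_norm]
      have := dist_triangle w z z₀
      rw [dist_comm w z] at this
      linarith
    have hne : z ≠ w := by
      rintro rfl
      rw [sub_self, norm_zero] at hd
      linarith
    rw [dslope_of_ne _ hne, slope_def_module, norm_smul, norm_inv, ← div_eq_inv_mul]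
    have h1 := hC₂ z (hsub hz)
    have h2 := hC₃ w hw
    gcongr
    · exact (norm_nonneg _).trans (norm_sub_le (h z) (h w)) |>.trans (by linarith)
    · exact (norm_sub_le _ _).trans (by linarith)

section closedCurve

variable {η η' : ℝ → ℂ} {U : Set ℂ} {h : ℂ → ℂ}

/-- The divided difference is symmetric, hence holomorphic in z for each point of the curve.
Cauchy's estimate turns its bound on a ball of radius 2r into a bound for its z-derivative on the
ball of radius r, which justifies differentiating under the integral. -/
theorem differentiableOn_integral_dslope (hU : IsOpen U) (hh : DifferentiableOn ℂ h U)
    (hη : Continuous η) (hη' : Continuous η') (hmem : ∀ s, η s ∈ U) :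
    DifferentiableOn ℂ (fun z => ∫ s in (0 : ℝ)..1, dslope h z (η s) * η' s) U := by
  intro z₀ hz₀
  refine DifferentiableAt.differentiableWithinAt ?_
  obtain ⟨r, hr, hrU, C, hC⟩ := exists_norm_dslope_le hU hh (isCompact_Icc.image hη)
    (by rintro _ ⟨s, -, rfl⟩; exact hmem s) (K := η '' Icc 0 1) hz₀
  obtain ⟨M, hM, hM'⟩ := exists_norm_le_Icc hη'
  have hsub : Ι (0 : ℝ) 1 ⊆ Icc 0 1 := by
    rw [uIoc_of_le zero_le_one]; exact Ioc_subset_Icc_self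
  have hr2 : Metric.ball z₀ (2 * r) ⊆ U := Metric.ball_subset_closedBall.trans hrU
  have hr1 : Metric.ball z₀ r ⊆ U := (Metric.ball_subset_ball (by linarith)).trans hr2
  have hdd : ∀ w ∈ U, DifferentiableOn ℂ (dslope h w) U := fun w hw =>
    (Complex.differentiableOn_dslope (hU.mem_nhds hw)).2 hh
  have hcont : ∀ z ∈ U, Continuous fun s => dslope h z (η s) * η' s := fun z hz =>
    ((hdd z hz).continuousOn.comp_continuous hη hmem).mul hη'
  have hd : ∀ s, ∀ z ∈ U, HasDerivAt (fun z => dslope h z (η s) * η' s)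
      (deriv (dslope h (η s)) z * η' s) z := fun s z hz => by
    simp only [dslope_comm_complex h _ (η s)]
    exact (((hdd _ (hmem s)).differentiableAt (hU.mem_nhds hz)).hasDerivAt).mul_const _
  have key := intervalIntegral.hasDerivAt_integral_of_dominated_loc_of_deriv_le
    (μ := volume) (a := 0) (b := 1) (F := fun z s => dslope h z (η s) * η' s)
    (F' := fun z s => deriv (dslope h (η s)) z * η' s) (x₀ := z₀) (s := Metric.ball z₀ r)
    (bound := fun _ => C / r * M) (Metric.ball_mem_nhds _ hr)
    (eventually_of_mem (Metric.ball_mem_nhds _ hr) fun z hz =>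
      (hcont z (hr1 hz)).aestronglyMeasurable)
    ((hcont z₀ hz₀).intervalIntegrable _ _) ?_ ?_ intervalIntegrable_const ?_
  · exact key.2.differentiableAt
  -- Measurability in s of the z-derivative: it is a limit of a sequence of difference quotients,
  -- each continuous in s.
  · obtain ⟨ε, hε⟩ : ∃ ε : ℕ → ℂ, Tendsto ε atTop (𝓝[≠] z₀) := exists_seq_tendsto _
    have hεU : ∀ᶠ n in atTop, ε n ∈ U :=
      (hε.mono_right nhdsWithin_le_nhds).eventually (hU.mem_nhds hz₀)
    obtain ⟨N, hN⟩ := eventually_atTop.1 hεU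
    refine aestronglyMeasurable_of_tendsto_ae atTop
      (f := fun n s => slope (fun z => dslope h z (η s) * η' s) z₀ (ε (n + N))) (fun n => ?_)
      (Eventually.of_forall fun s => ?_)
    · refine Continuous.aestronglyMeasurable ?_
      simp only [slope_def_field]
      exact ((hcont _ (hN _ (Nat.le_add_left _ _))).sub (hcont z₀ hz₀)).div_const _
    · exact (hasDerivAt_iff_tendsto_slope.1 (hd s z₀ hz₀)).comp
        (hε.comp (tendsto_add_atTop_nat N))
  · refine Eventually.of_forall fun s hs z hz => ?_
    rw [norm_mul]
    have hs' := hsub hs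
    have hC0 : 0 ≤ C := (norm_nonneg _).trans
      (hC (η s) ⟨s, hs', rfl⟩ z₀ (Metric.mem_closedBall_self (by positivity)))
    refine mul_le_mul ?_ (hM' s hs') (norm_nonneg _) (by positivity)
    have hcb : Metric.closedBall z r ⊆ Metric.closedBall z₀ (2 * r) :=
      Metric.closedBall_subset_closedBall' (by rw [Metric.mem_ball] at hz; linarith)
    refine Complex.norm_deriv_le_of_forall_mem_sphere_norm_le hr ?_
      fun w hw => hC _ ⟨s, hs', rfl⟩ w (hcb (Metric.sphere_subset_closedBall hw))
    refine DifferentiableOn.diffContOnCl ?_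
    rw [closure_ball _ hr.ne']
    exact (hdd _ (hmem s)).mono (hcb.trans hrU)
  · exact Eventually.of_forall fun s _ z hz => hd s z (hr1 hz)

/-- Cauchy's theorem for a closed curve in a bounded open set, no point of the complement of
which is enclosed by the curve. -/
theorem integral_eq_zero_of_winding_eq_zero (hU : IsOpen U) (hUb : Bornology.IsBounded U)
    (hh : DifferentiableOn ℂ h U) (hη : ∀ s, HasDerivAt η (η' s) s) (hη' : Continuous η')
    (hcl : η 1 = η 0) (hmem : ∀ s, η s ∈ U)
    (hw : ∀ z ∉ U, cauchyTransform η η' 1 z = 0) :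
    ∫ s in (0 : ℝ)..1, h (η s) * η' s = 0 := by
  classical
  have hc : Continuous η := continuous_iff_continuousAt.2 fun s => (hη s).continuousAt
  have hhη : Continuous fun s => h (η s) := hh.continuousOn.comp_continuous hc hmem
  set u : ℝ → ℂ := fun s => h (η s) * η' s with hu
  have huc : Continuous u := hhη.mul hη'
  -- Dixon's function. The two formulas agree at points off the curve with winding zero, a set which
  -- contains a neighbourhood of each point outside U; hence F is entire, vanishes at infinity, and
  -- is zero.
  set F : ℂ → ℂ := fun z => if z ∈ U then ∫ s in (0 : ℝ)..1, dslope h z (η s) * η' s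
    else cauchyTransform η u 1 z with hF
  have hFU : ∀ z ∈ U, F z = ∫ s in (0 : ℝ)..1, dslope h z (η s) * η' s := fun z hz => if_pos hz
  have hFW : ∀ z ∉ η '' Icc 0 1, cauchyTransform η η' 1 z = 0 →
      F z = cauchyTransform η u 1 z := by
    intro z hzK hz0
    by_cases hzU : z ∈ U
    · have hne : ∀ s ∈ uIcc (0 : ℝ) 1, η s - z ≠ 0 := fun s hs h => by
        rw [uIcc_of_le zero_le_one] at hs
        exact hzK ⟨s, hs, sub_eq_zero.1 h⟩
      have hint : ∀ v : ℝ → ℂ, Continuous v →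
          IntervalIntegrable (fun s => v s / (η s - z) ^ 1) volume 0 1 := fun v hv =>
        (hv.continuousOn.div (by fun_prop)
          fun s hs => pow_ne_zero _ (hne s hs)).intervalIntegrable
      have h1 : cauchyTransform η u 1 z = ∫ s in (0 : ℝ)..1,
          (u s / (η s - z) ^ 1 - h z * (η' s / (η s - z) ^ 1)) := by
        rw [intervalIntegral.integral_sub (hint u huc) ((hint η' hη').const_mul _),
          intervalIntegral.integral_const_mul]
        change _ = cauchyTransform η u 1 z - h z * cauchyTransform η η' 1 z
        rw [hz0, mul_zero, sub_zero]
      rw [hFU z hzU, h1]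
      refine intervalIntegral.integral_congr fun s hs => ?_
      have h2 := hne s hs
      rw [dslope_of_ne _ (sub_ne_zero.1 h2), slope_def_field, hu]
      field_simp
    · exact if_neg hzU
  have hdiff : Differentiable ℂ F := by
    intro z
    by_cases hzU : z ∈ U
    · have h1 := (differentiableOn_integral_dslope hU hh hc hη' hmem).differentiableAt
        (hU.mem_nhds hzU)
      exact h1.congr_of_eventuallyEq (eventually_of_mem (hU.mem_nhds hzU) hFU)
    · have hzK : z ∉ η '' Icc 0 1 := by
        rintro ⟨s, -, rfl⟩
        exact hzU (hmem s)
      obtain ⟨r, hr, hball⟩ := Metric.isOpen_iff.1 (isOpen_compl_image hc) z hzK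
      have h1 : F =ᶠ[𝓝 z] cauchyTransform η u 1 := by
        refine eventually_of_mem (Metric.ball_mem_nhds z hr) fun w hw' => hFW w (hball hw') ?_
        rw [← hw z hzU]
        exact winding_eq_of_isPreconnected hη hη' hcl (convex_ball z r).isPreconnected hball hw'
          (Metric.mem_ball_self hr)
      exact (hasDerivAt_cauchyTransform hc huc
        (fun s hs he => hzK ⟨s, hs, he⟩) 1).differentiableAt.congr_of_eventuallyEq h1
  have hUc : ∀ᶠ z in cocompact ℂ, z ∉ U := by
    rw [← Metric.cobounded_eq_cocompact]
    exact hUb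
  have hev : F =ᶠ[cocompact ℂ] cauchyTransform η u 1 := by
    filter_upwards [hUc] with z hz using if_neg hz
  have hF0 : ∀ z, F z = 0 := fun z => hdiff.apply_eq_of_tendsto_cocompact z
    ((tendsto_cauchyTransform_cocompact huc hc).congr' hev.symm)
  -- From uη/(η - z) = u + z · u/(η - z) and F = 0, the transform of uη equals ∫ u for all large z;
  -- but it also tends to 0.
  have hfin : ∀ᶠ z in cocompact ℂ,
      cauchyTransform η (fun s => u s * η s) 1 z = ∫ s in (0 : ℝ)..1, u s := by
    filter_upwards [hev, hUc] with z hz hzU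
    have hne : ∀ s, η s - z ≠ 0 := fun s he => hzU (sub_eq_zero.1 he ▸ hmem s)
    have hint : ∀ v : ℝ → ℂ, Continuous v →
        IntervalIntegrable (fun s => v s / (η s - z) ^ 1) volume 0 1 := fun v hv =>
      (hv.div (by fun_prop) fun s => pow_ne_zero _ (hne s)).intervalIntegrable _ _
    rw [hF0] at hz
    have h1 : cauchyTransform η (fun s => u s * η s) 1 z = ∫ s in (0 : ℝ)..1,
        (u s + z * (u s / (η s - z) ^ 1)) := by
      refine intervalIntegral.integral_congr fun s _ => ?_
      have := hne s
      field_simp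
      ring
    rw [h1, intervalIntegral.integral_add (huc.intervalIntegrable _ _) ((hint u huc).const_mul _),
      intervalIntegral.integral_const_mul]
    change _ + z * cauchyTransform η u 1 z = _
    rw [← hz, mul_zero, add_zero]
  exact tendsto_nhds_unique (tendsto_const_nhds.congr' (hfin.mono fun _ h => h.symm))
    (tendsto_cauchyTransform_cocompact (huc.mul hc) hc)

end closedCurve

end

/-! ### Cauchy's theorem up to the boundary, by pushing the contour inwards. -/

section

variable {γ : ℝ → ℂ} (hγ : IsSmoothContour 1 γ)
include hγ

/-- A continuously differentiable field of vectors along the contour which points inwards. -/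
theorem IsSmoothContour.exists_inward_field : ∃ (n n' : ℝ → ℂ) (lam : ℝ), 0 < lam ∧
    (∀ s, HasDerivAt n (n' s) s) ∧ Continuous n' ∧ Function.Periodic n 1 ∧
    ∀ s l : ℝ, 0 < l → l ≤ lam → γ s + l * n s ∈ inside γ := by
  obtain ⟨c, lam, hc, hlam, hK, -, hin, -⟩ := hγ.exists_tube
  obtain ⟨δ, hδ, hδ'⟩ := hγ.linear_approx (η := c / 2) (by positivity)
  have hcγ' := hγ.continuous_deriv
  -- For a C¹ contour the normal iγ' is merely continuous, and the pushed curve needs a derivative.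
  -- A symmetric difference quotient is C¹ and differs from iγ' by at most c/2.
  refine ⟨fun s => Complex.I * ((γ (s + δ) - γ (s - δ)) / (2 * δ)),
    fun s => Complex.I * ((deriv γ (s + δ) - deriv γ (s - δ)) / (2 * δ)), lam, hlam,
    fun s => ?_, by fun_prop, fun s => ?_, fun s l hl hl' => ?_⟩
  · have h1 : HasDerivAt (fun s : ℝ => γ (s + δ)) (deriv γ (s + δ)) s :=
      (hγ.hasDerivAt (s + δ)).comp_add_const s δ
    have h2 : HasDerivAt (fun s : ℝ => γ (s - δ)) (deriv γ (s - δ)) s :=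
      (hγ.hasDerivAt (s - δ)).comp_sub_const s δ
    exact ((h1.fun_sub h2).div_const _).const_mul _
  · have h1 : s + 1 + δ = s + δ + 1 := by ring
    have h2 : s + 1 - δ = s - δ + 1 := by ring
    simp only [h1, h2, hγ.periodic (s + δ), hγ.periodic (s - δ)]
  · set n := Complex.I * ((γ (s + δ) - γ (s - δ)) / (2 * δ)) with hn
    have hclose : ‖n - Complex.I * deriv γ s‖ ≤ c / 2 := by
      have h1 := hδ' s (s + δ) (by rw [add_sub_cancel_left, abs_of_pos hδ])
      have h2 := hδ' s (s - δ) (by rw [sub_sub_cancel_left, abs_neg, abs_of_pos hδ])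
      rw [add_sub_cancel_left, abs_of_pos hδ] at h1
      rw [sub_sub_cancel_left, abs_neg, abs_of_pos hδ] at h2
      have h3 : n - Complex.I * deriv γ s = Complex.I / (2 * δ) *
          ((γ (s + δ) - γ s - (δ : ℝ) * deriv γ s) -
            (γ (s - δ) - γ s - (-δ : ℝ) * deriv γ s)) := by
        have : (δ : ℂ) ≠ 0 := by exact_mod_cast hδ.ne'
        rw [hn]
        push_cast
        field_simp
        ring
      rw [h3, norm_mul, norm_div, norm_mul, Complex.norm_I, Complex.norm_ofNat, Complex.norm_real,
        Real.norm_of_nonneg hδ.le]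
      calc 1 / (2 * δ) * _ ≤ 1 / (2 * δ) * (c / 2 * δ + c / 2 * δ) := by
            gcongr
            exact (norm_sub_le _ _).trans (add_le_add h1 h2)
        _ = c / 2 := by field_simp; ring
    -- The segment from the point on the true normal to the modified one avoids the trace: the
    -- deviation is at most lc/2, while the normal point is at distance at least cl from L.
    have hseg : IsPreconnected ((fun r : ℝ => γ s + l * (Complex.I * deriv γ s
        + r * (n - Complex.I * deriv γ s))) '' Icc 0 1) :=
      (convex_Icc (0 : ℝ) 1).isPreconnected.image _ (by fun_prop)
    refine subset_inside_of_isPreconnected hseg ?_ ⟨0, by simp, rfl⟩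
      (by simpa using hin s l hl hl') ⟨1, by simp, by simp [← hn]⟩
    rintro _ ⟨r, hr, rfl⟩ hmem
    obtain ⟨s', hs', he⟩ := hγ.exists_mem_trace hmem s
    have h4 := hK s s' l hs' (by rwa [abs_of_pos hl])
    rw [abs_of_pos hl] at h4
    have h5 : γ s' - (γ s + l * (Complex.I * deriv γ s)) = l * (r * (n - Complex.I * deriv γ s)) := by
      rw [he]
      ring
    rw [h5, norm_mul, norm_mul, Complex.norm_real, Complex.norm_real, Real.norm_of_nonneg hl.le,
      Real.norm_of_nonneg hr.1] at h4
    have h6 : l * (r * ‖n - Complex.I * deriv γ s‖) ≤ l * (1 * (c / 2)) := by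
      gcongr
      exact hr.2
    have h7 : 0 ≤ c * |s' - s| := by positivity
    nlinarith

/-- An exterior component is unbounded and disjoint from a curve lying inside. Points of L itself
are reached from the exterior along the outer normal, by continuity of the transform of η. -/
theorem IsSmoothContour.winding_eq_zero_of_inside {η η' : ℝ → ℂ}
    (hη : ∀ s, HasDerivAt η (η' s) s) (hη' : Continuous η') (hcl : η 1 = η 0)
    (hmem : ∀ s, η s ∈ inside γ) {z : ℂ} (hz : z ∉ inside γ) :
    cauchyTransform η η' 1 z = 0 := by
  have hc : Continuous η := continuous_iff_continuousAt.2 fun s => (hη s).continuousAt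
  have hout : ∀ w ∉ trace γ, w ∉ inside γ → cauchyTransform η η' 1 w = 0 := by
    intro w hw hw'
    refine winding_eq_zero_of_not_isBounded hη hη' hcl
      (isPreconnected_connectedComponentIn (F := (trace γ)ᶜ) (x := w)) ?_
      (fun h => hw' ⟨hw, h⟩) (mem_connectedComponentIn hw)
    rintro v hv ⟨s, -, rfl⟩
    exact disjoint_inside_of_isPreconnected isPreconnected_connectedComponentIn
      (connectedComponentIn_subset _ _) (mem_connectedComponentIn hw) hw' hv (hmem s)
  by_cases hzt : z ∈ trace γ
  · obtain ⟨s, rfl⟩ := hzt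
    obtain ⟨c, lam, hc', hlam, -, hoff, -, hex⟩ := hγ.exists_tube
    have hzK : ∀ r ∈ Icc (0 : ℝ) 1, η r ≠ γ s := fun r _ h => hz (h ▸ hmem r)
    have h1 : Tendsto (fun l : ℝ => γ s + l * (Complex.I * deriv γ s)) (𝓝[<] 0) (𝓝 (γ s)) := by
      have : Continuous fun l : ℝ => γ s + l * (Complex.I * deriv γ s) := by fun_prop
      simpa using (this.tendsto 0).mono_left nhdsWithin_le_nhds
    have h2 := (hasDerivAt_cauchyTransform hc hη' hzK 1).continuousAt.tendsto.comp h1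
    refine tendsto_nhds_unique h2 (tendsto_const_nhds.congr' ?_)
    filter_upwards [self_mem_nhdsWithin,
      mem_nhdsWithin_of_mem_nhds (Ici_mem_nhds (neg_lt_zero.2 hlam))] with l h2 h3
    have h2 : l < 0 := h2
    have h3 : -lam ≤ l := h3
    exact (hout _ (hoff s l (abs_pos.2 h2.ne) (by rw [abs_of_neg h2]; linarith))
      (hex s l h2 h3)).symm
  · exact hout z hzt hz

/-- **Cauchy's theorem** for functions which are continuous on the closed inner domain. -/
theorem IsSmoothContour.integral_eq_zero {h : ℂ → ℂ} (hh : DiffContOnCl ℂ h (inside γ)) :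
    ∫ s in (0 : ℝ)..1, h (γ s) * deriv γ s = 0 := by
  obtain ⟨n, n', lam, hlam, hn, hn', hper, hin⟩ := hγ.exists_inward_field
  have hnc : Continuous n := continuous_iff_continuousAt.2 fun s => (hn s).continuousAt
  have hcγ := hγ.continuous
  have hcγ' := hγ.continuous_deriv
  -- Each pushed curve lies inside, where Dixon's version applies; then l → 0 by dominated
  -- convergence.
  have hzero : ∀ l : ℝ, 0 < l → l ≤ lam →
      ∫ s in (0 : ℝ)..1, h (γ s + l * n s) * (deriv γ s + l * n' s) = 0 := by
    intro l hl hl'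
    have hη : ∀ s, HasDerivAt (fun s => γ s + l * n s) (deriv γ s + l * n' s) s := fun s =>
      (hγ.hasDerivAt s).fun_add ((hn s).const_mul _)
    have hη' : Continuous fun s => deriv γ s + l * n' s := by fun_prop
    have hcl : γ 1 + l * n 1 = γ 0 + l * n 0 := by
      have h0 : n 1 = n 0 := by simpa using hper 0
      rw [hγ.closed, h0]
    exact integral_eq_zero_of_winding_eq_zero (η := fun s => γ s + l * n s) hγ.isOpen_inside
      hγ.isBounded_inside hh.differentiableOn hη hη' hcl (fun s => hin s l hl hl')
      fun z hz => hγ.winding_eq_zero_of_inside hη hη' hcl (fun s => hin s l hl hl') hz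
  obtain ⟨B, hB⟩ := hγ.isCompact_closure.exists_bound_of_continuousOn hh.continuousOn
  obtain ⟨M, hM, hM'⟩ := hγ.exists_norm_deriv_le
  obtain ⟨N, hN, hN'⟩ := exists_norm_le_Icc hn'
  have hsmall : ∀ᶠ l : ℝ in 𝓝[>] 0, 0 < l ∧ l ≤ lam := by
    filter_upwards [self_mem_nhdsWithin, mem_nhdsWithin_of_mem_nhds (Iic_mem_nhds hlam)]
      with l h1 h2 using ⟨h1, h2⟩
  have hlim : Tendsto (fun l : ℝ => ∫ s in (0 : ℝ)..1, h (γ s + l * n s) * (deriv γ s + l * n' s))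
      (𝓝[>] 0) (𝓝 (∫ s in (0 : ℝ)..1, h (γ s) * deriv γ s)) := by
    refine intervalIntegral.tendsto_integral_filter_of_dominated_convergence
      (fun _ => B * (M + lam * N)) ?_ ?_ intervalIntegrable_const ?_
    · filter_upwards [hsmall] with l ⟨hl, hl'⟩
      refine Continuous.aestronglyMeasurable ?_
      exact (hh.continuousOn.comp_continuous (by fun_prop)
        fun s => subset_closure (hin s l hl hl')).mul (by fun_prop)
    · filter_upwards [hsmall] with l ⟨hl, hl'⟩
      refine Eventually.of_forall fun s hs => ?_
      rw [uIoc_of_le zero_le_one] at hs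
      have h1 := hB _ (subset_closure (hin s l hl hl'))
      rw [norm_mul]
      refine mul_le_mul h1 ?_ (norm_nonneg _) ((norm_nonneg _).trans h1)
      refine (norm_add_le _ _).trans (add_le_add (hM' s) ?_)
      rw [norm_mul, Complex.norm_real, Real.norm_of_nonneg hl.le]
      exact mul_le_mul hl' (hN' s (Ioc_subset_Icc_self hs)) (norm_nonneg _) hlam.le
    · refine Eventually.of_forall fun s _ => ?_
      have h1 : Tendsto (fun l : ℝ => γ s + l * n s) (𝓝[>] 0) (𝓝[closure (inside γ)] (γ s)) := by
        refine tendsto_nhdsWithin_iff.2 ⟨?_, ?_⟩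
        · have : Continuous fun l : ℝ => γ s + l * n s := by fun_prop
          simpa using (this.tendsto 0).mono_left nhdsWithin_le_nhds
        · filter_upwards [hsmall] with l ⟨hl, hl'⟩ using subset_closure (hin s l hl hl')
      have h2 : Tendsto (fun l : ℝ => deriv γ s + l * n' s) (𝓝[>] 0) (𝓝 (deriv γ s)) := by
        have : Continuous fun l : ℝ => deriv γ s + l * n' s := by fun_prop
        simpa using (this.tendsto 0).mono_left nhdsWithin_le_nhds
      exact ((hh.continuousOn _ (hγ.trace_subset_closure ⟨s, rfl⟩)).tendsto.comp h1).mul h2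
  refine tendsto_nhds_unique hlim (tendsto_const_nhds.congr' ?_)
  filter_upwards [hsmall] with l ⟨hl, hl'⟩
  exact (hzero l hl hl').symm

end

/-! ### Cauchy's formula and the characterization of boundary values. -/

section

variable {γ : ℝ → ℂ} (hγ : IsSmoothContour 1 γ)
include hγ

theorem IsSmoothContour.exterior_of_normal {z : ℂ} (h1 : z ∉ trace γ) (h2 : z ∉ inside γ) :
    z ∉ closure (inside γ) := by
  rw [hγ.closure_inside]
  exact fun h => h.elim h2 h1

theorem IsSmoothContour.cauchyTransform_exterior {h : ℂ → ℂ} (hh : DiffContOnCl ℂ h (inside γ))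
    {z : ℂ} (hz : z ∉ closure (inside γ)) (k : ℕ) :
    cauchyTransform γ (fun s => h (γ s) * deriv γ s) k z = 0 := by
  have hne : ∀ w ∈ closure (inside γ), (w - z) ^ k ≠ 0 := fun w hw =>
    pow_ne_zero _ (sub_ne_zero.2 fun he => hz (he ▸ hw))
  have hd : DiffContOnCl ℂ (fun w => h w / (w - z) ^ k) (inside γ) :=
    ⟨hh.differentiableOn.div (by fun_prop) fun w hw => hne w (subset_closure hw),
      hh.continuousOn.div (by fun_prop) hne⟩
  rw [← hγ.integral_eq_zero hd, cauchyTransform]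
  refine intervalIntegral.integral_congr fun s _ => ?_
  ring

/-- **Cauchy's integral formula** for functions which are continuous on the closed inner domain. -/
theorem IsSmoothContour.cauchyTransform_inside {h : ℂ → ℂ} (hh : DiffContOnCl ℂ h (inside γ))
    {z : ℂ} (hz : z ∈ inside γ) :
    cauchyTransform γ (fun s => h (γ s) * deriv γ s) 1 z = 2 * Real.pi * Complex.I * h z := by
  have hnhds : inside γ ∈ 𝓝 z := hγ.isOpen_inside.mem_nhds hz
  -- Cauchy's theorem for the divided difference, combined with winding 2πi about z, is the integral
  -- formula.
  have hd : DiffContOnCl ℂ (dslope h z) (inside γ) := by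
    refine ⟨(Complex.differentiableOn_dslope hnhds).2 hh.differentiableOn, ?_⟩
    rw [continuousOn_dslope (mem_of_superset hnhds subset_closure)]
    exact ⟨hh.continuousOn, hh.differentiableOn.differentiableAt hnhds⟩
  have hne : ∀ s, γ s - z ≠ 0 := fun s he => hz.1 ⟨s, sub_eq_zero.1 he⟩
  have hcγ := hγ.continuous
  have hcγ' := hγ.continuous_deriv
  have hch : Continuous fun s => h (γ s) := hh.continuousOn.comp_continuous hcγ
    fun s => hγ.trace_subset_closure ⟨s, rfl⟩
  have hint : ∀ v : ℝ → ℂ, Continuous v →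
      IntervalIntegrable (fun s => v s / (γ s - z) ^ 1) volume 0 1 := fun v hv =>
    (hv.div (by fun_prop) fun s => pow_ne_zero _ (hne s)).intervalIntegrable _ _
  have h0 := hγ.integral_eq_zero hd
  have h1 : ∫ s in (0 : ℝ)..1, dslope h z (γ s) * deriv γ s = ∫ s in (0 : ℝ)..1,
      (h (γ s) * deriv γ s / (γ s - z) ^ 1 - h z * (deriv γ s / (γ s - z) ^ 1)) := by
    refine intervalIntegral.integral_congr fun s _ => ?_
    have := hne s
    rw [dslope_of_ne _ (sub_ne_zero.1 this), slope_def_field]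
    field_simp
  rw [h1, intervalIntegral.integral_sub (hint (fun s => h (γ s) * deriv γ s) (hch.mul hcγ'))
    ((hint _ hcγ').const_mul _),
    intervalIntegral.integral_const_mul] at h0
  have h2 : cauchyTransform γ (fun s => h (γ s) * deriv γ s) 1 z
    - h z * cauchyTransform γ (deriv γ) 1 z = 0 := h0
  rw [hγ.winding_inside hz] at h2
  linear_combination h2

-- The integrand has the primitive arctan((r - s)/l), whose total variation is below π whatever l
-- is.
omit hγ in
theorem integral_poisson_le {l : ℝ} (hl : 0 < l) (s : ℝ) :
    ∫ r in (s - 1 / 2)..(s - 1 / 2) + 1, l / ((r - s) ^ 2 + l ^ 2) ≤ Real.pi := by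
  have h1 : ∀ r ∈ uIcc (s - 1 / 2) ((s - 1 / 2) + 1),
      HasDerivAt (fun r => Real.arctan ((r - s) / l)) (l / ((r - s) ^ 2 + l ^ 2)) r := by
    intro r _
    have h2 : HasDerivAt (fun r => (r - s) / l) (1 / l) r :=
      ((hasDerivAt_id r).sub_const s).div_const l
    convert! h2.arctan using 1
    field_simp
    ring
  have h3 : Continuous fun r : ℝ => l / ((r - s) ^ 2 + l ^ 2) :=
    continuous_const.div (by fun_prop) fun r => by positivity
  rw [intervalIntegral.integral_eq_sub_of_hasDerivAt h1 (h3.intervalIntegrable _ _)]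
  linarith [Real.arctan_lt_pi_div_two ((s - 1 / 2 + 1 - s) / l),
    Real.neg_pi_div_two_lt_arctan ((s - 1 / 2 - s) / l)]

/-- The Cauchy integral of a continuous density, whose Cauchy integral vanishes in the exterior,
tends to the density along the inner normals, uniformly. -/
theorem IsSmoothContour.exists_forall_cauchyTransform_sub_le {u : ℝ → ℂ} (hu : Continuous u)
    (hup : Function.Periodic u 1)
    (hext : ∀ z ∉ closure (inside γ), cauchyTransform γ (fun s => u s * deriv γ s) 1 z = 0)
    {e : ℝ} (he : 0 < e) : ∃ l₀ > 0, ∀ s l : ℝ, 0 < l → l ≤ l₀ →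
      ‖cauchyTransform γ (fun s => u s * deriv γ s) 1 (γ s + l * (Complex.I * deriv γ s))
        - 2 * Real.pi * Complex.I * u s‖ ≤ e := by
  obtain ⟨c, lam, hc, hlam, hK, hoff, hin, hex⟩ := hγ.exists_tube
  obtain ⟨M, hM, hM'⟩ := hγ.exists_norm_deriv_le
  obtain ⟨B, hB, hB'⟩ := exists_bound_of_periodic hu hup
  have hcγ := hγ.continuous
  have hcγ' := hγ.continuous_deriv
  set A := 2 * M ^ 2 / c ^ 2 with hA
  have hA0 : 0 < A := by positivity
  -- With this choice the near part A·e₁·π equals e/2; the second bound in `l₀` makes the far part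
  -- 2ABl/δ² at most e/2.
  set e₁ := e / (2 * A * Real.pi) with he₁
  have hpi := Real.pi_pos
  have he₁0 : 0 < e₁ := by positivity
  obtain ⟨δ, hδ, hδ'⟩ := Metric.uniformContinuous_iff.1
    (uniformContinuous_of_continuous_of_periodic hu hup) e₁ he₁0
  set l₀ := min lam (e * δ ^ 2 / (4 * A * B)) with hl₀
  refine ⟨l₀, by positivity, fun s l hl hl' => ?_⟩
  set d := Complex.I * deriv γ s with hd
  have hll : l ≤ lam := hl'.trans (min_le_left _ _)
  have hl2 : l ≤ e * δ ^ 2 / (4 * A * B) := hl'.trans (min_le_right _ _)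
  have hzin := hin s l hl hll
  have hzoff := hoff s (-l) (by simpa using hl.ne') (by rwa [abs_neg, abs_of_pos hl])
  have hzex := hex s (-l) (by linarith) (by linarith)
  set z := γ s + l * d with hz
  set z' := γ s + (-l : ℝ) * d with hz'
  have hne : ∀ r, γ r - z ≠ 0 := fun r h => hzin.1 ⟨r, sub_eq_zero.1 h⟩
  have hne' : ∀ r, γ r - z' ≠ 0 := fun r h => hzoff ⟨r, sub_eq_zero.1 h⟩
  have hint : ∀ v : ℝ → ℂ, Continuous v → Continuous (fun r => v r / (γ r - z) ^ 1) :=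
    fun v hv => hv.div (by fun_prop) fun r => pow_ne_zero _ (hne r)
  have hint' : ∀ v : ℝ → ℂ, Continuous v → Continuous (fun r => v r / (γ r - z') ^ 1) :=
    fun v hv => hv.div (by fun_prop) fun r => pow_ne_zero _ (hne' r)
  have hudc : Continuous fun r => u r * deriv γ r := hu.mul hcγ'
  -- Subtract the same expression at the mirror point z' on the outer normal, where both the
  -- transform and the winding integral vanish. The difference of the two kernels is bounded by a
  -- Poisson kernel.
  have h1 : cauchyTransform γ (fun s => u s * deriv γ s) 1 z - 2 * Real.pi * Complex.I * u s =
      ∫ r in (0 : ℝ)..1, (u r - u s) * deriv γ r * (z - z') / ((γ r - z) * (γ r - z')) := by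
    have h2 := hext z' (hγ.exterior_of_normal hzoff hzex)
    have h3 := hγ.winding_inside hzin
    have h4 := hγ.winding_outside hzoff hzex
    have h5 : cauchyTransform γ (fun s => u s * deriv γ s) 1 z - 2 * Real.pi * Complex.I * u s =
        (cauchyTransform γ (fun s => u s * deriv γ s) 1 z
          - u s * cauchyTransform γ (deriv γ) 1 z)
        - (cauchyTransform γ (fun s => u s * deriv γ s) 1 z'
          - u s * cauchyTransform γ (deriv γ) 1 z') := by
      rw [h2, h3, h4]
      ring
    rw [h5]
    simp only [cauchyTransform]
    rw [← intervalIntegral.integral_const_mul, ← intervalIntegral.integral_const_mul,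
      ← intervalIntegral.integral_sub ((hint _ hudc).intervalIntegrable _ _)
        (((hint _ hcγ').const_mul _).intervalIntegrable _ _),
      ← intervalIntegral.integral_sub ((hint' _ hudc).intervalIntegrable _ _)
        (((hint' _ hcγ').const_mul _).intervalIntegrable _ _),
      ← intervalIntegral.integral_sub]
    · refine intervalIntegral.integral_congr fun r _ => ?_
      have := hne r
      have := hne' r
      field_simp
      ring
    · exact ((hint _ hudc).sub ((hint _ hcγ').const_mul _)).intervalIntegrable _ _
    · exact ((hint' _ hudc).sub ((hint' _ hcγ').const_mul _)).intervalIntegrable _ _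
  have hper : Function.Periodic (fun r => (u r - u s) * deriv γ r * (z - z') /
      ((γ r - z) * (γ r - z'))) 1 := fun r => by
    simp only [hup r, hγ.periodic_deriv r, hγ.periodic r]
  have h6 := hper.intervalIntegral_add_eq (s - 1 / 2) 0
  rw [zero_add] at h6
  rw [h1, ← h6]
  have hzz : ‖z - z'‖ ≤ 2 * l * M := by
    have : z - z' = 2 * l * d := by
      rw [hz, hz']
      push_cast
      ring
    rw [this, hd, norm_mul, norm_mul, norm_mul, Complex.norm_ofNat, Complex.norm_real,
      Complex.norm_I, one_mul, Real.norm_of_nonneg hl.le]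
    gcongr
    exact hM' s
  have hle : s - 1 / 2 ≤ s - 1 / 2 + 1 := by linarith
  have hpc : Continuous fun r : ℝ => l / ((r - s) ^ 2 + l ^ 2) :=
    continuous_const.div (by fun_prop) fun r => by positivity
  calc _ ≤ ∫ r in (s - 1 / 2)..(s - 1 / 2) + 1,
        (A * e₁ * (l / ((r - s) ^ 2 + l ^ 2)) + 2 * A * B * l / δ ^ 2) := by
        refine intervalIntegral.norm_integral_le_of_norm_le hle ?_
          (Continuous.intervalIntegrable (by fun_prop) _ _)
        refine Eventually.of_forall fun r hr => ?_
        have hrs : |r - s| ≤ 1 / 2 := abs_le.2 ⟨by linarith [hr.1], by linarith [hr.2]⟩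
        have k1 := hK s r l hrs (by rwa [abs_of_pos hl])
        have k2 := hK s r (-l) hrs (by rwa [abs_neg, abs_of_pos hl])
        rw [abs_of_pos hl] at k1
        rw [abs_neg, abs_of_pos hl] at k2
        have k3 : (c ^ 2) * ((r - s) ^ 2 + l ^ 2) ≤ ‖γ r - z‖ * ‖γ r - z'‖ := by
          refine le_trans ?_ (mul_le_mul k1 k2 (by positivity) (norm_nonneg _))
          have : (r - s) ^ 2 + l ^ 2 ≤ (|r - s| + l) ^ 2 := by
            have := abs_nonneg (r - s)
            nlinarith [sq_abs (r - s)]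
          nlinarith [sq_nonneg c]
        rw [norm_div, norm_mul, norm_mul, norm_mul]
        have k4 : ‖u r - u s‖ * ‖deriv γ r‖ * ‖z - z'‖ / (‖γ r - z‖ * ‖γ r - z'‖) ≤
            ‖u r - u s‖ * M * (2 * l * M) / (c ^ 2 * ((r - s) ^ 2 + l ^ 2)) := by
          gcongr
          exact hM' r
        have k5 : ‖u r - u s‖ * M * (2 * l * M) / (c ^ 2 * ((r - s) ^ 2 + l ^ 2)) =
            A * ‖u r - u s‖ * (l / ((r - s) ^ 2 + l ^ 2)) := by
          rw [hA]
          field_simp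
        rw [k5] at k4
        refine k4.trans ?_
        by_cases hrd : |r - s| < δ
        · have k6 : ‖u r - u s‖ ≤ e₁ := by
            rw [← dist_eq_norm]
            exact (hδ' (by rwa [Real.dist_eq])).le
          have k7 : 0 ≤ 2 * A * B * l / δ ^ 2 := by positivity
          have k8 : A * ‖u r - u s‖ * (l / ((r - s) ^ 2 + l ^ 2)) ≤
            A * e₁ * (l / ((r - s) ^ 2 + l ^ 2)) := by gcongr
          linarith
        · have k6 : ‖u r - u s‖ ≤ 2 * B := by
            refine (norm_sub_le _ _).trans ?_
            linarith [hB' r, hB' s]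
          have k7 : 0 ≤ A * e₁ * (l / ((r - s) ^ 2 + l ^ 2)) := by positivity
          have k9 : δ ^ 2 ≤ (r - s) ^ 2 + l ^ 2 := by
            have : δ ^ 2 ≤ |r - s| ^ 2 := by
              push Not at hrd
              gcongr
            rw [sq_abs] at this
            nlinarith
          have k8 : A * ‖u r - u s‖ * (l / ((r - s) ^ 2 + l ^ 2)) ≤
            A * (2 * B) * (l / δ ^ 2) := by gcongr
          have k10 : A * (2 * B) * (l / δ ^ 2) = 2 * A * B * l / δ ^ 2 := by ring
          linarith
    _ ≤ A * e₁ * Real.pi + 2 * A * B * l / δ ^ 2 := by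
        rw [intervalIntegral.integral_add (Continuous.intervalIntegrable (by fun_prop) _ _)
          intervalIntegrable_const, intervalIntegral.integral_const_mul,
          intervalIntegral.integral_const]
        have := integral_poisson_le hl s
        simp only [add_sub_cancel_left, one_smul]
        gcongr
    _ ≤ e / 2 + e / 2 := by
        refine add_le_add (le_of_eq ?_) ?_
        · rw [he₁]
          field_simp
        · rw [le_div_iff₀ (by positivity)] at hl2
          rw [div_le_iff₀ (by positivity)]
          linarith
    _ = e := by ring

/-- At a nearest point of the contour the derivative of the squared distance vanishes, so z - γ s is
orthogonal to the tangent. -/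
theorem IsSmoothContour.exists_eq_normal (z : ℂ) : ∃ s l : ℝ,
    z = γ s + l * (Complex.I * deriv γ s) ∧ ∀ r, ‖z - γ s‖ ≤ ‖z - γ r‖ := by
  obtain ⟨t, ⟨s, rfl⟩, ht⟩ := hγ.isCompact_trace.exists_infDist_eq_dist (range_nonempty γ) z
  have hmin : ∀ r, ‖z - γ s‖ ≤ ‖z - γ r‖ := fun r => by
    rw [← dist_eq_norm, ← dist_eq_norm, ← ht]
    exact Metric.infDist_le_dist_of_mem ⟨r, rfl⟩
  have hd : HasDerivAt (fun r => ‖γ r - z‖ ^ 2) (2 * inner ℝ (γ s - z) (deriv γ s)) s :=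
    ((hγ.hasDerivAt s).sub_const z).norm_sq
  have hloc : IsLocalMin (fun r => ‖γ r - z‖ ^ 2) s := Eventually.of_forall fun r => by
    have := hmin r
    rw [norm_sub_rev z, norm_sub_rev z] at this
    beta_reduce
    gcongr
  have h0 := hloc.hasDerivAt_eq_zero hd
  rw [Complex.inner] at h0
  have hne := hγ.deriv_ne_zero s
  have hne2 := Complex.normSq_pos.2 hne
  refine ⟨s, ((z - γ s) / deriv γ s).im, ?_, hmin⟩
  have hre : ((z - γ s) / deriv γ s).re = 0 := by
    rw [Complex.div_re]
    simp at h0 ⊢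
    field_simp
    linarith
  have h1 : (z - γ s) / deriv γ s = ((z - γ s) / deriv γ s).im * Complex.I := by
    conv_lhs => rw [← Complex.re_add_im ((z - γ s) / deriv γ s), hre]
    simp
  have h2 : z - γ s = ((z - γ s) / deriv γ s) * deriv γ s := by field_simp
  rw [h1] at h2
  linear_combination h2

/-- A continuous function on the contour, whose Cauchy integral vanishes in the exterior, consists
of the boundary values of a function which is holomorphic in the inner domain. -/
theorem IsSmoothContour.exists_diffContOnCl {u : ℝ → ℂ} (hu : Continuous u)
    (hup : Function.Periodic u 1)
    (hext : ∀ z ∉ closure (inside γ), cauchyTransform γ (fun s => u s * deriv γ s) 1 z = 0) :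
    ∃ h : ℂ → ℂ, DiffContOnCl ℂ h (inside γ) ∧ ∀ s, h (γ s) = u s := by
  classical
  obtain ⟨c, lam, hc, hlam, hK, hoff, hin, hex⟩ := hγ.exists_tube
  obtain ⟨m, hm, hm'⟩ := hγ.exists_le_norm_deriv
  have hcγ := hγ.continuous
  have hcγ' := hγ.continuous_deriv
  have hpi : (2 * Real.pi * Complex.I : ℂ) ≠ 0 := Complex.two_pi_I_ne_zero
  set T : ℂ → ℂ := fun z => (2 * Real.pi * Complex.I)⁻¹ *
    cauchyTransform γ (fun s => u s * deriv γ s) 1 z with hT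
  set h : ℂ → ℂ := fun z => if z ∈ inside γ then T z else u (Function.invFun γ z) with hh
  have hhin : ∀ z ∈ inside γ, h z = T z := fun z hz => if_pos hz
  have hhγ : ∀ s, h (γ s) = u s := fun s => by
    have h1 : γ s ∉ inside γ := fun hs => hs.1 ⟨s, rfl⟩
    rw [hh]
    beta_reduce
    rw [if_neg h1]
    obtain ⟨n, hn⟩ := hγ.eq_iff.1 (Function.invFun_eq (f := γ) ⟨s, rfl⟩).symm
    rw [hn]
    simpa using hup.int_mul n s
  have hTd : ∀ z ∈ inside γ, DifferentiableAt ℂ T z := fun z hz =>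
    ((hasDerivAt_cauchyTransform hcγ (hu.mul hcγ')
      (fun s _ he => hz.1 ⟨s, he⟩) 1).differentiableAt).const_mul _
  have hd : ∀ z ∈ inside γ, DifferentiableAt ℂ h z := fun z hz =>
    (hTd z hz).congr_of_eventuallyEq (eventually_of_mem (hγ.isOpen_inside.mem_nhds hz) hhin)
  refine ⟨h, ⟨fun z hz => (hd z hz).differentiableWithinAt, ?_⟩, hhγ⟩
  intro z hz
  rw [hγ.closure_inside] at hz
  rcases hz with hz | ⟨s₁, rfl⟩
  · exact (hd z hz).continuousAt.continuousWithinAt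
  rw [Metric.continuousWithinAt_iff]
  intro e he
  obtain ⟨δ, hδ, hδ'⟩ := Metric.uniformContinuous_iff.1
    (uniformContinuous_of_continuous_of_periodic hu hup) (e / 2) (by positivity)
  obtain ⟨l₀, hl₀, hl₀'⟩ := hγ.exists_forall_cauchyTransform_sub_le hu hup hext (e := e / 2)
    (by positivity)
  have hnear : ∀ s, ‖γ s - γ s₁‖ < c * δ → dist (u s) (u s₁) < e / 2 := by
    intro s hs
    obtain ⟨s', hs', he'⟩ := hγ.exists_mem_trace ⟨s, rfl⟩ s₁
    have h1 := hK s₁ s' 0 hs' (by simpa using hlam.le)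
    simp only [abs_zero, add_zero, Complex.ofReal_zero, zero_mul] at h1
    rw [he'] at h1
    have h2 : |s' - s₁| < δ := by
      by_contra! hcon
      nlinarith
    have h3 : u s = u s' := by rw [← hhγ, ← hhγ, he']
    rw [h3]
    exact hδ' (by rwa [Real.dist_eq])
  refine ⟨min (c * δ / 2) (m * min l₀ lam), by positivity, fun {z} hz hdist => ?_⟩
  rw [hγ.closure_inside] at hz
  have hd1 := hdist.trans_le (min_le_left _ _)
  have hd2 := hdist.trans_le (min_le_right _ _)
  rcases hz with hz | ⟨s, rfl⟩
  -- The uniform estimate along normals is applied at the foot γ s, not at γ s₁. As the foot is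
  -- nearest to z, it lies within twice the distance of z from γ s₁, and uniform continuity of u
  -- compares u s with u s₁.
  · obtain ⟨s, l, hzl, hmin⟩ := hγ.exists_eq_normal z
    have hms := hmin s₁
    rw [← dist_eq_norm z (γ s₁)] at hms
    have hnz : ‖z - γ s‖ = |l| * ‖deriv γ s‖ := by
      conv_lhs => rw [hzl]
      rw [add_sub_cancel_left, norm_mul, norm_mul, Complex.norm_real, Complex.norm_I, one_mul,
        Real.norm_eq_abs]
    have hlb : |l| < min l₀ lam := by
      have h1 : |l| * m ≤ |l| * ‖deriv γ s‖ := by gcongr; exact hm' s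
      by_contra! hcon
      nlinarith
    have hlpos : 0 < l := by
      by_contra! hcon
      rcases hcon.lt_or_eq with h1 | h1
      · refine hex s l h1 ?_ (hzl ▸ hz)
        have := hlb.trans_le (min_le_right _ _)
        rw [abs_of_neg h1] at this
        linarith
      · rw [h1] at hzl
        refine hz.1 ⟨s, ?_⟩
        rw [hzl]
        simp
    have h2 := hl₀' s l hlpos (by
      have := hlb.trans_le (min_le_left _ _)
      rw [abs_of_pos hlpos] at this
      exact this.le)
    rw [← hzl] at h2
    have h3 : ‖T z - u s‖ < e / 2 := by
      have h4 : T z - u s = (2 * Real.pi * Complex.I)⁻¹ *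
          (cauchyTransform γ (fun s => u s * deriv γ s) 1 z - 2 * Real.pi * Complex.I * u s) := by
        rw [hT]
        field_simp
      have h5 : ‖(2 * Real.pi * Complex.I : ℂ)⁻¹‖ < 1 := by
        rw [norm_inv]
        simp only [norm_mul, Complex.norm_ofNat, Complex.norm_real, Complex.norm_I, mul_one,
          Real.norm_of_nonneg Real.pi_pos.le]
        exact inv_lt_one_of_one_lt₀ (by linarith [Real.pi_gt_three])
      rw [h4, norm_mul]
      nlinarith [norm_nonneg (cauchyTransform γ (fun s => u s * deriv γ s) 1 z -
        2 * Real.pi * Complex.I * u s), norm_nonneg (2 * Real.pi * Complex.I : ℂ)⁻¹]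
    have h6 : ‖γ s - γ s₁‖ < c * δ := by
      have h7 := norm_sub_le_norm_sub_add_norm_sub (γ s) z (γ s₁)
      rw [norm_sub_rev (γ s) z, ← dist_eq_norm z (γ s₁)] at h7
      linarith
    have h8 := hnear s h6
    rw [hhin z hz, hhγ]
    have h9 := dist_triangle (T z) (u s) (u s₁)
    rw [dist_eq_norm (T z) (u s)] at h9
    linarith
  · rw [hhγ, hhγ]
    have h1 := hnear s (by
      rw [← dist_eq_norm]
      have : 0 < c * δ := by positivity
      linarith)
    linarith

end

/-! ### Derivatives along the contour, Taylor's formula, and the remainder integral. -/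

section

section derivatives

variable {γ : ℝ → ℂ} (hγ : IsSmoothContour 1 γ)
include hγ

theorem IsSmoothContour.uniqueDiffOn_trace : UniqueDiffOn ℂ (trace γ) := by
  rintro _ ⟨s, rfl⟩
  refine AccPt.uniqueDiffWithinAt ?_
  rw [accPt_iff_frequently]
  have h1 : Tendsto γ (𝓝[≠] s) (𝓝 (γ s)) :=
    (hγ.continuous.tendsto s).mono_left nhdsWithin_le_nhds
  refine h1.frequently (Eventually.frequently ?_)
  have h2 : ∀ᶠ r in 𝓝 s, |r - s| < 1 := by
    have : Continuous fun r : ℝ => |r - s| := by fun_prop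
    exact this.continuousAt.eventually_lt_const (by simp)
  filter_upwards [self_mem_nhdsWithin, mem_nhdsWithin_of_mem_nhds h2] with r hr hr2
  refine ⟨fun h => hr ?_, ⟨r, rfl⟩⟩
  obtain ⟨n, hn⟩ := hγ.eq_iff.1 h.symm
  rw [hn, add_sub_cancel_left] at hr2
  have h10 : |n| < 1 := by exact_mod_cast hr2
  rw [Int.abs_lt_one_iff] at h10
  simpa [h10] using hn

theorem IsSmoothContour.hasDerivAt_contourDeriv {x : ℂ → ℂ} {r k : ℕ}
    (hx : ContDiffOn ℂ r x (trace γ)) (hk : k < r) (s : ℝ) :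
    HasDerivAt (fun s => contourDeriv γ k x (γ s)) (contourDeriv γ (k + 1) x (γ s) * deriv γ s)
      s := by
  have h1 := (hx.differentiableOn_iteratedDerivWithin (m := k) (by exact_mod_cast hk)
    hγ.uniqueDiffOn_trace (γ s) ⟨s, rfl⟩).hasDerivWithinAt
  rw [← iteratedDerivWithin_succ] at h1
  have h2 := h1.scomp_hasDerivAt s (hγ.hasDerivAt s) fun r => ⟨r, rfl⟩
  rw [smul_eq_mul, mul_comm] at h2
  exact h2

theorem IsSmoothContour.continuous_contourDeriv {x : ℂ → ℂ} {r k : ℕ}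
    (hx : ContDiffOn ℂ r x (trace γ)) (hk : k ≤ r) :
    Continuous fun s => contourDeriv γ k x (γ s) :=
  (hx.continuousOn_iteratedDerivWithin (by exact_mod_cast hk)
    hγ.uniqueDiffOn_trace).comp_continuous hγ.continuous fun s => ⟨s, rfl⟩

end derivatives

/-- Taylor's formula along a curve, with a remainder of Hölder type. -/
theorem norm_sub_taylor_le {η η' : ℝ → ℂ} (hη : ∀ s, HasDerivAt η (η' s) s) {M : ℝ}
    (hM : ∀ s, ‖η' s‖ ≤ M) {y : ℕ → ℝ → ℂ} {r : ℕ}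
    (hy : ∀ k < r, ∀ s, HasDerivAt (y k) (y (k + 1) s * η' s) s) {s₀ C α ℓ : ℝ} (hC : 0 ≤ C)
    (hα : 0 ≤ α) (hr : ∀ s, |s - s₀| ≤ ℓ → ‖y r s - y r s₀‖ ≤ C * |s - s₀| ^ α) :
    ∀ j ≤ r, ∀ s, |s - s₀| ≤ ℓ →
      ‖y (r - j) s - ∑ k ∈ Finset.range (j + 1), y (r - j + k) s₀ / (k.factorial : ℂ)
        * (η s - η s₀) ^ k‖ ≤ C * M ^ j * |s - s₀| ^ j * |s - s₀| ^ α := by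
  have hM0 : 0 ≤ M := (norm_nonneg _).trans (hM 0)
  intro j
  induction j with
  | zero =>
    intro _ s hs
    simpa using hr s hs
  | succ j ih =>
    intro hj s hs
    obtain ⟨i, hi⟩ : ∃ i, r - j = i + 1 := ⟨r - j - 1, by omega⟩
    have hi' : r - (j + 1) = i := by omega
    have ih' := ih (by omega)
    rw [hi] at ih'
    rw [hi']
    -- The derivative of this remainder is the remainder for the next derivative, of one degree
    -- less, times η'. The mean value inequality then gains one factor M|s - s₀|.
    set R : ℝ → ℂ := fun u => y i u - ∑ k ∈ Finset.range (j + 1 + 1),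
      y (i + k) s₀ / (k.factorial : ℂ) * (η u - η s₀) ^ k with hR
    have hd : ∀ u, HasDerivAt R ((y (i + 1) u - ∑ k ∈ Finset.range (j + 1),
        y (i + 1 + k) s₀ / (k.factorial : ℂ) * (η u - η s₀) ^ k) * η' u) u := by
      intro u
      have h1 : HasDerivAt (fun u => ∑ k ∈ Finset.range (j + 1 + 1),
          y (i + k) s₀ / (k.factorial : ℂ) * (η u - η s₀) ^ k)
          (∑ k ∈ Finset.range (j + 1 + 1), y (i + k) s₀ / (k.factorial : ℂ) *
            (k * (η u - η s₀) ^ (k - 1) * η' u)) u :=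
        HasDerivAt.fun_sum fun k _ => (((hη u).sub_const _).fun_pow k).const_mul _
      convert! (hy i (by omega) u).sub h1 using 1
      rw [Finset.sum_range_succ' _ (j + 1), sub_mul, Finset.sum_mul]
      simp only [Nat.cast_zero, zero_mul, mul_zero, add_zero]
      congr 1
      refine Finset.sum_congr rfl fun k _ => ?_
      rw [Nat.add_sub_cancel, Nat.factorial_succ, show i + (k + 1) = i + 1 + k by ring]
      have h3 : ((k : ℂ) + 1) ≠ 0 := by exact_mod_cast Nat.succ_ne_zero k
      have h4 : (k.factorial : ℂ) ≠ 0 := by exact_mod_cast k.factorial_ne_zero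
      push_cast
      field_simp
    have hR0 : R s₀ = 0 := by
      simp [hR, Finset.sum_range_succ']
    have hb : ∀ u ∈ uIcc s₀ s, ‖(y (i + 1) u - ∑ k ∈ Finset.range (j + 1),
        y (i + 1 + k) s₀ / (k.factorial : ℂ) * (η u - η s₀) ^ k) * η' u‖ ≤
        C * M ^ j * |s - s₀| ^ j * |s - s₀| ^ α * M := by
      intro u hu
      have h5 : |u - s₀| ≤ |s - s₀| := abs_sub_left_of_mem_uIcc hu
      rw [norm_mul]
      refine mul_le_mul ((ih' u (h5.trans hs)).trans ?_) (hM u) (norm_nonneg _) (by positivity)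
      gcongr
    have h6 := (convex_uIcc s₀ s).norm_image_sub_le_of_norm_hasDerivWithin_le
      (fun u _ => (hd u).hasDerivWithinAt) hb left_mem_uIcc right_mem_uIcc
    rw [hR0, sub_zero, Real.norm_eq_abs] at h6
    refine h6.trans (le_of_eq ?_)
    ring

theorem intervalIntegrable_abs_sub_rpow {β : ℝ} (hβ : -1 < β) (s₀ a b : ℝ) :
    IntervalIntegrable (fun s => |s - s₀| ^ β) volume a b := by
  have h1 : ∀ c : ℝ, 0 ≤ c → IntervalIntegrable (fun s : ℝ => |s| ^ β) volume 0 c := by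
    intro c hc
    refine (intervalIntegral.intervalIntegrable_rpow' hβ (a := 0) (b := c)).congr fun s hs => ?_
    rw [uIoc_of_le hc] at hs
    rw [abs_of_pos hs.1]
  have h2 : ∀ c : ℝ, IntervalIntegrable (fun s : ℝ => |s| ^ β) volume 0 c := by
    intro c
    rcases le_total 0 c with hc | hc
    · exact h1 c hc
    · have := (IntervalIntegrable.iff_comp_neg (by finiteness)).1 (h1 (-c) (by linarith))
      simpa using this
  have h3 := ((h2 (a - s₀)).symm.trans (h2 (b - s₀))).comp_sub_right s₀
  simpa using h3

section boundary

variable {γ : ℝ → ℂ} (hγ : IsSmoothContour 1 γ)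
include hγ

/-- The truncated integrals tend to zero if the density vanishes at the singular point to a
sufficiently high order. -/
theorem IsSmoothContour.tendsto_truncatedIntegral_zero {h : ℂ → ℂ}
    (hh : DiffContOnCl ℂ h (inside γ)) {s₀ C α : ℝ} {r : ℕ} (hα : 0 < α)
    (hbd : ∀ s, |s - s₀| ≤ 1 / 2 → ‖h (γ s)‖ ≤ C * |s - s₀| ^ r * |s - s₀| ^ α) :
    Tendsto (truncatedIntegral γ (r + 1) h (γ s₀)) (𝓝[>] 0) (𝓝 0) := by
  obtain ⟨c, lam, hc, hlam, hK, hoff, -, hex⟩ := hγ.exists_tube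
  obtain ⟨M, hM, hM'⟩ := hγ.exists_norm_deriv_le
  have hcγ := hγ.continuous
  have hcγ' := hγ.continuous_deriv
  have hch : Continuous fun s => h (γ s) := hh.continuousOn.comp_continuous hcγ
    fun s => hγ.trace_subset_closure ⟨s, rfl⟩
  have hC : 0 ≤ C := by
    have h0 := (norm_nonneg _).trans (hbd (s₀ + 1 / 2) (by simp))
    rw [mul_assoc] at h0
    refine nonneg_of_mul_nonneg_left h0 ?_
    simp only [add_sub_cancel_left]
    positivity
  set a := s₀ - 1 / 2 with ha
  have hab : a ≤ a + 1 := by linarith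
  have hmemI : ∀ s ∈ Ι a (a + 1), |s - s₀| ≤ 1 / 2 := by
    intro s hs
    rw [uIoc_of_le hab] at hs
    exact abs_le.2 ⟨by linarith [hs.1], by linarith [hs.2]⟩
  -- Vanishing of order r + α against a pole of order r + 1 leaves the exponent α - 1 > -1. This
  -- majorant dominates both the integrals with displaced pole and the truncated ones.
  set g : ℝ → ℝ := fun s => C * M / c ^ (r + 1) * |s - s₀| ^ (α - 1) with hg
  have hgint : IntervalIntegrable g volume a (a + 1) :=
    (intervalIntegrable_abs_sub_rpow (by linarith) s₀ _ _).const_mul _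
  have hbound : ∀ s, |s - s₀| ≤ 1 / 2 → s ≠ s₀ → ∀ w : ℂ, c * |s - s₀| ≤ ‖γ s - w‖ →
      ‖h (γ s) / (γ s - w) ^ (r + 1) * deriv γ s‖ ≤ g s := by
    intro s hs hne w hw
    have hpos : 0 < |s - s₀| := abs_pos.2 (sub_ne_zero.2 hne)
    rw [norm_mul, norm_div, norm_pow]
    calc _ ≤ C * |s - s₀| ^ r * |s - s₀| ^ α / (c * |s - s₀|) ^ (r + 1) * M := by
          gcongr
          · exact hbd s hs
          · exact hM' s
      _ = g s := by
          rw [hg]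
          beta_reduce
          rw [Real.rpow_sub_one hpos.ne', mul_pow, pow_succ |s - s₀| r]
          field_simp
  have hlow : ∀ s, |s - s₀| ≤ 1 / 2 → c * |s - s₀| ≤ ‖γ s - γ s₀‖ := by
    intro s hs
    have h1 := hK s₀ s 0 hs (by simpa using hlam.le)
    simpa using h1
  have hae : ∀ᵐ s : ℝ, s ≠ s₀ := by simp [ae_iff]
  set Φ : ℝ → ℂ := fun s => h (γ s) / (γ s - γ s₀) ^ (r + 1) * deriv γ s with hΦ
  have hΦm : Measurable Φ := (hch.measurable.div ((hcγ.measurable.sub_const _).pow_const _)).mul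
    hcγ'.measurable
  -- the singular integral vanishes, as a limit of integrals with an exterior pole
  have hzero : ∫ s in a..a + 1, Φ s = 0 := by
    set z : ℝ → ℂ := fun l => γ s₀ + (-l : ℝ) * (Complex.I * deriv γ s₀) with hz
    have hsmall : ∀ᶠ l : ℝ in 𝓝[>] 0, 0 < l ∧ l ≤ lam := by
      filter_upwards [self_mem_nhdsWithin, mem_nhdsWithin_of_mem_nhds (Iic_mem_nhds hlam)]
        with l h1 h2 using ⟨h1, h2⟩
    have hlim : Tendsto (fun l : ℝ => ∫ s in a..a + 1, h (γ s) / (γ s - z l) ^ (r + 1) * deriv γ s)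
        (𝓝[>] 0) (𝓝 (∫ s in a..a + 1, Φ s)) := by
      refine intervalIntegral.tendsto_integral_filter_of_dominated_convergence g ?_ ?_ hgint ?_
      · refine Eventually.of_forall fun l => Measurable.aestronglyMeasurable ?_
        exact (hch.measurable.div ((hcγ.measurable.sub_const _).pow_const _)).mul hcγ'.measurable
      · filter_upwards [hsmall] with l ⟨hl, hl'⟩
        filter_upwards [hae] with s hs hsI
        refine hbound s (hmemI s hsI) hs _ ?_
        have h1 := hK s₀ s (-l) (hmemI s hsI) (by rwa [abs_neg, abs_of_pos hl])
        refine le_trans ?_ h1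
        gcongr
        linarith [abs_nonneg (-l)]
      · filter_upwards [hae] with s hs hsI
        have h1 : Tendsto z (𝓝[>] 0) (𝓝 (γ s₀)) := by
          have : Continuous z := by fun_prop
          simpa [hz] using (this.tendsto 0).mono_left nhdsWithin_le_nhds
        have hne : γ s - γ s₀ ≠ 0 := by
          rw [← norm_pos_iff]
          exact lt_of_lt_of_le (mul_pos hc (abs_pos.2 (sub_ne_zero.2 hs))) (hlow s (hmemI s hsI))
        exact ((tendsto_const_nhds.div ((h1.const_sub _).pow _) (pow_ne_zero _ hne))).mul_const _
    refine tendsto_nhds_unique hlim (tendsto_const_nhds.congr' ?_)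
    filter_upwards [hsmall] with l ⟨hl, hl'⟩
    have h2 := hγ.cauchyTransform_exterior hh (z := z l) (hγ.exterior_of_normal
      (hoff s₀ (-l) (by simpa using hl.ne') (by rwa [abs_neg, abs_of_pos hl]))
      (hex s₀ (-l) (by linarith) (by linarith))) (r + 1)
    have hper : Function.Periodic (fun s => h (γ s) / (γ s - z l) ^ (r + 1) * deriv γ s) 1 :=
      fun s => by simp only [hγ.periodic s, hγ.periodic_deriv s]
    rw [hper.intervalIntegral_add_eq a 0, zero_add, ← h2, cauchyTransform]
    refine intervalIntegral.integral_congr fun s _ => ?_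
    ring
  have hmain : Tendsto (fun v : ℝ => ∫ s in a..a + 1,
      {s : ℝ | v ≤ ‖γ s - γ s₀‖}.indicator Φ s) (𝓝[>] 0) (𝓝 (∫ s in a..a + 1, Φ s)) := by
    refine intervalIntegral.tendsto_integral_filter_of_dominated_convergence g ?_ ?_ hgint ?_
    · refine Eventually.of_forall fun v => Measurable.aestronglyMeasurable ?_
      exact hΦm.indicator (measurableSet_le measurable_const (hcγ.measurable.sub_const _).norm)
    · refine Eventually.of_forall fun v => ?_
      filter_upwards [hae] with s hs hsI
      exact (norm_indicator_le_norm_self _ _).trans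
        (hbound s (hmemI s hsI) hs _ (hlow s (hmemI s hsI)))
    · filter_upwards [hae] with s hs hsI
      have hpos : 0 < ‖γ s - γ s₀‖ :=
        lt_of_lt_of_le (mul_pos hc (abs_pos.2 (sub_ne_zero.2 hs))) (hlow s (hmemI s hsI))
      refine tendsto_const_nhds.congr' ?_
      filter_upwards [mem_nhdsWithin_of_mem_nhds (Iic_mem_nhds hpos)] with v hv
      rw [indicator_of_mem (by exact hv)]
  rw [hzero] at hmain
  refine hmain.congr fun v => ?_
  rw [truncatedIntegral_eq hγ _ _ _ _ a]

end boundary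

end

/-! ### The ends of the arc removed by truncation. -/

section

/-- Hadamard's lemma. Each differentiation in s brings out a factor r, so the induction on
smoothness must run over all weights r^j. -/
theorem contDiff_integral_pow_mul {n : ℕ} {F : ℝ → ℂ} (hF : ContDiff ℝ n F) (s₀ : ℝ) (j : ℕ) :
    ContDiff ℝ n (fun s => ∫ r in (0 : ℝ)..1, (r : ℂ) ^ j * F (s₀ + s * r)) := by
  induction n generalizing F j with
  | zero =>
    have hFc := hF.continuous
    refine contDiff_zero.2 ?_
    exact intervalIntegral.continuous_parametric_intervalIntegral_of_continuous' (by fun_prop) 0 1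
  | succ n ih =>
    have hF' : ContDiff ℝ n (deriv F) := (contDiff_succ_iff_deriv.1 hF).2.2
    have hFd : Differentiable ℝ F := hF.differentiable (by simp)
    have hFc := hF.continuous
    have hFc' := hF'.continuous
    have hd : ∀ s, HasDerivAt (fun s => ∫ r in (0 : ℝ)..1, (r : ℂ) ^ j * F (s₀ + s * r))
        (∫ r in (0 : ℝ)..1, (r : ℂ) ^ (j + 1) * deriv F (s₀ + s * r)) s := by
      intro s
      obtain ⟨B, hB⟩ := ((isCompact_closedBall s 1).prod (isCompact_Icc (a := (0 : ℝ)) (b := 1))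
        ).exists_bound_of_continuousOn (f := fun q : ℝ × ℝ =>
          (q.2 : ℂ) ^ (j + 1) * deriv F (s₀ + q.1 * q.2))
          (Continuous.continuousOn (by fun_prop))
      have key := intervalIntegral.hasDerivAt_integral_of_dominated_loc_of_deriv_le
        (μ := volume) (a := 0) (b := 1) (F := fun s (r : ℝ) => (r : ℂ) ^ j * F (s₀ + s * r))
        (F' := fun s (r : ℝ) => (r : ℂ) ^ (j + 1) * deriv F (s₀ + s * r)) (x₀ := s)
        (s := Metric.ball s 1) (bound := fun _ => B) (Metric.ball_mem_nhds _ one_pos)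
        (Eventually.of_forall fun u => Continuous.aestronglyMeasurable (by fun_prop))
        (Continuous.intervalIntegrable (by fun_prop) _ _)
        (Continuous.aestronglyMeasurable (by fun_prop)) ?_ intervalIntegrable_const ?_
      · exact key.2
      · refine Eventually.of_forall fun r hr u hu => ?_
        rw [uIoc_of_le zero_le_one] at hr
        exact hB (u, r) ⟨Metric.ball_subset_closedBall hu, Ioc_subset_Icc_self hr⟩
      · refine Eventually.of_forall fun r hr u hu => ?_
        have h1 : HasDerivAt (fun u : ℝ => s₀ + u * r) r u := by
          simpa using ((hasDerivAt_id u).mul_const r).const_add s₀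
        have h2 := ((hFd (s₀ + u * r)).hasDerivAt.scomp u h1).const_mul ((r : ℂ) ^ j)
        convert! h2 using 1
        rw [Complex.real_smul]
        ring
    refine (contDiff_succ_iff_deriv (n := (n : WithTop ℕ∞))).2
      ⟨fun s => (hd s).differentiableAt, by simp, ?_⟩
    have : deriv (fun s => ∫ r in (0 : ℝ)..1, (r : ℂ) ^ j * F (s₀ + s * r)) =
        fun s => ∫ r in (0 : ℝ)..1, (r : ℂ) ^ (j + 1) * deriv F (s₀ + s * r) :=
      funext fun s => (hd s).deriv
    rw [this]
    exact ih hF' (j + 1)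

/-- The quotient `(γ (s₀ + s) - γ s₀) / s` is of class `C^r` if `γ` is of class `C^(r+1)`. -/
theorem exists_contDiff_quotient {γ : ℝ → ℂ} {r : ℕ} (hγ : ContDiff ℝ (r + 1 : ℕ) γ) (s₀ : ℝ) :
    ∃ g : ℝ → ℂ, ContDiff ℝ r g ∧ g 0 = deriv γ s₀ ∧ ∀ s, γ (s₀ + s) - γ s₀ = s * g s := by
  have hγ' : ContDiff ℝ r (deriv γ) := (contDiff_succ_iff_deriv.1 hγ).2.2
  have hd : Differentiable ℝ γ := hγ.differentiable (by simp)
  refine ⟨fun s => ∫ u in (0 : ℝ)..1, (u : ℂ) ^ 0 * deriv γ (s₀ + s * u),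
    contDiff_integral_pow_mul hγ' s₀ 0, by simp, fun s => ?_⟩
  have h1 := intervalIntegral.smul_integral_comp_add_mul (deriv γ) (a := 0) (b := 1) s s₀
  rw [intervalIntegral.integral_deriv_eq_sub (fun x _ => hd x)
    (hγ'.continuous.intervalIntegrable _ _)] at h1
  simp only [pow_zero, one_mul]
  rw [← Complex.real_smul, h1]
  simp

/-- The ends of the part of the contour in a small disc about `γ s₀`. -/
theorem IsSmoothContour.exists_endpoints {γ : ℝ → ℂ} {r : ℕ} (hr : 1 ≤ r)
    (hγ : IsSmoothContour (r + 1) γ) (s₀ : ℝ) :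
    ∃ (σ : ℝ → ℝ) (w : ℝ → ℂ), ContDiffAt ℝ r w 0 ∧ ∀ᶠ v in 𝓝[>] (0 : ℝ),
      -(1 / 2) ≤ σ (-v) ∧ σ (-v) < σ v ∧ σ v ≤ 1 / 2 ∧
      (∀ s, |s| ≤ 1 / 2 → (v ≤ ‖γ (s₀ + s) - γ s₀‖ ↔ s ≤ σ (-v) ∨ σ v ≤ s)) ∧
      (γ (s₀ + σ v) - γ s₀)⁻¹ = w v / v ∧ (γ (s₀ + σ (-v)) - γ s₀)⁻¹ = w (-v) / (-v) := by
  obtain ⟨c, lam, hc, hlam, hK, -⟩ := (hγ.toOne (by omega)).exists_tube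
  obtain ⟨g, hg, hg0, hq⟩ := exists_contDiff_quotient hγ.contDiff s₀
  have hg0' : g 0 ≠ 0 := hg0 ▸ hγ.deriv_ne_zero s₀
  have hr0 : (r : WithTop ℕ∞) ≠ 0 := by
    have : r ≠ 0 := by omega
    exact_mod_cast this
  -- The signed distance to γ s₀. Its local inverse gives the ends of the arc of radius v as the
  -- parameters at v and at -v.
  set ρ : ℝ → ℝ := fun s => s * ‖g s‖ with hρ
  have hρc : ContDiffAt ℝ r ρ 0 := contDiffAt_id.mul (hg.contDiffAt.norm ℝ hg0')
  have ha : 0 < ‖g 0‖ := norm_pos_iff.2 hg0'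
  have hρd : HasDerivAt ρ ‖g 0‖ 0 := by
    have h1 := (hasDerivAt_id (0 : ℝ)).mul
      ((hg.contDiffAt.norm ℝ hg0').differentiableAt hr0).hasDerivAt
    convert! h1 using 1
    simp
  have hρs : HasStrictDerivAt ρ ‖g 0‖ 0 := hρc.hasStrictDerivAt' hρd hr0
  obtain ⟨δ, hδ, hmono⟩ : ∃ δ > 0, StrictMonoOn ρ (Ioo (-δ) δ) := by
    have h1 := hρs.isLittleO.def (c := ‖g 0‖ / 2) (by positivity)
    rw [Metric.eventually_nhds_iff] at h1
    obtain ⟨δ, hδ, h1⟩ := h1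
    refine ⟨δ, hδ, fun x hx y hy hxy => ?_⟩
    have h2 := h1 (y := (y, x)) (by
      rw [Prod.dist_eq, max_lt_iff]
      simp only [Real.dist_eq, sub_zero]
      exact ⟨abs_lt.2 hy, abs_lt.2 hx⟩)
    simp only [ContinuousLinearMap.toSpanSingleton_apply, smul_eq_mul, Real.norm_eq_abs] at h2
    rw [abs_of_pos (sub_pos.2 hxy)] at h2
    have h3 := (abs_le.1 h2).1
    have h4 : 0 < (y - x) * ‖g 0‖ := mul_pos (sub_pos.2 hxy) ha
    linarith
  have hfd := hρd.hasFDerivAt_equiv ha.ne'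
  set σ : ℝ → ℝ := hρc.localInverse hfd hr0 with hσ
  have hρ0 : ρ 0 = 0 := by simp [hρ]
  have hσc : ContDiffAt ℝ r σ 0 := by
    have := hρc.to_localInverse hfd hr0
    rwa [hρ0] at this
  have hσ0 : σ 0 = 0 := by
    have := hρc.localInverse_apply_image hfd hr0
    rwa [hρ0] at this
  have hright : ∀ᶠ v in 𝓝 (0 : ℝ), ρ (σ v) = v := by
    have h1 := hρc.image_mem_toOpenPartialHomeomorph_target hfd hr0
    rw [hρ0] at h1
    filter_upwards [(hρc.toOpenPartialHomeomorph ρ hfd hr0).open_target.mem_nhds h1] with v hv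
    exact (hρc.toOpenPartialHomeomorph ρ hfd hr0).right_inv hv
  have hgσ : ContDiffAt ℝ r (fun v => g (σ v)) 0 := hg.contDiffAt.comp 0 hσc
  have hgσ0 : g (σ 0) ≠ 0 := by rwa [hσ0]
  -- Since v = σ(v)‖g(σ v)‖ and the chord is σ(v)g(σ v), the reciprocal chord is this quotient
  -- divided by v. A single function thus serves both ends, which makes the later parity argument
  -- possible.
  refine ⟨σ, fun v => (‖g (σ v)‖ : ℂ) / g (σ v), ?_, ?_⟩
  · simp only [div_eq_mul_inv]
    have h1 : ContDiffAt ℝ r (fun v => (‖g (σ v)‖ : ℂ)) 0 :=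
      Complex.ofRealCLM.contDiff.contDiffAt.comp 0 (hgσ.norm ℝ hgσ0)
    exact h1.mul (hgσ.inv hgσ0)
  have hnear : ∀ᶠ v in 𝓝 (0 : ℝ), σ v ∈ Ioo (-(min δ (1 / 2))) (min δ (1 / 2)) := by
    refine hσc.continuousAt.eventually_mem (Ioo_mem_nhds ?_ ?_) <;> rw [hσ0]
    · have : 0 < min δ (1 / 2) := by positivity
      linarith
    · positivity
  have hneg : Tendsto (fun v : ℝ => -v) (𝓝 0) (𝓝 0) := by
    simpa using (continuous_neg (G := ℝ)).tendsto 0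
  have hall := (hright.and hnear).and (hneg.eventually (hright.and hnear))
  have hinv : ∀ v : ℝ, v ≠ 0 → ρ (σ v) = v →
      (γ (s₀ + σ v) - γ s₀)⁻¹ = (‖g (σ v)‖ : ℂ) / g (σ v) / v := by
    intro v hv h1
    have h2 : (v : ℂ) = σ v * ‖g (σ v)‖ := by
      conv_lhs => rw [← h1]
      simp [hρ]
    have h3 : (‖g (σ v)‖ : ℂ) ≠ 0 := by
      intro h4
      rw [h4, mul_zero] at h2
      exact hv (by exact_mod_cast h2)
    rw [hq]
    conv_rhs => rw [h2]
    field_simp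
  filter_upwards [mem_nhdsWithin_of_mem_nhds hall, self_mem_nhdsWithin,
    mem_nhdsWithin_of_mem_nhds (Iio_mem_nhds (show 0 < c * δ by positivity))]
    with v ⟨⟨h1, h2⟩, ⟨h3, h4⟩⟩ (h5 : 0 < v) (h6 : v < c * δ)
  have hm1 := min_le_left δ (1 / 2)
  have hm2 := min_le_right δ (1 / 2)
  have h2' : σ v ∈ Ioo (-δ) δ := ⟨by linarith [h2.1], by linarith [h2.2]⟩
  have h4' : σ (-v) ∈ Ioo (-δ) δ := ⟨by linarith [h4.1], by linarith [h4.2]⟩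
  refine ⟨by linarith [h4.1], ?_, by linarith [h2.2], fun s hs => ?_, hinv v h5.ne' h1, ?_⟩
  · rw [← hmono.lt_iff_lt h4' h2', h1, h3]
    linarith
  · by_cases hsδ : |s| < δ
    · have hs' : s ∈ Ioo (-δ) δ := abs_lt.1 hsδ
      have h7 : ‖γ (s₀ + s) - γ s₀‖ = |ρ s| := by
        rw [hq, hρ, norm_mul, Complex.norm_real, Real.norm_eq_abs, abs_mul, abs_norm]
      rw [h7, ← hmono.le_iff_le hs' h4', ← hmono.le_iff_le h2' hs', h1, h3, le_abs, or_comm,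
        le_neg]
    · push Not at hsδ
      have h7 : v ≤ ‖γ (s₀ + s) - γ s₀‖ := by
        have h8 := hK s₀ (s₀ + s) 0 (by simpa using hs) (by simpa using hlam.le)
        simp only [add_sub_cancel_left, abs_zero, add_zero, Complex.ofReal_zero, zero_mul] at h8
        nlinarith
      refine iff_of_true h7 ?_
      rcases le_abs.1 hsδ with h8 | h8
      · exact Or.inr (by linarith [h2'.2])
      · exact Or.inl (by linarith [h4'.1])
  · have := hinv (-v) (by linarith) h3
    simpa using this

end

/-! ### The finite part of a pure power of the kernel. -/

section

/-- The integrand has the primitive -(γ - γ s₀)^(-m)/m on both remaining arcs, and the contributions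
at s₀ ± 1/2 cancel by periodicity. -/
theorem truncatedIntegral_of_endpoints {γ : ℝ → ℂ} (hγ : IsSmoothContour 1 γ) {m : ℕ}
    (hm : 1 ≤ m) {s₀ v e₁ e₂ : ℝ} (hv : 0 < v) (h1 : -(1 / 2) ≤ e₁) (h12 : e₁ < e₂)
    (h2 : e₂ ≤ 1 / 2)
    (hset : ∀ s, |s| ≤ 1 / 2 → (v ≤ ‖γ (s₀ + s) - γ s₀‖ ↔ s ≤ e₁ ∨ e₂ ≤ s)) :
    truncatedIntegral γ (m + 1) (fun _ => 1) (γ s₀) v =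
      ((γ (s₀ + e₂) - γ s₀)⁻¹ ^ m - (γ (s₀ + e₁) - γ s₀)⁻¹ ^ m) / m := by
  have hcγ := hγ.continuous
  have hcγ' := hγ.continuous_deriv
  have hm0 : (m : ℂ) ≠ 0 := by
    have : m ≠ 0 := by omega
    exact_mod_cast this
  set Φ : ℝ → ℂ := fun s => 1 / (γ s - γ s₀) ^ (m + 1) * deriv γ s with hΦ
  have hset' : ∀ s, |s - s₀| ≤ 1 / 2 →
      (v ≤ ‖γ s - γ s₀‖ ↔ s ≤ s₀ + e₁ ∨ s₀ + e₂ ≤ s) := fun s hs => by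
    have := hset (s - s₀) hs
    rw [add_sub_cancel] at this
    rw [this, sub_le_iff_le_add', le_sub_iff_add_le']
  have hne : ∀ s, |s - s₀| ≤ 1 / 2 → (s ≤ s₀ + e₁ ∨ s₀ + e₂ ≤ s) → γ s - γ s₀ ≠ 0 := by
    intro s hs h
    rw [← norm_pos_iff]
    exact hv.trans_le ((hset' s hs).2 h)
  have hftc : ∀ a b, a ≤ b → (∀ s ∈ Icc a b, γ s - γ s₀ ≠ 0) →
      IntervalIntegrable Φ volume a b ∧ ∫ s in a..b, Φ s =
        ((γ a - γ s₀)⁻¹ ^ m - (γ b - γ s₀)⁻¹ ^ m) / m := by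
    intro a b hab hne
    rw [← uIcc_of_le hab] at hne
    have hc : ContinuousOn Φ (uIcc a b) :=
      ContinuousOn.mul (continuousOn_const.div (by fun_prop) fun s hs => pow_ne_zero _ (hne s hs))
        (by fun_prop)
    refine ⟨hc.intervalIntegrable, ?_⟩
    have hd : ∀ s ∈ uIcc a b, HasDerivAt (fun s => -((γ s - γ s₀)⁻¹ ^ m) / m) (Φ s) s := by
      intro s hs
      have h0 := hne s hs
      convert! ((((hγ.hasDerivAt s).sub_const (γ s₀)).fun_inv h0).fun_pow m).fun_neg.div_const
        (m : ℂ) using 1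
      obtain ⟨j, rfl⟩ : ∃ j, m = j + 1 := ⟨m - 1, by omega⟩
      rw [hΦ]
      beta_reduce
      rw [Nat.add_sub_cancel]
      simp only [inv_pow]
      field_simp
      ring
    rw [intervalIntegral.integral_eq_sub_of_hasDerivAt hd hc.intervalIntegrable]
    ring
  have hI1 := hftc (s₀ - 1 / 2) (s₀ + e₁) (by linarith) fun s hs =>
    hne s (abs_le.2 ⟨by linarith [hs.1], by linarith [hs.2]⟩) (Or.inl hs.2)
  have hI2 := hftc (s₀ + e₂) (s₀ + 1 / 2) (by linarith) fun s hs =>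
    hne s (abs_le.2 ⟨by linarith [hs.1], by linarith [hs.2]⟩) (Or.inr hs.1)
  set T : ℝ → ℂ := {s : ℝ | v ≤ ‖γ s - γ s₀‖}.indicator Φ with hT
  have hT1 : ∀ s ∈ Ι (s₀ - 1 / 2) (s₀ + e₁), T s = Φ s := fun s hs => by
    rw [uIoc_of_le (by linarith)] at hs
    have hmem : v ≤ ‖γ s - γ s₀‖ :=
      (hset' s (abs_le.2 ⟨by linarith [hs.1], by linarith [hs.2]⟩)).2 (Or.inl hs.2)
    exact indicator_of_mem (s := {s : ℝ | v ≤ ‖γ s - γ s₀‖}) hmem Φ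
  have hT2 : ∀ s ∈ Ι (s₀ + e₂) (s₀ + 1 / 2), T s = Φ s := fun s hs => by
    rw [uIoc_of_le (by linarith)] at hs
    have hmem : v ≤ ‖γ s - γ s₀‖ :=
      (hset' s (abs_le.2 ⟨by linarith [hs.1], by linarith [hs.2]⟩)).2 (Or.inr hs.1.le)
    exact indicator_of_mem (s := {s : ℝ | v ≤ ‖γ s - γ s₀‖}) hmem Φ
  have hT3 : ∀ᵐ s : ℝ, s ∈ Ι (s₀ + e₁) (s₀ + e₂) → T s = 0 := by
    have hae : ∀ᵐ s : ℝ, s ≠ s₀ + e₂ := by simp [ae_iff]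
    filter_upwards [hae] with s hse hs
    rw [uIoc_of_le (by linarith)] at hs
    refine indicator_of_notMem (s := {s : ℝ | v ≤ ‖γ s - γ s₀‖}) (fun hmem => ?_) Φ
    rcases (hset' s (abs_le.2 ⟨by linarith [hs.1], by linarith [hs.2]⟩)).1 hmem with h | h
    · linarith [hs.1]
    · exact hse (le_antisymm hs.2 h)
  have hT3i : IntervalIntegrable T volume (s₀ + e₁) (s₀ + e₂) :=
    (intervalIntegrable_const (c := (0 : ℂ))).congr_ae
      ((ae_restrict_iff' measurableSet_uIoc).2 (hT3.mono fun s h hs => (h hs).symm))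
  have hT1i : IntervalIntegrable T volume (s₀ - 1 / 2) (s₀ + e₁) :=
    hI1.1.congr fun s hs => (hT1 s hs).symm
  have hT2i : IntervalIntegrable T volume (s₀ + e₂) (s₀ + 1 / 2) :=
    hI2.1.congr fun s hs => (hT2 s hs).symm
  rw [truncatedIntegral_eq hγ _ _ _ _ (s₀ - 1 / 2), show s₀ - 1 / 2 + 1 = s₀ + 1 / 2 by ring,
    ← intervalIntegral.integral_add_adjacent_intervals hT1i (hT3i.trans hT2i),
    ← intervalIntegral.integral_add_adjacent_intervals hT3i hT2i,
    intervalIntegral.integral_congr_ae (Eventually.of_forall hT1),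
    intervalIntegral.integral_congr_ae (Eventually.of_forall hT2),
    intervalIntegral.integral_congr_ae hT3, hI1.2, hI2.2, intervalIntegral.integral_zero]
  have hper : γ (s₀ + 1 / 2) = γ (s₀ - 1 / 2) := by
    rw [← hγ.periodic (s₀ - 1 / 2)]
    congr 1
    ring
  rw [hper]
  ring

/-- The finite part of the integral of `(τ - t)^(-m-1)` is zero for `1 ≤ m`. -/
theorem IsSmoothContour.exists_tendsto_truncatedIntegral {γ : ℝ → ℂ} {r m : ℕ} (hm : 1 ≤ m)
    (hmr : m ≤ r) (hγ : IsSmoothContour (r + 1) γ) {t : ℂ} (ht : t ∈ trace γ) :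
    ∃ ξ : Polynomial ℂ, ξ.degree < (m : WithBot ℕ) ∧
      Tendsto (fun v : ℝ => truncatedIntegral γ (m + 1) (fun _ => 1) t v
        + ξ.eval (v : ℂ) / (v : ℂ) ^ m) (𝓝[>] 0) (𝓝 0) := by
  obtain ⟨s₀, rfl⟩ := ht
  obtain ⟨σ, w, hw, hev⟩ := hγ.exists_endpoints (by omega) s₀
  have hm0 : (m : ℂ) ≠ 0 := by
    have : m ≠ 0 := by omega
    exact_mod_cast this
  -- The truncated integral equals (V(v) - (-1)^m V(-v)) / (m v^m), so a Taylor expansion of V to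
  -- order m, available because m ≤ r, determines the divergent terms.
  set V : ℝ → ℂ := fun v => w v ^ m with hV
  have hVc : ContDiffAt ℝ m V 0 := (hw.of_le (by exact_mod_cast hmr)).pow m
  obtain ⟨c, hc⟩ : ∃ c : ℕ → ℂ, (fun v : ℝ => V v - ∑ k ∈ Finset.range (m + 1), c k * (v : ℂ) ^ k)
      =o[𝓝 0] fun v : ℝ => v ^ m := by
    obtain ⟨u, hu, hVu⟩ := hVc.contDiffOn le_rfl (by simp)
    obtain ⟨ε, hε, hball⟩ := Metric.mem_nhds_iff.1
      (show u ∈ 𝓝 (0 : ℝ) by simpa using hu)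
    have h1 := taylor_isLittleO (convex_ball (0 : ℝ) ε) (Metric.mem_ball_self hε)
      (hVu.mono hball)
    rw [nhdsWithin_eq_nhds.2 (Metric.ball_mem_nhds _ hε)] at h1
    refine ⟨fun k => ((k.factorial : ℝ)⁻¹ : ℝ) * iteratedDerivWithin k V (Metric.ball 0 ε) 0, ?_⟩
    simp only [taylor_within_apply, sub_zero] at h1
    refine h1.congr_left fun v => ?_
    congr 1
    refine Finset.sum_congr rfl fun k _ => ?_
    rw [Complex.real_smul]
    push_cast
    ring
  -- These coefficients cancel the terms of order k < m. The term k = m, which would be the finite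
  -- part, carries the factor 1 - (-1)^(2m) = 0.
  set ξ : Polynomial ℂ := ∑ k ∈ Finset.range m,
    Polynomial.C (-(c k * (1 - (-1) ^ (k + m))) / m) * Polynomial.X ^ k with hξ
  refine ⟨ξ, ?_, ?_⟩
  · refine (Polynomial.degree_sum_le _ _).trans_lt ?_
    rw [Finset.sup_lt_iff (by exact WithBot.bot_lt_coe m)]
    intro k hk
    refine (Polynomial.degree_C_mul_X_pow_le _ _).trans_lt ?_
    exact_mod_cast Finset.mem_range.1 hk
  have hc' : (fun v : ℝ => V (-v) - ∑ k ∈ Finset.range (m + 1), c k * ((-v : ℝ) : ℂ) ^ k)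
      =o[𝓝 0] fun v : ℝ => v ^ m := by
    have hneg : Tendsto (fun v : ℝ => -v) (𝓝 0) (𝓝 0) := by
      simpa using (continuous_neg (G := ℝ)).tendsto 0
    refine (hc.comp_tendsto hneg).trans_isBigO (Asymptotics.isBigO_of_le _ fun v => ?_)
    simp
  have hdiff := (hc.sub (hc'.const_mul_left ((-1) ^ m))).mono
    (nhdsWithin_le_nhds (s := Ioi (0 : ℝ)))
  have hdiff' := hdiff.trans_isBigO (k := fun v : ℝ => (v : ℂ) ^ m)
    (Asymptotics.isBigO_of_le _ fun v => by simp)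
  have hlim := hdiff'.tendsto_div_nhds_zero.div_const (m : ℂ)
  rw [zero_div] at hlim
  refine hlim.congr' ?_
  filter_upwards [hev, self_mem_nhdsWithin] with v ⟨h1, h2, h3, h4, h5, h6⟩ (hv : 0 < v)
  have hv0 : (v : ℂ) ≠ 0 := by exact_mod_cast hv.ne'
  rw [truncatedIntegral_of_endpoints (hγ.toOne (by omega)) hm hv h1 h2 h3 h4, h5, h6]
  have hsq : (-1 : ℂ) ^ m * (-1) ^ m = 1 := by rw [← mul_pow]; simp
  have hξe : ξ.eval (v : ℂ) = -(∑ k ∈ Finset.range (m + 1), c k * (v : ℂ) ^ k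
      - (-1) ^ m * ∑ k ∈ Finset.range (m + 1), c k * ((-v : ℝ) : ℂ) ^ k) / m := by
    have hsq' : (-1 : ℂ) ^ (m + m) = 1 := by rw [pow_add, hsq]
    rw [hξ, Polynomial.eval_finsetSum, Finset.mul_sum, ← Finset.sum_sub_distrib,
      Finset.sum_range_succ, neg_div, add_div, Finset.sum_div, neg_add, ← Finset.sum_neg_distrib]
    have hlast : c m * (v : ℂ) ^ m - (-1) ^ m * (c m * ((-v : ℝ) : ℂ) ^ m) = 0 := by
      push_cast
      rw [neg_pow (v : ℂ)]
      linear_combination -(c m * (v : ℂ) ^ m) * hsq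
    rw [hlast, zero_div, neg_zero, add_zero]
    refine Finset.sum_congr rfl fun k _ => ?_
    push_cast
    rw [neg_pow (v : ℂ)]
    simp
    ring
  have hneg : (w (-v) / (-v : ℂ)) ^ m = (-1 : ℂ) ^ m * (V (-v) / (v : ℂ) ^ m) := by
    rw [div_pow, neg_pow (v : ℂ), hV]
    field_simp
    linear_combination -(w (-v)) ^ m * hsq
  rw [hξe, hneg, div_pow, hV]
  field_simp
  ring

end

/-! ### Calculus of finite parts, and the finite-part identity. -/

section

/-- `I` is the finite part of `φ` at `0`, up to negative powers of order at most `r`. -/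
def IsFinitePartAt (r : ℕ) (φ : ℝ → ℂ) (I : ℂ) : Prop :=
  ∃ ξ : Polynomial ℂ, ξ.degree < (r : WithBot ℕ) ∧
    Tendsto (fun v : ℝ => φ v + ξ.eval (v : ℂ) / (v : ℂ) ^ r) (𝓝[>] 0) (𝓝 I)

namespace IsFinitePartAt

variable {r : ℕ} {φ ψ : ℝ → ℂ} {I J : ℂ}

theorem of_tendsto (h : Tendsto φ (𝓝[>] 0) (𝓝 I)) : IsFinitePartAt r φ I :=
  ⟨0, by simp, by simpa using h⟩

theorem congr (h : IsFinitePartAt r φ I) (hφ : ∀ v, 0 < v → φ v = ψ v) :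
    IsFinitePartAt r ψ I := by
  obtain ⟨ξ, hξ, h⟩ := h
  refine ⟨ξ, hξ, h.congr' ?_⟩
  filter_upwards [self_mem_nhdsWithin] with v hv
  rw [hφ v hv]

theorem add (h : IsFinitePartAt r φ I) (h' : IsFinitePartAt r ψ J) :
    IsFinitePartAt r (fun v => φ v + ψ v) (I + J) := by
  obtain ⟨ξ, hξ, h⟩ := h
  obtain ⟨ζ, hζ, h'⟩ := h'
  refine ⟨ξ + ζ, (Polynomial.degree_add_le _ _).trans_lt (max_lt hξ hζ),
    (h.add h').congr fun v => ?_⟩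
  rw [Polynomial.eval_add]
  ring

theorem const_mul (h : IsFinitePartAt r φ I) (c : ℂ) :
    IsFinitePartAt r (fun v => c * φ v) (c * I) := by
  obtain ⟨ξ, hξ, h⟩ := h
  refine ⟨Polynomial.C c * ξ, (Polynomial.degree_mul_le _ _).trans_lt ?_,
    (h.const_mul c).congr fun v => ?_⟩
  · refine lt_of_le_of_lt ?_ hξ
    calc (Polynomial.C c).degree + ξ.degree ≤ 0 + ξ.degree := by
          gcongr
          exact Polynomial.degree_C_le
      _ = ξ.degree := zero_add _
  · rw [Polynomial.eval_mul, Polynomial.eval_C]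
    ring

theorem sum {ι : Type*} (s : Finset ι) {φ : ι → ℝ → ℂ} {I : ι → ℂ}
    (h : ∀ i ∈ s, IsFinitePartAt r (φ i) (I i)) :
    IsFinitePartAt r (fun v => ∑ i ∈ s, φ i v) (∑ i ∈ s, I i) := by
  classical
  induction s using Finset.induction_on with
  | empty => simpa using of_tendsto (tendsto_const_nhds (x := (0 : ℂ)))
  | insert i s hi ih =>
    simp only [Finset.sum_insert hi]
    exact (h i (Finset.mem_insert_self _ _)).add
      (ih fun j hj => h j (Finset.mem_insert_of_mem hj))

/-- Numerator and denominator are multiplied by v^(r-m). This brings the expansions for poles of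
different orders to a common denominator. -/
theorem mono {m : ℕ} (h : IsFinitePartAt m φ I) (hm : m ≤ r) : IsFinitePartAt r φ I := by
  obtain ⟨ξ, hξ, h⟩ := h
  refine ⟨ξ * Polynomial.X ^ (r - m), ?_, h.congr' ?_⟩
  · rw [Polynomial.degree_mul, Polynomial.degree_X_pow]
    rcases eq_or_ne ξ 0 with rfl | h0
    · simp
    · rw [Polynomial.degree_eq_natDegree h0] at hξ ⊢
      norm_cast at hξ ⊢
      omega
  · filter_upwards [self_mem_nhdsWithin] with v (hv : 0 < v)
    have hv0 : (v : ℂ) ≠ 0 := by exact_mod_cast hv.ne'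
    rw [Polynomial.eval_mul, Polynomial.eval_pow, Polynomial.eval_X]
    congr 1
    rw [div_eq_div_iff (pow_ne_zero _ hv0) (pow_ne_zero _ hv0), mul_assoc, ← pow_add,
      Nat.sub_add_cancel hm]

/-- If ξ(v)/v^(r+1) converges, then ξ(0) = 0, and one factor v cancels; induction ends at r = 0,
where ξ = 0. -/
theorem eq_zero_of_zero : ∀ {r : ℕ} {I : ℂ}, IsFinitePartAt r (fun _ => 0) I → I = 0 := by
  intro r
  induction r with
  | zero =>
    rintro I ⟨ξ, hξ, h⟩
    have h0 : ξ = 0 := by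
      rw [← Polynomial.degree_eq_bot]
      exact Nat.WithBot.lt_zero_iff.1 (by exact_mod_cast hξ)
    subst h0
    refine tendsto_nhds_unique h ?_
    simp
  | succ r ih =>
    rintro I ⟨ξ, hξ, h⟩
    have hid : Tendsto (fun v : ℝ => (v : ℂ)) (𝓝[>] 0) (𝓝 0) := by
      have := (Complex.continuous_ofReal.tendsto 0).mono_left
        (nhdsWithin_le_nhds (s := Ioi (0 : ℝ)))
      simpa using this
    have h0 : ξ.eval 0 = 0 := by
      have h1 := h.mul (hid.pow (r + 1))
      have h2 : Tendsto (fun v : ℝ => ξ.eval (v : ℂ)) (𝓝[>] 0) (𝓝 (ξ.eval 0)) :=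
        (ξ.continuous.tendsto 0).comp hid
      refine tendsto_nhds_unique h2 ?_
      rw [zero_pow (Nat.succ_ne_zero r), mul_zero] at h1
      refine h1.congr' ?_
      filter_upwards [self_mem_nhdsWithin] with v (hv : 0 < v)
      have hv0 : (v : ℂ) ≠ 0 := by exact_mod_cast hv.ne'
      rw [zero_add, div_mul_cancel₀ _ (pow_ne_zero _ hv0)]
    obtain ⟨ζ, rfl⟩ : Polynomial.X ∣ ξ := by
      rw [Polynomial.X_dvd_iff, Polynomial.coeff_zero_eq_eval_zero, h0]
    refine ih ⟨ζ, ?_, h.congr' ?_⟩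
    · rcases eq_or_ne ζ 0 with rfl | h0
      · simp
      · rw [Polynomial.degree_mul, Polynomial.degree_X, Polynomial.degree_eq_natDegree h0] at hξ
        rw [Polynomial.degree_eq_natDegree h0]
        norm_cast at hξ ⊢
        omega
    · filter_upwards [self_mem_nhdsWithin] with v (hv : 0 < v)
      have hv0 : (v : ℂ) ≠ 0 := by exact_mod_cast hv.ne'
      rw [Polynomial.eval_mul, Polynomial.eval_X]
      field_simp
      ring

theorem unique (h : IsFinitePartAt r φ I) (h' : IsFinitePartAt r φ J) : I = J := by
  have := (h.add (h'.const_mul (-1))).congr (ψ := fun _ => 0) fun v _ => by ring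
  linear_combination this.eq_zero_of_zero

end IsFinitePartAt

theorem integrableOn_truncated {γ : ℝ → ℂ} (hγ : IsSmoothContour 1 γ) {x : ℂ → ℂ}
    (hx : Continuous fun s => x (γ s)) (p : ℕ) (t : ℂ) {v : ℝ} (hv : 0 < v) :
    IntegrableOn (fun s => x (γ s) / (γ s - t) ^ p * deriv γ s)
      {s : ℝ | s ∈ Ioc 0 1 ∧ v ≤ ‖γ s - t‖} := by
  have hcγ := hγ.continuous
  have hcγ' := hγ.continuous_deriv
  have hK : IsCompact (Icc (0 : ℝ) 1 ∩ {s | v ≤ ‖γ s - t‖}) :=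
    isCompact_Icc.inter_right (isClosed_le continuous_const (by fun_prop))
  have hc : ContinuousOn (fun s => x (γ s) / (γ s - t) ^ p * deriv γ s)
      (Icc (0 : ℝ) 1 ∩ {s | v ≤ ‖γ s - t‖}) :=
    ContinuousOn.mul (hx.continuousOn.div (by fun_prop) fun s hs =>
      pow_ne_zero _ (norm_pos_iff.1 (hv.trans_le hs.2))) (by fun_prop)
  exact (hc.integrableOn_compact hK).mono_set fun s hs => ⟨⟨hs.1.1.le, hs.1.2⟩, hs.2⟩

theorem truncatedIntegral_sum {γ : ℝ → ℂ} (hγ : IsSmoothContour 1 γ) {ι : Type*} (J : Finset ι)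
    {x : ι → ℂ → ℂ} (hx : ∀ i ∈ J, Continuous fun s => x i (γ s)) (c : ι → ℂ) (p : ℕ) (t : ℂ)
    {v : ℝ} (hv : 0 < v) :
    truncatedIntegral γ p (fun z => ∑ i ∈ J, c i * x i z) t v =
      ∑ i ∈ J, c i * truncatedIntegral γ p (x i) t v := by
  simp only [truncatedIntegral]
  simp_rw [← integral_const_mul]
  rw [← integral_finsetSum _ fun i hi =>
    (integrableOn_truncated hγ (hx i hi) p t hv).const_mul (c i)]
  refine integral_congr_ae (Eventually.of_forall fun s => ?_)
  simp only [Finset.sum_div, Finset.sum_mul]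
  exact Finset.sum_congr rfl fun i _ => by ring

theorem truncatedIntegral_sub {γ : ℝ → ℂ} (hγ : IsSmoothContour 1 γ) {x y : ℂ → ℂ}
    (hx : Continuous fun s => x (γ s)) (hy : Continuous fun s => y (γ s)) (p : ℕ) (t : ℂ)
    {v : ℝ} (hv : 0 < v) :
    truncatedIntegral γ p (fun z => x z - y z) t v =
      truncatedIntegral γ p x t v - truncatedIntegral γ p y t v := by
  simp only [truncatedIntegral]
  rw [← integral_sub (integrableOn_truncated hγ hx p t hv) (integrableOn_truncated hγ hy p t hv)]
  exact integral_congr_ae (Eventually.of_forall fun s => by ring)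

theorem measurableSet_truncated {γ : ℝ → ℂ} (hγ : IsSmoothContour 1 γ) (t : ℂ) (v : ℝ) :
    MeasurableSet {s : ℝ | s ∈ Ioc 0 1 ∧ v ≤ ‖γ s - t‖} := by
  have hcγ := hγ.continuous
  exact measurableSet_Ioc.inter (isClosed_le continuous_const
    (by fun_prop : Continuous fun s => ‖γ s - t‖)).measurableSet

theorem truncatedIntegral_pow {γ : ℝ → ℂ} (hγ : IsSmoothContour 1 γ) (n k : ℕ) (t : ℂ)
    {v : ℝ} (hv : 0 < v) :
    truncatedIntegral γ (n + k) (fun z => (z - t) ^ k) t v =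
      truncatedIntegral γ n (fun _ => 1) t v := by
  refine setIntegral_congr_fun (measurableSet_truncated hγ t v) fun s hs => ?_
  have h0 : γ s - t ≠ 0 := norm_pos_iff.1 (hv.trans_le hs.2)
  simp only [pow_add]
  field_simp

theorem IsAdmissible.diffContOnCl {γ : ℝ → ℂ} {p : ℕ} {α : ℝ≥0} {x : ℂ → ℂ}
    (hx : IsAdmissible γ p α x) : DiffContOnCl ℂ x (inside γ) :=
  ⟨hx.analytic.differentiableOn, hx.continuousOn⟩

/-- The finite part of a Cauchy integral in terms of the derivative along the contour. -/
theorem IsSmoothContour.hasFinitePart {γ : ℝ → ℂ} {r : ℕ} (hγ : IsSmoothContour (r + 1) γ)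
    {α : ℝ≥0} (hα : 0 < α) {x : ℂ → ℂ} (hx : IsAdmissible γ (r + 1) α x) {t : ℂ}
    (ht : t ∈ trace γ) :
    HasFinitePart γ (r + 1) x t
      (Real.pi * Complex.I * (contourDeriv γ r x t / (r.factorial : ℂ))) := by
  have hγ1 := hγ.toOne (by omega)
  obtain ⟨hxr, Mh, hMh⟩ := hx.wHolder
  rw [Nat.add_sub_cancel] at hxr hMh
  obtain ⟨s₀, rfl⟩ := ht
  set t := γ s₀ with ht
  have hcγ := hγ1.continuous
  obtain ⟨M, hM0, hM⟩ := hγ1.exists_norm_deriv_le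
  -- The Taylor polynomial along the contour. Being entire, it can be subtracted without leaving the
  -- class to which Cauchy's theorem applies.
  set P : ℂ → ℂ := fun z => ∑ k ∈ Finset.range (r + 1),
    contourDeriv γ k x t / (k.factorial : ℂ) * (z - t) ^ k with hP
  have hPd : Differentiable ℂ P := by
    intro z
    simp only [hP]
    fun_prop
  have hcx : Continuous fun s => x (γ s) := by
    simpa [contourDeriv] using hγ1.continuous_contourDeriv hxr (Nat.zero_le r)
  have hcP : Continuous fun s => P (γ s) := hPd.continuous.comp hcγ
  have hh : DiffContOnCl ℂ (fun z => x z - P z) (inside γ) :=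
    hx.diffContOnCl.sub hPd.diffContOnCl
  have hhol : ∀ s, |s - s₀| ≤ 1 / 2 →
      ‖contourDeriv γ r x (γ s) - contourDeriv γ r x (γ s₀)‖
        ≤ Mh * M ^ (α : ℝ) * |s - s₀| ^ (α : ℝ) := by
    intro s _
    have h1 := hMh.dist_le (x := γ s) (y := γ s₀) ⟨s, rfl⟩ ⟨s₀, rfl⟩
    have h2 : dist (γ s) (γ s₀) ≤ M * |s - s₀| := by
      rw [dist_eq_norm]
      exact Convex.norm_image_sub_le_of_norm_hasDerivWithin_le
        (fun u _ => (hγ1.hasDerivAt u).hasDerivWithinAt) (fun u _ => hM u) convex_univ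
        (mem_univ _) (mem_univ _)
    rw [dist_eq_norm] at h1
    refine h1.trans ?_
    rw [mul_assoc, ← Real.mul_rpow hM0.le (abs_nonneg _)]
    gcongr
  have hbd := norm_sub_taylor_le hγ1.hasDerivAt hM
    (y := fun k s => contourDeriv γ k x (γ s)) (r := r)
    (fun k hk s => hγ1.hasDerivAt_contourDeriv hxr hk s) (by positivity) α.coe_nonneg hhol r le_rfl
  have h0 := hγ1.tendsto_truncatedIntegral_zero hh (s₀ := s₀)
    (C := Mh * M ^ (α : ℝ) * M ^ r) (r := r) (α := α) (by exact_mod_cast hα) (fun s hs => by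
      have := hbd s hs
      simpa [contourDeriv, hP] using this)
  -- The monomial of degree k lowers the pole to order r + 1 - k. This is at least 2 for k < r, with
  -- finite part zero, and 1 for k = r, with principal value πi.
  have hfp : IsFinitePartAt r (fun v => truncatedIntegral γ (r + 1) (fun z => x z - P z) t v
      + ∑ k ∈ Finset.range (r + 1), contourDeriv γ k x t / (k.factorial : ℂ)
        * truncatedIntegral γ (r + 1 - k) (fun _ => 1) t v)
      (0 + ∑ k ∈ Finset.range (r + 1), contourDeriv γ k x t / (k.factorial : ℂ)
        * (if k = r then Real.pi * Complex.I else 0)) := by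
    refine (IsFinitePartAt.of_tendsto h0).add (IsFinitePartAt.sum _ fun k hk => ?_)
    refine IsFinitePartAt.const_mul ?_ _
    have hkr := Finset.mem_range.1 hk
    split_ifs with hkr'
    · subst hkr'
      rw [Nat.add_sub_cancel_left]
      exact IsFinitePartAt.of_tendsto (hγ1.tendsto_truncatedIntegral_one ⟨s₀, rfl⟩)
    · have h2 := hγ.exists_tendsto_truncatedIntegral (m := r - k) (by omega) (by omega)
        (t := t) ⟨s₀, rfl⟩
      rw [show r - k + 1 = r + 1 - k by omega] at h2
      exact IsFinitePartAt.mono h2 (by omega)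
  have hval : (0 + ∑ k ∈ Finset.range (r + 1), contourDeriv γ k x t / (k.factorial : ℂ)
        * (if k = r then Real.pi * Complex.I else 0)) =
      Real.pi * Complex.I * (contourDeriv γ r x t / (r.factorial : ℂ)) := by
    simp
    ring
  rw [hval] at hfp
  refine hfp.congr fun v hv => ?_
  rw [truncatedIntegral_sub hγ1 hcx hcP _ _ hv, hP, truncatedIntegral_sum hγ1 _
    (fun i _ => by fun_prop) _ _ _ hv, sub_add]
  rw [sub_eq_self, sub_eq_zero]
  refine Finset.sum_congr rfl fun k hk => ?_
  have hkr := Finset.mem_range.1 hk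
  rw [← truncatedIntegral_pow hγ1 (r + 1 - k) k t hv, Nat.sub_add_cancel (by omega)]

theorem IsAdmissible.finitePart_eq {γ : ℝ → ℂ} {r : ℕ} (hγ : IsSmoothContour (r + 1) γ)
    {α : ℝ≥0} (hα : 0 < α) {x : ℂ → ℂ} (hx : IsAdmissible γ (r + 1) α x) {t I : ℂ}
    (ht : t ∈ trace γ) (hI : HasFinitePart γ (r + 1) x t I) :
    I = Real.pi * Complex.I * (contourDeriv γ r x t / (r.factorial : ℂ)) :=
  IsFinitePartAt.unique (r := r) hI (hγ.hasFinitePart hα hx ht)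

/-- For admissible functions the singular equation is a differential equation on the contour. -/
theorem IsAdmissible.solvesEquation_iff {γ : ℝ → ℂ} {r : ℕ} (hγ : IsSmoothContour (r + 1) γ)
    {α : ℝ≥0} (hα : 0 < α) {a b f x : ℂ → ℂ} (hx : IsAdmissible γ (r + 1) α x) :
    SolvesEquation γ (r + 1) a b f x ↔ ∀ t ∈ trace γ,
      b t / (r.factorial : ℂ) * contourDeriv γ r x t + a t * x t = f t := by
  have hπ : (Real.pi : ℂ) * Complex.I ≠ 0 :=
    mul_ne_zero (by exact_mod_cast Real.pi_ne_zero) Complex.I_ne_zero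
  have key : ∀ t, a t * x t + b t / (Real.pi * Complex.I)
      * (Real.pi * Complex.I * (contourDeriv γ r x t / (r.factorial : ℂ))) =
      b t / (r.factorial : ℂ) * contourDeriv γ r x t + a t * x t := fun t => by
    rw [← mul_assoc, div_mul_cancel₀ _ hπ]
    ring
  refine ⟨fun h t ht => ?_, fun h t ht => ⟨_, hγ.hasFinitePart hα hx ht, ?_⟩⟩
  · obtain ⟨I, hI, h⟩ := h t ht
    rw [IsAdmissible.finitePart_eq hγ hα hx ht hI, key] at h
    exact h
  · rw [key, h t ht]

end

/-! ### Derivatives along the contour as boundary values of derivatives inside. -/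

section

variable {γ : ℝ → ℂ}

theorem ne_of_notMem_trace {z : ℂ} (hz : z ∉ trace γ) :
    ∀ s ∈ Icc (0 : ℝ) 1, γ s ≠ z := fun s _ h => hz ⟨s, h⟩

variable (hγ : IsSmoothContour 1 γ)
include hγ

/-- Integration by parts against (γ - z)^(-k); the boundary terms cancel because u and γ are
periodic. -/
theorem IsSmoothContour.cauchyTransform_deriv {u u' : ℝ → ℂ}
    (hu : ∀ s, HasDerivAt u (u' s * deriv γ s) s) (hu' : Continuous u')
    (hup : Function.Periodic u 1) {z : ℂ} (hz : z ∉ trace γ) (k : ℕ) :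
    cauchyTransform γ (fun s => u' s * deriv γ s) k z =
      k * cauchyTransform γ (fun s => u s * deriv γ s) (k + 1) z := by
  have hcγ := hγ.continuous
  have hcγ' := hγ.continuous_deriv
  have hcu : Continuous u := continuous_iff_continuousAt.2 fun s => (hu s).continuousAt
  have hne : ∀ s, γ s - z ≠ 0 := fun s => sub_ne_zero.2 fun h => hz ⟨s, h⟩
  have hd : ∀ s ∈ uIcc (0 : ℝ) 1, HasDerivAt (fun s => u s * (γ s - z)⁻¹ ^ k)
      (u' s * deriv γ s / (γ s - z) ^ k
        - k * (u s * deriv γ s / (γ s - z) ^ (k + 1))) s := by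
    intro s _
    have h0 := hne s
    convert! (hu s).fun_mul ((((hγ.hasDerivAt s).sub_const z).fun_inv h0).fun_pow k) using 1
    rcases k with _ | j
    · simp
    · rw [Nat.add_sub_cancel]
      simp only [inv_pow]
      field_simp
      ring
  have hc1 : Continuous fun s => u' s * deriv γ s / (γ s - z) ^ k :=
    (hu'.mul hcγ').div (by fun_prop) fun s => pow_ne_zero _ (hne s)
  have hc2 : Continuous fun s => u s * deriv γ s / (γ s - z) ^ (k + 1) :=
    (hcu.mul hcγ').div (by fun_prop) fun s => pow_ne_zero _ (hne s)
  have h1 := intervalIntegral.integral_eq_sub_of_hasDerivAt hd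
    ((hc1.sub (hc2.const_mul (k : ℂ))).intervalIntegrable _ _)
  rw [intervalIntegral.integral_sub (hc1.intervalIntegrable _ _)
    ((hc2.const_mul (k : ℂ)).intervalIntegrable _ _), intervalIntegral.integral_const_mul,
    hγ.closed, ← zero_add (1 : ℝ), hup 0, sub_self, sub_eq_zero, zero_add] at h1
  exact h1

theorem IsSmoothContour.periodic_comp (x : ℂ → ℂ) : Function.Periodic (fun s => x (γ s)) 1 :=
  fun s => congrArg x (hγ.periodic s)

theorem IsSmoothContour.cauchyTransform_contourDeriv {x : ℂ → ℂ} {r : ℕ}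
    (hx : ContDiffOn ℂ r x (trace γ)) {z : ℂ} (hz : z ∉ trace γ) : ∀ j ≤ r, ∀ k : ℕ,
    (k.factorial : ℂ)
        * cauchyTransform γ (fun s => contourDeriv γ j x (γ s) * deriv γ s) (k + 1) z =
      ((k + j).factorial : ℂ)
        * cauchyTransform γ (fun s => x (γ s) * deriv γ s) (k + 1 + j) z := by
  intro j
  induction j with
  | zero => intro _ k; simp [contourDeriv]
  | succ j ih =>
    intro hj k
    have h1 := hγ.cauchyTransform_deriv (fun s => hγ.hasDerivAt_contourDeriv hx hj s)
      (hγ.continuous_contourDeriv hx hj) (hγ.periodic_comp (contourDeriv γ j x)) hz (k + 1)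
    have h2 := ih (by omega) (k + 1)
    rw [h1, ← mul_assoc, ← Nat.cast_mul, mul_comm k.factorial, ← Nat.factorial_succ, h2,
      show k + 1 + j = k + (j + 1) by ring, show k + 1 + 1 + j = k + 1 + (j + 1) by ring]

theorem IsSmoothContour.iteratedDeriv_eq {h : ℂ → ℂ} (hh : DiffContOnCl ℂ h (inside γ)) (n : ℕ) :
    ∀ z ∈ inside γ, 2 * Real.pi * Complex.I * iteratedDeriv n h z =
      (n.factorial : ℂ) * cauchyTransform γ (fun s => h (γ s) * deriv γ s) (n + 1) z := by
  have hc : Continuous fun s => h (γ s) * deriv γ s :=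
    (hh.continuousOn.comp_continuous hγ.continuous fun s =>
      hγ.trace_subset_closure ⟨s, rfl⟩).mul hγ.continuous_deriv
  have hπ : 2 * (Real.pi : ℂ) * Complex.I ≠ 0 := Complex.two_pi_I_ne_zero
  induction n with
  | zero =>
    intro z hz
    rw [iteratedDeriv_zero, Nat.factorial_zero, Nat.cast_one, one_mul, zero_add,
      hγ.cauchyTransform_inside hh hz]
  | succ n ih =>
    intro z hz
    have hev : iteratedDeriv n h =ᶠ[𝓝 z] fun z => (2 * Real.pi * Complex.I)⁻¹
        * ((n.factorial : ℂ) * cauchyTransform γ (fun s => h (γ s) * deriv γ s) (n + 1) z) := by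
      filter_upwards [hγ.isOpen_inside.mem_nhds hz] with w hw
      rw [← ih w hw, inv_mul_cancel_left₀ hπ]
    rw [iteratedDeriv_succ, hev.deriv_eq,
      (((hasDerivAt_cauchyTransform hγ.continuous hc (ne_of_notMem_trace hz.1)
        (n + 1)).const_mul _).const_mul _).deriv, mul_inv_cancel_left₀ hπ, Nat.factorial_succ]
    push_cast
    ring

/-- The derivative of order `r` along the contour is the boundary value of the one inside. -/
theorem IsAdmissible.exists_diffContOnCl_contourDeriv {α : ℝ≥0} {x : ℂ → ℂ} {r : ℕ}
    (hx : IsAdmissible γ (r + 1) α x) : ∃ h : ℂ → ℂ, DiffContOnCl ℂ h (inside γ) ∧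
      (∀ t ∈ trace γ, h t = contourDeriv γ r x t) ∧
      ∀ z ∈ inside γ, h z = iteratedDeriv r x z := by
  obtain ⟨hxr, -⟩ := hx.wHolder
  rw [Nat.add_sub_cancel] at hxr
  have hcT : ∀ z ∉ trace γ,
      cauchyTransform γ (fun s => contourDeriv γ r x (γ s) * deriv γ s) 1 z =
      (r.factorial : ℂ) * cauchyTransform γ (fun s => x (γ s) * deriv γ s) (r + 1) z :=
    fun z hz => by
      simpa [add_comm] using hγ.cauchyTransform_contourDeriv hxr hz r le_rfl 0
  -- After r integrations by parts the Cauchy integral of the contour derivative is r! times the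
  -- transform of x of order r + 1. In the exterior this is zero, so the criterion for boundary
  -- values applies; inside it is 2πi times the r-th derivative.
  obtain ⟨h, hh, hhb⟩ := hγ.exists_diffContOnCl (hγ.continuous_contourDeriv hxr le_rfl)
    (hγ.periodic_comp (contourDeriv γ r x)) fun z hz => by
      rw [hcT z fun h => hz (hγ.trace_subset_closure h),
        hγ.cauchyTransform_exterior hx.diffContOnCl hz, mul_zero]
  refine ⟨h, hh, ?_, fun z hz => ?_⟩
  · rintro _ ⟨s, rfl⟩
    exact hhb s
  · refine mul_left_cancel₀ Complex.two_pi_I_ne_zero ?_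
    rw [← hγ.cauchyTransform_inside hh hz, hγ.iteratedDeriv_eq hx.diffContOnCl r z hz,
      ← hcT z hz.1]
    simp only [hhb]

theorem IsSmoothContour.eqOn_zero {h : ℂ → ℂ} (hh : DiffContOnCl ℂ h (inside γ))
    (h0 : ∀ t ∈ trace γ, h t = 0) {z : ℂ} (hz : z ∈ inside γ) : h z = 0 := by
  have h1 := hγ.cauchyTransform_inside hh hz
  have h2 : ∀ s, h (γ s) = 0 := fun s => h0 _ ⟨s, rfl⟩
  simp only [cauchyTransform, h2, zero_mul, zero_div, intervalIntegral.integral_zero] at h1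
  exact (mul_eq_zero.1 h1.symm).resolve_left Complex.two_pi_I_ne_zero

/-- A differential equation which holds on the contour holds in the inner domain as well. -/
theorem IsAdmissible.differentialEquation_inside {α : ℝ≥0} {a b f x : ℂ → ℂ} {r : ℕ}
    (hx : IsAdmissible γ (r + 1) α x) (ha : DiffContOnCl ℂ a (inside γ))
    (hb : DiffContOnCl ℂ b (inside γ)) (hf : DiffContOnCl ℂ f (inside γ)) (c : ℂ)
    (h : ∀ t ∈ trace γ, b t / c * contourDeriv γ r x t + a t * x t = f t) :
    ∀ z ∈ inside γ, b z / c * iteratedDeriv r x z + a z * x z = f z := by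
  obtain ⟨y, hy, hyb, hyi⟩ := hx.exists_diffContOnCl_contourDeriv hγ
  intro z hz
  -- The defect of the equation is analytic inside, continuous on the closure and zero on L, hence
  -- zero by Cauchy's formula.
  have h1 := hγ.eqOn_zero (((hb.smul (hy.const_smul c⁻¹)).add (ha.smul hx.diffContOnCl)).sub hf)
    (fun t ht => ?_) hz
  · simp only [Pi.sub_apply, Pi.add_apply, Pi.smul_apply, smul_eq_mul, hyi z hz]
      at h1
    linear_combination h1
  · simp only [Pi.sub_apply, Pi.add_apply, Pi.smul_apply, smul_eq_mul, hyb t ht]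
    linear_combination h t ht

/-- The transform of order two is the derivative of that of order one, which is therefore constant
on each exterior component. Such a component is unbounded and the transform tends to 0 at infinity.
-/
theorem IsSmoothContour.cauchyTransform_exterior_eq_zero {u : ℝ → ℂ} (hu : Continuous u)
    (h2 : ∀ z ∉ closure (inside γ), cauchyTransform γ u 2 z = 0) {z : ℂ}
    (hz : z ∉ closure (inside γ)) : cauchyTransform γ u 1 z = 0 := by
  have hzt : z ∈ (trace γ)ᶜ := fun h => hz (hγ.trace_subset_closure h)
  set S := connectedComponentIn (trace γ)ᶜ z with hS
  have hSo : IsOpen S := hγ.isOpen_compl_trace.connectedComponentIn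
  have hSp : IsPreconnected S := isPreconnected_connectedComponentIn
  have hSt : S ⊆ (trace γ)ᶜ := connectedComponentIn_subset _ _
  have hzS : z ∈ S := mem_connectedComponentIn hzt
  have hub : ¬ Bornology.IsBounded S := fun h => hz (subset_closure ⟨hzt, h⟩)
  have hSe : ∀ w ∈ S, w ∉ closure (inside γ) := fun w hw =>
    hγ.exterior_of_normal (hSt hw) fun hwi => hub <| by
      rw [hS, connectedComponentIn_eq hw]
      exact hwi.2
  have hd : ∀ w ∈ S, HasDerivAt (cauchyTransform γ u 1) 0 w := fun w hw => by
    have := hasDerivAt_cauchyTransform hγ.continuous hu (ne_of_notMem_trace (hSt hw)) 1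
    rwa [h2 w (hSe w hw), mul_zero] at this
  by_contra hne
  have h1 := (tendsto_cauchyTransform_cocompact hu hγ.continuous).eventually_ne (Ne.symm hne)
  rw [Filter.Eventually, Metric.mem_cocompact_iff_closedBall_compl_subset 0] at h1
  obtain ⟨r, hr⟩ := h1
  refine hub ((Metric.isBounded_closedBall (x := (0 : ℂ)) (r := r)).subset fun w hw => ?_)
  by_contra hwr
  refine hr hwr (hSo.is_const_of_deriv_eq_zero hSp
    (fun w hw => (hd w hw).differentiableAt.differentiableWithinAt)
    (fun w hw => (hd w hw).deriv) hw hzS)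

end

/-! ### Linear differential systems in the space of boundary values. -/

section

open scoped BoundedContinuousFunction

/-- `u` is, in terms of the parameter, the boundary value of a function which is continuous on the
closed inner domain and analytic inside. -/
def IsBoundaryValue (γ u : ℝ → ℂ) : Prop :=
  ∃ h : ℂ → ℂ, DiffContOnCl ℂ h (inside γ) ∧ ∀ s, h (γ s) = u s

namespace IsBoundaryValue

variable {γ u v : ℝ → ℂ}

theorem const (c : ℂ) : IsBoundaryValue γ fun _ => c :=
  ⟨fun _ => c, diffContOnCl_const, fun _ => rfl⟩

theorem add (hu : IsBoundaryValue γ u) (hv : IsBoundaryValue γ v) :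
    IsBoundaryValue γ fun s => u s + v s := by
  obtain ⟨h, hh, hu⟩ := hu
  obtain ⟨k, hk, hv⟩ := hv
  exact ⟨h + k, hh.add hk, fun s => by rw [Pi.add_apply, hu, hv]⟩

theorem mul (hu : IsBoundaryValue γ u) (hv : IsBoundaryValue γ v) :
    IsBoundaryValue γ fun s => u s * v s := by
  obtain ⟨h, hh, hu⟩ := hu
  obtain ⟨k, hk, hv⟩ := hv
  exact ⟨fun z => h z • k z, hh.smul hk, fun s => by
    simp only [smul_eq_mul, hu, hv]⟩

theorem sum {ι : Type*} {u : ι → ℝ → ℂ} (J : Finset ι) (hu : ∀ i ∈ J, IsBoundaryValue γ (u i)) :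
    IsBoundaryValue γ fun s => ∑ i ∈ J, u i s := by
  classical
  induction J using Finset.induction_on with
  | empty => simpa using const 0
  | insert i J hi ih =>
    simp only [Finset.sum_insert hi]
    exact (hu i (Finset.mem_insert_self _ _)).add
      (ih fun j hj => hu j (Finset.mem_insert_of_mem hj))

variable (hγ : IsSmoothContour 1 γ)
include hγ

theorem continuous (hu : IsBoundaryValue γ u) : Continuous u := by
  obtain ⟨h, hh, hu⟩ := hu
  rw [← funext hu]
  exact hh.continuousOn.comp_continuous hγ.continuous fun s => hγ.trace_subset_closure ⟨s, rfl⟩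

theorem periodic (hu : IsBoundaryValue γ u) : Function.Periodic u 1 := by
  obtain ⟨h, hh, hu⟩ := hu
  rw [← funext hu]
  exact hγ.periodic_comp h

theorem iff_cauchyTransform : IsBoundaryValue γ u ↔ Continuous u ∧ Function.Periodic u 1 ∧
    ∀ z ∉ closure (inside γ), cauchyTransform γ (fun s => u s * deriv γ s) 1 z = 0 := by
  refine ⟨fun hu => ⟨hu.continuous hγ, hu.periodic hγ, fun z hz => ?_⟩, fun ⟨h1, h2, h3⟩ =>
    hγ.exists_diffContOnCl h1 h2 h3⟩
  obtain ⟨h, hh, hu⟩ := hu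
  simp only [← hu]
  exact hγ.cauchyTransform_exterior hh hz 1

theorem hasDerivAt_integral (hu : IsBoundaryValue γ u) (s₀ s : ℝ) :
    HasDerivAt (fun s => ∫ r in s₀..s, u r * deriv γ r) (u s * deriv γ s) s := by
  have hc := (hu.continuous hγ).mul hγ.continuous_deriv
  exact intervalIntegral.integral_hasDerivAt_right (hc.intervalIntegrable _ _)
    hc.aestronglyMeasurable.stronglyMeasurableAtFilter hc.continuousAt

/-- Cauchy's theorem makes the primitive periodic. Integration by parts identifies its transform of
order two with the transform of u of order one, zero in the exterior, and the order then drops from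
two to one. -/
theorem integral (hu : IsBoundaryValue γ u) (s₀ : ℝ) :
    IsBoundaryValue γ fun s => ∫ r in s₀..s, u r * deriv γ r := by
  have hcu := hu.continuous hγ
  have hc : Continuous fun s => u s * deriv γ s := hcu.mul hγ.continuous_deriv
  have hper : Function.Periodic (fun s => ∫ r in s₀..s, u r * deriv γ r) 1 := fun s => by
    have h1 : Function.Periodic (fun r => u r * deriv γ r) 1 :=
      (hu.periodic hγ).mul hγ.periodic_deriv
    have h2 : ∫ r in (0 : ℝ)..1, u r * deriv γ r = 0 := by
      obtain ⟨h, hh, hu⟩ := hu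
      simp only [← hu]
      exact hγ.integral_eq_zero hh
    have h3 := h1.intervalIntegral_add_eq s 0
    rw [zero_add, h2] at h3
    simp only
    rw [← intervalIntegral.integral_add_adjacent_intervals (hc.intervalIntegrable s₀ s)
      (hc.intervalIntegrable s (s + 1)), h3, add_zero]
  have hd := hu.hasDerivAt_integral hγ s₀
  have hcont : Continuous fun s => ∫ r in s₀..s, u r * deriv γ r :=
    continuous_iff_continuousAt.2 fun s => (hd s).continuousAt
  refine (iff_cauchyTransform hγ).2 ⟨hcont, hper, fun z hz => ?_⟩
  refine hγ.cauchyTransform_exterior_eq_zero (hcont.mul hγ.continuous_deriv) (fun w hw => ?_) hz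
  have h1 := hγ.cauchyTransform_deriv hd hcu hper
    (fun h => hw (hγ.trace_subset_closure h)) 1
  rw [((iff_cauchyTransform hγ).1 hu).2.2 w hw, Nat.cast_one, one_mul] at h1
  exact h1.symm

/-- By the exterior criterion, being a boundary value amounts to a family of equations between
continuous functionals in the uniform norm. -/
theorem isClosed : IsClosed {u : ℝ →ᵇ ℂ | IsBoundaryValue γ u} := by
  have hset : {u : ℝ →ᵇ ℂ | IsBoundaryValue γ u} =
      (⋂ s : ℝ, {u : ℝ →ᵇ ℂ | u (s + 1) = u s}) ∩ ⋂ z ∈ (closure (inside γ))ᶜ,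
        {u : ℝ →ᵇ ℂ | cauchyTransform γ (fun s => u s * deriv γ s) 1 z = 0} := by
    ext u
    simp only [mem_ofPred_eq, iff_cauchyTransform hγ, mem_inter_iff, mem_iInter, mem_compl_iff]
    exact ⟨fun h => h.2, fun h => ⟨u.continuous, h⟩⟩
  rw [hset]
  refine (isClosed_iInter fun s => isClosed_eq ?_ ?_).inter
    (isClosed_biInter fun z hz => isClosed_eq ?_ continuous_const)
  · fun_prop
  · fun_prop
  have hcγ := hγ.continuous
  have hcγ' := hγ.continuous_deriv
  have hne : ∀ s, γ s - z ≠ 0 := fun s =>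
    sub_ne_zero.2 fun h => hz (hγ.trace_subset_closure ⟨s, h⟩)
  have hck : Continuous fun s => deriv γ s / (γ s - z) ^ 1 :=
    hcγ'.div (by fun_prop) fun s => pow_ne_zero _ (hne s)
  obtain ⟨B, hB0, hB⟩ := exists_norm_le_Icc hck
  refine (LipschitzWith.of_dist_le_mul (K := ⟨B, hB0.le⟩) fun u v => ?_).continuous
  have hci : ∀ w : ℝ →ᵇ ℂ, Continuous fun s => w s * deriv γ s / (γ s - z) ^ 1 := fun w =>
    (w.continuous.mul hcγ').div (by fun_prop) fun s => pow_ne_zero _ (hne s)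
  rw [dist_eq_norm, cauchyTransform, cauchyTransform, ← intervalIntegral.integral_sub
    ((hci u).intervalIntegrable _ _) ((hci v).intervalIntegrable _ _)]
  refine (intervalIntegral.norm_integral_le_of_norm_le_const (C := B * dist u v)
    fun s hs => ?_).trans (by rw [sub_zero, abs_one, mul_one]; rfl)
  rw [uIoc_of_le zero_le_one] at hs
  rw [show u s * deriv γ s / (γ s - z) ^ 1 - v s * deriv γ s / (γ s - z) ^ 1 =
    deriv γ s / (γ s - z) ^ 1 * (u s - v s) by ring, norm_mul, ← dist_eq_norm]
  gcongr
  · exact hB s (Ioc_subset_Icc_self hs)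
  · exact BoundedContinuousFunction.dist_coe_le_dist s

theorem exists_boundedContinuousFunction (hu : IsBoundaryValue γ u) :
    ∃ w : ℝ →ᵇ ℂ, ∀ s, w s = u s := by
  obtain ⟨M, -, hM⟩ := exists_bound_of_periodic (hu.continuous hγ) (hu.periodic hγ)
  exact ⟨BoundedContinuousFunction.ofNormedAddCommGroup u (hu.continuous hγ) M hM, fun _ => rfl⟩

end IsBoundaryValue

/-- A linear system of differential equations along the contour, the coefficients of which are
boundary values of analytic functions, has solutions of the same kind. -/
theorem IsSmoothContour.exists_linear_system {γ : ℝ → ℂ} (hγ : IsSmoothContour 1 γ) {ι : Type*}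
    [Fintype ι] {A : ι → ι → ℝ → ℂ} {F : ι → ℝ → ℂ} (hA : ∀ i j, IsBoundaryValue γ (A i j))
    (hF : ∀ i, IsBoundaryValue γ (F i)) (s₀ : ℝ) (e : ι → ℂ) :
    ∃ y : ι → ℝ → ℂ, (∀ i, IsBoundaryValue γ (y i)) ∧ (∀ i, y i s₀ = e i) ∧
      ∀ i s, HasDerivAt (y i) ((∑ j, A i j s * y j s + F i s) * deriv γ s) s := by
  -- The Picard operator maps this complete space into itself. Working here, rather than on an
  -- interval, is what makes the solution periodic and extendable into the inner domain.
  set S : Set (ι → ℝ →ᵇ ℂ) := {y | ∀ i, IsBoundaryValue γ (y i)} with hS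
  have hSc : IsClosed S := by
    rw [hS, ofPred_forall]
    exact isClosed_iInter fun i =>
      (IsBoundaryValue.isClosed hγ).preimage (f := fun y : ι → ℝ →ᵇ ℂ => y i) (continuous_apply i)
  have hcS : CompleteSpace S := hSc.completeSpace_coe
  have hne : Nonempty S := ⟨⟨0, fun i => IsBoundaryValue.const 0⟩⟩
  have hrhs : ∀ (y : S) i, IsBoundaryValue γ fun s => ∑ j, A i j s * y.1 j s + F i s :=
    fun y i => (IsBoundaryValue.sum _ fun j _ => (hA i j).mul (y.2 j)).add (hF i)
  have hT : ∀ y : S, ∃ w : S, ∀ i s, w.1 i s =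
      e i + ∫ r in s₀..s, (∑ j, A i j r * y.1 j r + F i r) * deriv γ r := by
    intro y
    have h1 : ∀ i, IsBoundaryValue γ fun s =>
        e i + ∫ r in s₀..s, (∑ j, A i j r * y.1 j r + F i r) * deriv γ r := fun i =>
      (IsBoundaryValue.const (e i)).add ((hrhs y i).integral hγ s₀)
    choose w hw using fun i => (h1 i).exists_boundedContinuousFunction hγ
    exact ⟨⟨w, fun i => by
      have := h1 i
      rwa [← funext (hw i)] at this⟩, hw⟩
  choose T hT using hT
  obtain ⟨M, hM0, hM⟩ := hγ.exists_norm_deriv_le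
  obtain ⟨B, hB0, hB⟩ : ∃ B : ℝ, 0 ≤ B ∧ ∀ i s, ∑ j, ‖A i j s‖ ≤ B := by
    choose b hb0 hb using fun i j =>
      exists_bound_of_periodic ((hA i j).continuous hγ) ((hA i j).periodic hγ)
    refine ⟨∑ i, ∑ j, b i j, Finset.sum_nonneg fun i _ => Finset.sum_nonneg fun j _ =>
      (hb0 i j).le, fun i s => ?_⟩
    refine (Finset.sum_le_sum fun j _ => hb i j s).trans ?_
    exact Finset.single_le_sum (f := fun i => ∑ j, b i j)
      (fun i _ => Finset.sum_nonneg fun j _ => (hb0 i j).le) (Finset.mem_univ i)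
  set K : ℝ := B * M with hK
  have hK0 : 0 ≤ K := by positivity
  -- The usual Picard estimate over one period; periodicity then carries it to all s. Since Kⁿ/n! →
  -- 0, some iterate is a contraction, and its fixed point is fixed by `T` as well.
  have hest : ∀ (n : ℕ) (y w : S) (i : ι), ∀ s ∈ Icc s₀ (s₀ + 1),
      ‖(T^[n] y).1 i s - (T^[n] w).1 i s‖ ≤
        K ^ n * (s - s₀) ^ n / (n.factorial : ℝ) * dist y w := by
    intro n y w
    induction n with
    | zero =>
      intro i s _
      simp only [Function.iterate_zero, id_eq, pow_zero, Nat.factorial_zero, Nat.cast_one,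
        mul_one, div_one, one_mul]
      rw [← dist_eq_norm, Subtype.dist_eq]
      exact (BoundedContinuousFunction.dist_coe_le_dist s).trans (dist_le_pi_dist y.1 w.1 i)
    | succ n ih =>
      intro i s hs
      rw [Function.iterate_succ_apply', Function.iterate_succ_apply', hT, hT, add_sub_add_left_eq_sub]
      have hc : ∀ y : S, Continuous fun r => (∑ j, A i j r * y.1 j r + F i r) * deriv γ r :=
        fun y => ((hrhs y i).continuous hγ).mul hγ.continuous_deriv
      rw [← intervalIntegral.integral_sub ((hc _).intervalIntegrable _ _)
        ((hc _).intervalIntegrable _ _)]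
      have hI : ∫ r in s₀..s, K * (K ^ n * (r - s₀) ^ n / (n.factorial : ℝ) * dist y w) =
          K ^ (n + 1) * (s - s₀) ^ (n + 1) / ((n + 1).factorial : ℝ) * dist y w := by
        have h1 : ∫ r in s₀..s, (r - s₀) ^ n = (s - s₀) ^ (n + 1) / (n + 1) := by
          rw [intervalIntegral.integral_comp_sub_right (fun r => r ^ n), sub_self, integral_pow]
          simp
        rw [show (fun r => K * (K ^ n * (r - s₀) ^ n / (n.factorial : ℝ) * dist y w)) =
          fun r => (K ^ (n + 1) / (n.factorial : ℝ) * dist y w) * (r - s₀) ^ n by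
            ext r; ring, intervalIntegral.integral_const_mul, h1, Nat.factorial_succ]
        push_cast
        field_simp
      rw [← hI]
      refine intervalIntegral.norm_integral_le_of_norm_le hs.1
        (Eventually.of_forall fun r hr => ?_) (Continuous.intervalIntegrable (by fun_prop) _ _)
      have hr' : r ∈ Icc s₀ (s₀ + 1) := ⟨hr.1.le, hr.2.trans hs.2⟩
      rw [← sub_mul, add_sub_add_right_eq_sub, ← Finset.sum_sub_distrib, norm_mul]
      simp_rw [← mul_sub]
      set E := K ^ n * (r - s₀) ^ n / (n.factorial : ℝ) * dist y w with hE
      have hE0 : 0 ≤ E := by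
        have : 0 ≤ r - s₀ := sub_nonneg.2 hr'.1
        positivity
      have h2 : ‖∑ j, A i j r * ((T^[n] y).1 j r - (T^[n] w).1 j r)‖ ≤ B * E := by
        refine (norm_sum_le _ _).trans ?_
        refine (Finset.sum_le_sum fun j _ => (norm_mul_le _ _).trans
          (mul_le_mul_of_nonneg_left (ih j r hr') (norm_nonneg _))).trans ?_
        rw [← Finset.sum_mul]
        exact mul_le_mul_of_nonneg_right (hB i r) hE0
      calc _ ≤ (B * E) * M := mul_le_mul h2 (hM r) (norm_nonneg _) (by positivity)
        _ = K * E := by rw [hK]; ring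
  have hlip : ∀ n : ℕ, LipschitzWith ⟨K ^ n / (n.factorial : ℝ), by positivity⟩ T^[n] := by
    intro n
    refine LipschitzWith.of_dist_le_mul fun y w => ?_
    rw [Subtype.dist_eq (T^[n] y)]
    have h0 : 0 ≤ K ^ n / (n.factorial : ℝ) * dist y w := by positivity
    refine (dist_pi_le_iff h0).2 fun i => (BoundedContinuousFunction.dist_le h0).2 fun s => ?_
    have hper : Function.Periodic (fun s => (T^[n] y).1 i s - (T^[n] w).1 i s) 1 :=
      (((T^[n] y).2 i).periodic hγ).sub (((T^[n] w).2 i).periodic hγ)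
    obtain ⟨s', hs', h1⟩ := hper.exists_mem_Ico one_pos s s₀
    rw [dist_eq_norm, h1]
    refine (hest n y w i s' ⟨hs'.1, hs'.2.le⟩).trans ?_
    have h2 : (s' - s₀) ^ n ≤ 1 :=
      pow_le_one₀ (sub_nonneg.2 hs'.1) (by linarith [hs'.2])
    gcongr
    exact mul_le_of_le_one_right (by positivity) h2
  obtain ⟨n, hn⟩ : ∃ n : ℕ, K ^ n / (n.factorial : ℝ) < 1 :=
    ((FloorSemiring.tendsto_pow_div_factorial_atTop K).eventually_lt_const one_pos).exists
  have hcon : ContractingWith ⟨K ^ n / (n.factorial : ℝ), by positivity⟩ T^[n] :=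
    ⟨by exact_mod_cast hn, hlip n⟩
  set y := ContractingWith.fixedPoint T^[n] hcon with hy
  have hfix : T y = y := hcon.isFixedPt_fixedPoint_iterate
  have hval : ∀ i s, y.1 i s =
      e i + ∫ r in s₀..s, (∑ j, A i j r * y.1 j r + F i r) * deriv γ r := fun i s => by
    conv_lhs => rw [← hfix]
    exact hT y i s
  refine ⟨fun i => y.1 i, y.2, fun i => ?_, fun i s => ?_⟩
  · simp only [hval i s₀, intervalIntegral.integral_same, add_zero]
  · exact (((hrhs y i).hasDerivAt_integral hγ s₀ s).const_add (e i)).congr_of_eventuallyEq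
      (Eventually.of_forall (hval i))

end

/-! ### From derivatives in the parameter to derivatives along the contour. -/

section

section derivatives

variable {γ : ℝ → ℂ} (hγ : IsSmoothContour 1 γ)
include hγ

theorem IsSmoothContour.exists_chord_arc : ∃ c : ℝ, 0 < c ∧
    ∀ s s' : ℝ, |s' - s| ≤ 1 / 2 → c * |s' - s| ≤ ‖γ s' - γ s‖ := by
  obtain ⟨c, lam, hc, hlam, hK, -⟩ := hγ.exists_tube
  refine ⟨c, hc, fun s s' h => ?_⟩
  simpa using hK s s' 0 h (by simpa using hlam.le)

/-- The chord-arc bound, together with a parameter chosen within 1/2 of s, shows that points of L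
close to γ s have parameters close to s. Limits along L can therefore be computed in the parameter.
-/
theorem IsSmoothContour.nhdsWithin_trace_le (s : ℝ) : 𝓝[trace γ] (γ s) ≤ map γ (𝓝 s) := by
  obtain ⟨c, hc, hca⟩ := hγ.exists_chord_arc
  intro U hU
  obtain ⟨δ, hδ, hball⟩ := Metric.mem_nhds_iff.1 (mem_map.1 hU)
  refine mem_nhdsWithin_iff_exists_mem_nhds_inter.2
    ⟨Metric.ball (γ s) (c * δ), Metric.ball_mem_nhds _ (by positivity), ?_⟩
  rintro τ ⟨hτ, hτL⟩
  obtain ⟨s', hs', rfl⟩ := hγ.exists_mem_trace hτL s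
  refine hball (Metric.mem_ball.2 ?_)
  rw [Metric.mem_ball, dist_eq_norm] at hτ
  rw [Real.dist_eq]
  exact lt_of_mul_lt_mul_left ((hca s s' hs').trans_lt hτ) hc.le

/-- A derivative with respect to the parameter gives a derivative along the contour. -/
theorem IsSmoothContour.hasDerivWithinAt_trace {x : ℂ → ℂ} {x' : ℂ} {s : ℝ}
    (hx : HasDerivAt (fun s => x (γ s)) (x' * deriv γ s) s) :
    HasDerivWithinAt x x' (trace γ) (γ s) := by
  have h1 : (fun r => x (γ r) - x (γ s) - (γ r - γ s) * x') =o[𝓝 s] fun r => r - s := by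
    have := ((hx.fun_sub ((hγ.hasDerivAt s).mul_const x'))).isLittleO
    refine this.congr_left fun r => ?_
    simp
    ring
  have h2 : (fun r => r - s) =O[𝓝 s] fun r => γ r - γ s := by
    obtain ⟨c, hc, hca⟩ := hγ.exists_chord_arc
    refine Asymptotics.IsBigO.of_bound c⁻¹ ?_
    filter_upwards [Metric.closedBall_mem_nhds s (by norm_num : (0 : ℝ) < 1 / 2)] with r hr
    rw [Real.norm_eq_abs, inv_mul_eq_div, le_div_iff₀' hc]
    exact hca s r hr
  rw [hasDerivWithinAt_iff_isLittleO]
  have h3 := h1.trans_isBigO h2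
  refine Asymptotics.IsLittleO.mono ?_ (hγ.nhdsWithin_trace_le s)
  rw [Asymptotics.isLittleO_map]
  exact h3

theorem IsSmoothContour.contourDeriv_eq {X : ℕ → ℂ → ℂ} {r : ℕ}
    (hX : ∀ k < r, ∀ s, HasDerivAt (fun s => X k (γ s)) (X (k + 1) (γ s) * deriv γ s) s) :
    ∀ k ≤ r, ∀ t ∈ trace γ, contourDeriv γ k (X 0) t = X k t := by
  intro k
  induction k with
  | zero => intro _ t _; simp [contourDeriv]
  | succ k ih =>
    rintro hk _ ⟨s, rfl⟩
    rw [contourDeriv, iteratedDerivWithin_succ]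
    have h1 := (hγ.hasDerivWithinAt_trace (hX k hk s)).congr
      (fun t ht => ih (by omega) t ht) (ih (by omega) _ ⟨s, rfl⟩)
    exact h1.derivWithin (hγ.uniqueDiffOn_trace (γ s) ⟨s, rfl⟩)

theorem IsSmoothContour.contDiffOn_trace {X : ℕ → ℂ → ℂ} {r : ℕ}
    (hX : ∀ k < r, ∀ s, HasDerivAt (fun s => X k (γ s)) (X (k + 1) (γ s) * deriv γ s) s)
    (hXr : ContinuousOn (X r) (trace γ)) : ContDiffOn ℂ r (X 0) (trace γ) := by
  have hd : ∀ m < r, DifferentiableOn ℂ (X m) (trace γ) := by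
    rintro m hm _ ⟨s, rfl⟩
    exact (hγ.hasDerivWithinAt_trace (hX m hm s)).differentiableWithinAt
  have heq : ∀ m ≤ r, EqOn (iteratedDerivWithin m (X 0) (trace γ)) (X m) (trace γ) :=
    fun m hm t ht => hγ.contourDeriv_eq hX m hm t ht
  refine contDiffOn_of_continuousOn_differentiableOn_deriv (n := (r : ℕ∞)) (fun m hm => ?_)
    fun m hm => ?_
  · have hm' : m ≤ r := by exact_mod_cast hm
    refine ContinuousOn.congr ?_ (heq m hm')
    rcases hm'.lt_or_eq with h | rfl
    · exact (hd m h).continuousOn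
    · exact hXr
  · have hm' : m < r := by exact_mod_cast hm
    exact (hd m hm').congr (heq m hm'.le)

/-- A bounded parameter derivative and the chord-arc bound give a Lipschitz estimate on L; since L
is bounded, this implies a Hölder estimate for any smaller exponent. -/
theorem IsSmoothContour.exists_holderOnWith {g : ℂ → ℂ} {g' : ℝ → ℂ}
    (hg : ∀ s, HasDerivAt (fun s => g (γ s)) (g' s) s) (hg' : Continuous g') {α : ℝ≥0}
    (hα : α ≤ 1) : ∃ M : ℝ≥0, HolderOnWith M α g (trace γ) := by
  obtain ⟨c, hc, hca⟩ := hγ.exists_chord_arc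
  obtain ⟨B, hB⟩ := isCompact_Icc.exists_bound_of_continuousOn (s := Icc (-1 : ℝ) 2)
    hg'.continuousOn
  have hB0 : 0 ≤ B := (norm_nonneg _).trans (hB 0 (by norm_num))
  have hlip : HolderOnWith (B / c).toNNReal 1 g (trace γ) := by
    rw [holderOnWith_one]
    refine LipschitzOnWith.of_dist_le_mul ?_
    rintro _ ⟨s₀, rfl⟩ τ hτ
    obtain ⟨s, hs, hss⟩ := hγ.exists_mem_trace ⟨s₀, rfl⟩ (1 / 2)
    obtain ⟨s', hs', rfl⟩ := hγ.exists_mem_trace hτ s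
    rw [← hss]
    rw [abs_le] at hs
    have hs1 := abs_le.1 hs'
    have h1 : ‖g (γ s') - g (γ s)‖ ≤ B * ‖s' - s‖ :=
      (convex_Icc (-1 : ℝ) 2).norm_image_sub_le_of_norm_hasDerivWithin_le
        (fun u _ => (hg u).hasDerivWithinAt) hB
        ⟨by linarith [hs.1], by linarith [hs.2]⟩
        ⟨by linarith [hs.1, hs1.1], by linarith [hs.2, hs1.2]⟩
    rw [dist_comm, dist_comm (γ s), dist_eq_norm, dist_eq_norm]
    refine h1.trans ?_
    have h2 := hca s s' hs'
    rw [Real.norm_eq_abs, Real.coe_toNNReal _ (by positivity), div_mul_eq_mul_div, le_div_iff₀ hc]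
    nlinarith
  obtain ⟨D, hD⟩ := Metric.isBounded_iff_nndist.1 hγ.isCompact_trace.isBounded
  refine ⟨_, HolderOnWith.of_le (D := D) (fun y hy z hz => ?_) hlip hα⟩
  rw [edist_nndist]
  exact_mod_cast hD hy hz

end derivatives

end

/-! ### Solutions of the singular equation. -/

section

theorem diffContOnCl_of_analyticOnNhd {U : Set ℂ} {g : ℂ → ℂ}
    (hg : AnalyticOnNhd ℂ g (closure U)) : DiffContOnCl ℂ g U :=
  ⟨(hg.mono subset_closure).differentiableOn, hg.continuousOn⟩

variable {γ : ℝ → ℂ}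

section

variable (hγ : IsSmoothContour 1 γ)
include hγ

theorem IsSmoothContour.continuous_comp {g : ℂ → ℂ} (hg : ContinuousOn g (closure (inside γ))) :
    Continuous fun s => g (γ s) :=
  hg.comp_continuous hγ.continuous fun s => hγ.trace_subset_closure ⟨s, rfl⟩

theorem IsSmoothContour.hasDerivAt_comp {g : ℂ → ℂ} (hg : AnalyticOnNhd ℂ g (closure (inside γ)))
    (s : ℝ) : HasDerivAt (fun s => g (γ s)) (deriv g (γ s) * deriv γ s) s :=
  ((hg (γ s) (hγ.trace_subset_closure ⟨s, rfl⟩)).differentiableAt.hasDerivAt).comp s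
    (hγ.hasDerivAt s)

theorem IsSmoothContour.continuous_deriv_comp {g : ℂ → ℂ}
    (hg : AnalyticOnNhd ℂ g (closure (inside γ))) : Continuous fun s => deriv g (γ s) :=
  hγ.continuous_comp hg.deriv.continuousOn

/-- Solutions of `x^(r) = d - c x` along the contour which are boundary values of analytic
functions and take given initial values. -/
theorem IsSmoothContour.exists_solution {r : ℕ} (hr : 1 ≤ r) {α : ℝ≥0} (hα : α ≤ 1)
    {c d : ℂ → ℂ} (hc : AnalyticOnNhd ℂ c (closure (inside γ)))
    (hd : AnalyticOnNhd ℂ d (closure (inside γ))) (s₀ : ℝ) (e : Fin r → ℂ) :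
    ∃ x : ℂ → ℂ, IsAdmissible γ (r + 1) α x ∧
      (∀ t ∈ trace γ, contourDeriv γ r x t = d t - c t * x t) ∧
      ∀ k : Fin r, contourDeriv γ k x (γ s₀) = e k := by
  have hcB : IsBoundaryValue γ fun s => -c (γ s) :=
    ⟨fun z => -c z, (diffContOnCl_of_analyticOnNhd hc).neg, fun _ => rfl⟩
  have hdB : IsBoundaryValue γ fun s => d (γ s) :=
    ⟨d, diffContOnCl_of_analyticOnNhd hd, fun _ => rfl⟩
  -- The companion matrix of x^(r) = d - c x: ones above the diagonal, and -c in the first column of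
  -- the last row.
  set A : Fin r → Fin r → ℝ → ℂ := fun i j =>
    if i.val + 1 < r then (if j.val = i.val + 1 then fun _ => 1 else fun _ => 0)
    else if j.val = 0 then fun s => -c (γ s) else fun _ => 0 with hA
  set F : Fin r → ℝ → ℂ := fun i => if i.val + 1 < r then fun _ => 0 else fun s => d (γ s)
    with hF
  have hAB : ∀ i j, IsBoundaryValue γ (A i j) := by
    intro i j
    simp only [hA]
    split_ifs
    exacts [.const 1, .const 0, hcB, .const 0]
  have hFB : ∀ i, IsBoundaryValue γ (F i) := by
    intro i
    simp only [hF]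
    split_ifs
    exacts [.const 0, hdB]
  obtain ⟨y, hyB, hy0, hy⟩ := hγ.exists_linear_system hAB hFB s₀ e
  choose H hH hHy using hyB
  -- From index r on, X is defined by the right-hand side of the equation, so that X 0, …, X r is a
  -- full chain of derivatives along the contour.
  set X : ℕ → ℂ → ℂ := fun k z =>
    if hk : k < r then H ⟨k, hk⟩ z else d z - c z * H ⟨0, hr⟩ z with hX
  have hXlt : ∀ k (hk : k < r), X k = H ⟨k, hk⟩ := fun k hk => by
    ext z
    simp only [hX, dif_pos hk]
  have hXr : X r = fun z => d z - c z * H ⟨0, hr⟩ z := by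
    ext z
    simp only [hX, lt_irrefl, dif_neg, not_false_eq_true]
  have hXd : ∀ k < r, ∀ s, HasDerivAt (fun s => X k (γ s)) (X (k + 1) (γ s) * deriv γ s) s := by
    intro k hk s
    simp only [hXlt k hk, hHy]
    convert! hy ⟨k, hk⟩ s using 2
    rcases Nat.lt_or_ge (k + 1) r with h | h
    · rw [hXlt _ h, hHy, Finset.sum_eq_single ⟨k + 1, h⟩]
      · simp [hA, hF, h]
      · intro j _ hj
        have : j.val ≠ k + 1 := fun h' => hj (Fin.ext h')
        simp [hA, h, this]
      · simp
    · have hk1 : k + 1 = r := by omega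
      rw [hk1, hXr, Finset.sum_eq_single ⟨0, hr⟩]
      · simp [hA, hF, hk1, hHy]
        ring
      · intro j _ hj
        have : j.val ≠ 0 := fun h' => hj (Fin.ext h')
        simp [hA, hk1, this]
      · simp
  have hHc : ∀ i, ContinuousOn (H i) (closure (inside γ)) := fun i => (hH i).continuousOn
  have hXc : ∀ k ≤ r, ContinuousOn (X k) (closure (inside γ)) := by
    intro k hk
    rcases hk.lt_or_eq with h | rfl
    · rw [hXlt k h]
      exact hHc _
    · rw [hXr]
      exact hd.continuousOn.sub (hc.continuousOn.mul (hHc _))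
  have hXe := hγ.contourDeriv_eq hXd
  have hX0 : X 0 = H ⟨0, hr⟩ := hXlt 0 hr
  refine ⟨X 0, ⟨hXc 0 (Nat.zero_le r), ?_, ?_⟩, fun t ht => ?_, fun k => ?_⟩
  · rw [hX0]
    exact (hH _).differentiableOn.analyticOnNhd hγ.isOpen_inside
  · rw [Nat.add_sub_cancel]
    refine ⟨hγ.contDiffOn_trace hXd ((hXc r le_rfl).mono hγ.trace_subset_closure), ?_⟩
    -- The equation expresses the top derivative through c, d and X 0, so it is itself C¹ in the
    -- parameter, hence Hölder for every exponent up to 1. Here r ≥ 1 supplies the derivative X 1 of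
    -- X 0.
    have hder : ∀ s, HasDerivAt (fun s => X r (γ s)) (deriv d (γ s) * deriv γ s
        - (deriv c (γ s) * deriv γ s * X 0 (γ s) + c (γ s) * (X 1 (γ s) * deriv γ s))) s := by
      intro s
      rw [hXr, ← hX0]
      exact (hγ.hasDerivAt_comp hd s).sub ((hγ.hasDerivAt_comp hc s).mul (hXd 0 hr s))
    have h1 := hγ.continuous_comp (hXc 0 (Nat.zero_le r))
    have h2 := hγ.continuous_comp (hXc 1 hr)
    have h3 := hγ.continuous_comp hc.continuousOn
    have h4 := hγ.continuous_deriv_comp hc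
    have h5 := hγ.continuous_deriv_comp hd
    have h6 := hγ.continuous_deriv
    obtain ⟨M, hM⟩ := hγ.exists_holderOnWith hder
      ((h5.mul h6).sub (((h4.mul h6).mul h1).add (h3.mul (h2.mul h6)))) hα
    refine ⟨M, fun t ht t' ht' => ?_⟩
    rw [hXe r le_rfl t ht, hXe r le_rfl t' ht']
    exact hM t ht t' ht'
  · rw [hXe r le_rfl t ht, hXr, hX0]
  · rw [hXe k k.2.le _ ⟨s₀, rfl⟩, hXlt k k.2, hHy, hy0]

/-- Taking the k-th contour derivative of a linear relation at γ s₀ isolates its k-th coefficient.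
-/
theorem IsSmoothContour.linearIndependent_of_contourDeriv {r : ℕ} {x : Fin r → ℂ → ℂ}
    (hx : ∀ j, ContDiffOn ℂ r (x j) (trace γ)) (s₀ : ℝ)
    (h : ∀ j k : Fin r, contourDeriv γ k (x j) (γ s₀) = (Pi.single j 1 : Fin r → ℂ) k) :
    LinearIndependent ℂ (fun j => fun t : trace γ => x j t) := by
  rw [Fintype.linearIndependent_iff]
  intro g hg k
  set X : ℕ → ℂ → ℂ := fun k z => ∑ j, g j * contourDeriv γ k (x j) z with hX
  have hXd : ∀ k < r, ∀ s, HasDerivAt (fun s => X k (γ s)) (X (k + 1) (γ s) * deriv γ s) s := by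
    intro k hk s
    simp only [hX, Finset.sum_mul]
    refine HasDerivAt.fun_sum fun j _ => ?_
    rw [mul_assoc]
    exact (hγ.hasDerivAt_contourDeriv (hx j) hk s).const_mul (g j)
  have h0 : EqOn (X 0) (fun _ => 0) (trace γ) := fun t ht => by
    have := congrFun hg ⟨t, ht⟩
    simpa [hX, contourDeriv] using this
  have h1 : X k (γ s₀) = g k := by
    simp only [hX, h]
    rw [Finset.sum_eq_single k]
    · simp
    · intro j _ hj
      simp [Pi.single_eq_of_ne (Ne.symm hj)]
    · simp
  rw [← h1, ← hγ.contourDeriv_eq hXd k k.2.le _ ⟨s₀, rfl⟩, contourDeriv,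
    iteratedDerivWithin_congr h0 ⟨s₀, rfl⟩]
  exact iteratedDerivWithin_fun_const_zero

/-- Variation of constants along the contour. -/
theorem IsSmoothContour.eq_firstOrderSolution {P Q x : ℂ → ℂ} (hP : Continuous fun s => P (γ s))
    (hQ : Continuous fun s => Q (γ s))
    (hx : ∀ s, HasDerivAt (fun s => x (γ s)) ((Q (γ s) - P (γ s) * x (γ s)) * deriv γ s) s)
    (s₀ s : ℝ) : x (γ s) = firstOrderSolution γ P Q s₀ (x (γ s₀)) s := by
  have hcγ' := hγ.continuous_deriv
  have hPc : Continuous fun u => P (γ u) * deriv γ u := hP.mul hcγ'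
  have hE : ∀ s, HasDerivAt (fun s => arcIntegral γ P s₀ s) (P (γ s) * deriv γ s) s := fun s =>
    intervalIntegral.integral_hasDerivAt_right (hPc.intervalIntegrable _ _)
      hPc.aestronglyMeasurable.stronglyMeasurableAtFilter hPc.continuousAt
  have hEc : Continuous fun s => arcIntegral γ P s₀ s :=
    continuous_iff_continuousAt.2 fun s => (hE s).continuousAt
  -- The integrating factor exp ∫P cancels the term P x. It is used on the parameter line, where it
  -- need not be periodic, so s₀ and s may be arbitrary.
  have hd : ∀ u ∈ uIcc s₀ s, HasDerivAt (fun s => x (γ s) * Complex.exp (arcIntegral γ P s₀ s))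
      (Q (γ u) * Complex.exp (arcIntegral γ P s₀ u) * deriv γ u) u := fun u _ => by
    convert! (hx u).fun_mul (hE u).cexp using 1
    ring
  have h1 := intervalIntegral.integral_eq_sub_of_hasDerivAt hd
    (((hQ.mul hEc.cexp).mul hcγ').intervalIntegrable _ _)
  have h2 : arcIntegral γ P s₀ s₀ = 0 := intervalIntegral.integral_same
  rw [firstOrderSolution, h1, h2, Complex.exp_zero, mul_one, add_sub_cancel, mul_left_comm,
    ← Complex.exp_add, neg_add_cancel, Complex.exp_zero, mul_one]

theorem IsSmoothContour.isAdmissible_one {α : ℝ≥0} (hα : α ≤ 1) {g : ℂ → ℂ}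
    (hg : AnalyticOnNhd ℂ g (closure (inside γ))) : IsAdmissible γ 1 α g := by
  refine ⟨hg.continuousOn, hg.mono subset_closure, ?_, ?_⟩
  · rw [Nat.sub_self, Nat.cast_zero, contDiffOn_zero]
    exact hg.continuousOn.mono hγ.trace_subset_closure
  · obtain ⟨M, hM⟩ := hγ.exists_holderOnWith (hγ.hasDerivAt_comp hg)
      ((hγ.continuous_deriv_comp hg).mul hγ.continuous_deriv) hα
    refine ⟨M, ?_⟩
    have h1 : contourDeriv γ (1 - 1) g = g := by
      ext t
      simp [contourDeriv]
    rwa [h1]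

end

/-- Solutions of the singular integral equation with given initial values. -/
theorem IsSmoothContour.exists_solvesEquation {r : ℕ} (hr : 1 ≤ r)
    (hγ : IsSmoothContour (r + 1) γ) {α : ℝ≥0} (hα : 0 < α) (hα1 : α ≤ 1) {a b f : ℂ → ℂ}
    (ha : AnalyticOnNhd ℂ a (closure (inside γ))) (hb : AnalyticOnNhd ℂ b (closure (inside γ)))
    (hf : AnalyticOnNhd ℂ f (closure (inside γ))) (hb0 : ∀ z ∈ closure (inside γ), b z ≠ 0)
    (s₀ : ℝ) (e : Fin r → ℂ) : ∃ x : ℂ → ℂ, IsAdmissible γ (r + 1) α x ∧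
      SolvesEquation γ (r + 1) a b f x ∧ ∀ k : Fin r, contourDeriv γ k x (γ s₀) = e k := by
  have hγ1 := hγ.toOne (by omega)
  have hc : AnalyticOnNhd ℂ (fun z => (r.factorial : ℂ) * a z / b z) (closure (inside γ)) :=
    (analyticOnNhd_const.mul ha).div hb hb0
  have hd : AnalyticOnNhd ℂ (fun z => (r.factorial : ℂ) * f z / b z) (closure (inside γ)) :=
    (analyticOnNhd_const.mul hf).div hb hb0
  obtain ⟨x, hx, hxe, hxi⟩ := hγ1.exists_solution hr hα1 hc hd s₀ e
  refine ⟨x, hx, (hx.solvesEquation_iff hγ hα).2 fun t ht => ?_, hxi⟩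
  have h1 := hb0 t (hγ1.trace_subset_closure ht)
  have h2 : (r.factorial : ℂ) ≠ 0 := by exact_mod_cast r.factorial_ne_zero
  rw [hxe t ht]
  field_simp
  ring

theorem div_factorial_ode {A B F X Y : ℂ} {r : ℕ}
    (h : B / (r.factorial : ℂ) * Y + A * X = F) (hB : B ≠ 0) :
    Y + (r.factorial : ℂ) * (A / B) * X = (r.factorial : ℂ) * F / B := by
  have h2 : (r.factorial : ℂ) ≠ 0 := by exact_mod_cast r.factorial_ne_zero
  rw [← h]
  field_simp

/-- Solutions of the equation with a pole of order two satisfy a linear equation of first order. -/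
theorem IsAdmissible.eq_firstOrderSolution (hγ : IsSmoothContour 2 γ) {α : ℝ≥0} (hα : 0 < α)
    {a b f x : ℂ → ℂ} (ha : ContinuousOn a (closure (inside γ)))
    (hb : ContinuousOn b (closure (inside γ))) (hf : ContinuousOn f (closure (inside γ)))
    (hb0 : ∀ t ∈ trace γ, b t ≠ 0) (hx : IsAdmissible γ 2 α x)
    (hxs : SolvesEquation γ 2 a b f x) (s₀ s : ℝ) :
    x (γ s) = firstOrderSolution γ (fun t => a t / b t) (fun t => f t / b t) s₀ (x (γ s₀)) s := by
  have hγ1 := hγ.toOne (by omega)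
  have hode := (IsAdmissible.solvesEquation_iff (r := 1) hγ hα hx).1 hxs
  have hbc := hγ1.continuous_comp hb
  have hb0' : ∀ s, b (γ s) ≠ 0 := fun s => hb0 _ ⟨s, rfl⟩
  refine hγ1.eq_firstOrderSolution ((hγ1.continuous_comp ha).div hbc hb0')
    ((hγ1.continuous_comp hf).div hbc hb0') (fun s => ?_) s₀ s
  have h1 := hγ1.hasDerivAt_contourDeriv (r := 1) hx.wHolder.1 Nat.zero_lt_one s
  have h2 := div_factorial_ode (r := 1) (hode _ ⟨s, rfl⟩) (hb0' s)
  simp only [contourDeriv, iteratedDerivWithin_zero] at h1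
  convert! h1 using 2
  rw [Nat.factorial_one, Nat.cast_one, one_mul, one_mul, contourDeriv] at h2
  rw [← h2]
  ring

end

end Hypersingular

end

theorem mainTheorem1 (p : ℕ) (hp : 1 ≤ p) (γ : ℝ → ℂ)
    (hγ : Hypersingular.IsSmoothContour p γ)
    (α : ℝ≥0) (hα : 0 < α) (hα1 : α ≤ 1)
    (G : Set ℂ) (hG : IsOpen G) (hDG : closure (Hypersingular.inside γ) ⊆ G)
    (a b f : ℂ → ℂ)
    (ha : AnalyticOnNhd ℂ a G) (hb : AnalyticOnNhd ℂ b G) (hf : AnalyticOnNhd ℂ f G)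
    (ha0 : ∀ z ∈ Hypersingular.inside γ, a z ≠ 0) :
    -- the finite-part identity
    (∀ x : ℂ → ℂ, Hypersingular.IsAdmissible γ p α x → ∀ t ∈ Hypersingular.trace γ,
      ∃ I : ℂ, Hypersingular.HasFinitePart γ p x t I ∧
        1 / (Real.pi * Complex.I) * I =
          Hypersingular.contourDeriv γ (p - 1) x t / ((p - 1).factorial : ℂ)) ∧
    -- reduction to the differential equation, on the contour and in the inner domain
    (∀ x : ℂ → ℂ, Hypersingular.IsAdmissible γ p α x →
      Hypersingular.SolvesEquation γ p a b f x →
      (∀ t ∈ Hypersingular.trace γ,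
        b t / ((p - 1).factorial : ℂ) * Hypersingular.contourDeriv γ (p - 1) x t + a t * x t
          = f t ∧
        (b t ≠ 0 → Hypersingular.contourDeriv γ (p - 1) x t
          + ((p - 1).factorial : ℂ) * (a t / b t) * x t
            = ((p - 1).factorial : ℂ) * f t / b t)) ∧
      (∀ z ∈ Hypersingular.inside γ,
        b z / ((p - 1).factorial : ℂ) * iteratedDeriv (p - 1) x z + a z * x z = f z ∧
        (b z ≠ 0 → iteratedDeriv (p - 1) x z
          + ((p - 1).factorial : ℂ) * (a z / b z) * x z
            = ((p - 1).factorial : ℂ) * f z / b z))) ∧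
    -- at least `p - 1` linearly independent solutions
    ((∀ z ∈ closure (Hypersingular.inside γ), b z ≠ 0) →
      ∃ x : Fin (p - 1) → ℂ → ℂ,
        (∀ j, Hypersingular.IsAdmissible γ p α (x j) ∧
          Hypersingular.SolvesEquation γ p a b f (x j)) ∧
        LinearIndependent ℂ (fun j => fun t : Hypersingular.trace γ => x j t)) ∧
    -- the explicit solution for `p = 1`
    (p = 1 → (∀ z ∈ closure (Hypersingular.inside γ), a z + b z ≠ 0) →
      Hypersingular.IsAdmissible γ p α (fun z => f z / (a z + b z)) ∧
      Hypersingular.SolvesEquation γ p a b f (fun z => f z / (a z + b z)) ∧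
      ∀ x : ℂ → ℂ, Hypersingular.IsAdmissible γ p α x →
        Hypersingular.SolvesEquation γ p a b f x →
        ∀ z ∈ closure (Hypersingular.inside γ), x z = f z / (a z + b z)) ∧
    -- the explicit solutions for `p = 2`
    (p = 2 →
      ((∀ t ∈ Hypersingular.trace γ, b t ≠ 0) →
        ∀ x : ℂ → ℂ, Hypersingular.IsAdmissible γ p α x →
          Hypersingular.SolvesEquation γ p a b f x →
          ∀ s₀ s : ℝ, x (γ s) = Hypersingular.firstOrderSolution γ (fun t => a t / b t)
            (fun t => f t / b t) s₀ (x (γ s₀)) s) ∧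
      ((∀ z ∈ closure (Hypersingular.inside γ), b z ≠ 0) →
        ∀ (s₀ : ℝ) (c : ℂ), ∃ x : ℂ → ℂ, Hypersingular.IsAdmissible γ p α x ∧
          Hypersingular.SolvesEquation γ p a b f x ∧ x (γ s₀) = c ∧
          ∀ s : ℝ, x (γ s) = Hypersingular.firstOrderSolution γ (fun t => a t / b t)
            (fun t => f t / b t) s₀ c s)) := by
  obtain ⟨r, rfl⟩ : ∃ r, p = r + 1 := ⟨p - 1, by omega⟩
  have hγ1 := hγ.toOne hp
  have ha' := ha.mono hDG
  have hb' := hb.mono hDG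
  have hf' := hf.mono hDG
  simp only [Nat.add_sub_cancel]
  refine ⟨fun x hx t ht => ⟨_, hγ.hasFinitePart hα hx ht, ?_⟩, fun x hx hxs => ?_,
    fun hb0 => ?_, fun hr hab => ?_, fun hr => ⟨fun hb0 x hx hxs => ?_, fun hb0 s₀ c => ?_⟩⟩
  · have hπ : (Real.pi : ℂ) * Complex.I ≠ 0 :=
      mul_ne_zero (by exact_mod_cast Real.pi_ne_zero) Complex.I_ne_zero
    rw [one_div, inv_mul_cancel_left₀ hπ]
  · have h1 := (hx.solvesEquation_iff hγ hα).1 hxs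
    have h2 := hx.differentialEquation_inside hγ1
      (Hypersingular.diffContOnCl_of_analyticOnNhd ha')
      (Hypersingular.diffContOnCl_of_analyticOnNhd hb')
      (Hypersingular.diffContOnCl_of_analyticOnNhd hf') _ h1
    exact ⟨fun t ht => ⟨h1 t ht, Hypersingular.div_factorial_ode (h1 t ht)⟩,
      fun z hz => ⟨h2 z hz, Hypersingular.div_factorial_ode (h2 z hz)⟩⟩
  -- For p = 1 the required family is empty; the companion system needs at least one unknown.
  · rcases Nat.eq_zero_or_pos r with rfl | hr
    · have : IsEmpty (Fin (0 + 1 - 1)) := inferInstanceAs (IsEmpty (Fin 0))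
      exact ⟨fun _ => 0, fun j => j.elim0, linearIndependent_empty_type⟩
    choose x hx hxs hxi using fun j : Fin r =>
      hγ.exists_solvesEquation hr hα hα1 ha' hb' hf' hb0 0 (Pi.single j 1)
    exact ⟨x, fun j => ⟨hx j, hxs j⟩,
      hγ1.linearIndependent_of_contourDeriv (fun j => (hx j).wHolder.1) 0 hxi⟩
  · obtain rfl : r = 0 := by omega
    have hg := hf'.div (ha'.add hb') hab
    have hga : Hypersingular.IsAdmissible γ (0 + 1) α (fun z => f z / (a z + b z)) :=
      hγ1.isAdmissible_one hα1 hg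
    have hcd : ∀ (x : ℂ → ℂ) t, Hypersingular.contourDeriv γ 0 x t = x t := fun x t => by
      simp [Hypersingular.contourDeriv]
    refine ⟨hga, (hga.solvesEquation_iff hγ hα).2 fun t ht => ?_, fun x hx hxs => ?_⟩
    · have h1 := hab t (hγ1.trace_subset_closure ht)
      rw [hcd, Nat.factorial_zero, Nat.cast_one, div_one, ← add_mul, add_comm (b t),
        mul_div_cancel₀ _ h1]
    · have h1 : ∀ t ∈ Hypersingular.trace γ, x t = f t / (a t + b t) := fun t ht => by
        have h2 := (hx.solvesEquation_iff hγ hα).1 hxs t ht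
        rw [hcd, Nat.factorial_zero, Nat.cast_one, div_one] at h2
        rw [eq_div_iff (hab t (hγ1.trace_subset_closure ht))]
        linear_combination h2
      intro z hz
      rw [hγ1.closure_inside] at hz
      rcases hz with hz | hz
      -- For p = 1 the equation on L is algebraic and fixes x there; Cauchy's formula propagates the
      -- equality into the inner domain.
      · exact sub_eq_zero.1 (hγ1.eqOn_zero (hx.diffContOnCl.sub hga.diffContOnCl)
          (fun t ht => sub_eq_zero.2 (h1 t ht)) hz)
      · exact h1 z hz
  · obtain rfl : r = 1 := by omega
    exact hx.eq_firstOrderSolution hγ hα ha'.continuousOn hb'.continuousOn hf'.continuousOn hb0 hxs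
  · obtain rfl : r = 1 := by omega
    obtain ⟨x, hx, hxs, hxi⟩ :=
      hγ.exists_solvesEquation le_rfl hα hα1 ha' hb' hf' hb0 s₀ fun _ => c
    have h0 : x (γ s₀) = c := by simpa [Hypersingular.contourDeriv] using hxi 0
    refine ⟨x, hx, hxs, h0, fun s => ?_⟩
    have h1 := hx.eq_firstOrderSolution hγ hα ha'.continuousOn hb'.continuousOn hf'.continuousOn
      (fun t ht => hb0 t (hγ1.trace_subset_closure ht)) hxs s₀ s
    rwa [h0] at h1
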